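/- Conventions. All vector spaces are over $\mathbb{Q}$ and bigraded, $V=\bigoplus_{n,i\in\mathbb{Z}}V_{n,i}$, where $n$ is the weight and $i$ the homological degree; $V[1]_{n,i}=V_{n,i-1}$, and $V^0$ is the part of even homological degree. A homogeneous element of bidegree $(n,i)$ with $n\neq 0$ has slope $i/n$, and $V_C$ is the span of the homogeneous elements of slope $C$. An inequality $m_{\max}(V)\le C$ (resp. $<C$, and similarly for $m_{\min}$) means that $V$ is concentrated in nonzero weights and that all its nonzero homogeneous elements have slope $\le C$ (resp. $<C$). For $C=b/a$ in lowest terms with $a>0$, a ray of slope $C$ in $V$ is a subspace $\bigoplus_{u\ge 0}V_{au,bu+i_0}$ with $i_0\in\mathbb{Z}$; its graded dimension is the function equal to $\dim V_{n,Cn+i_0}$ if $a\mid n$ and to $0$ otherwise ($n\ge0$). Lie algebras are Lie algebras in bigraded vector spaces, with Koszul signs in the homological degree only. The Lie algebra homology $H^{\mathrm{Lie}}_*(\mathfrak{g})$ is the homology of the Chevalley–Eilenberg complex $\mathrm{Sym}(\mathfrak{g}[1])$ (graded symmetric algebra) with the coderivation differential determined by $\partial(xy)=(-1)^{d(x)}[x,y]$,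 where $d(x)$ is the degree of $x$ in $\mathfrak{g}$. A quasi-polynomial is a polynomial whose coefficients are periodic functions $\mathbb{Z}\to\mathbb{Q}$; its period is the least common multiple of the periods of its coefficients. Finally, $\mathrm{lcm}(V)$ is the least common multiple of the weights $n$ such that $V_{n,i}\ne0$ for some $i$. Statement. Let $\mathfrak{g}$ be a finite dimensional Lie algebra such that $\mathfrak{g}[1]$ is concentrated in bidegrees $(n,i)$ with $n,i\ge 0$ and $\mathfrak{g}[1]_{0,0}=0$. Let $\mathfrak{h}\subseteq\mathfrak{g}$ be a (bigraded) central subalgebra and $C\in\mathbb{Q}$, and suppose that $$m_{\max}(\mathfrak{h}[1]^0)\le C\quad\text{and}\quad m_{\max}((\mathfrak{g}/\mathfrak{h})[1]^0)<C,$$ or, in the minimal slope version, that $$m_{\min}(\mathfrak{h}[1]^0)\ge C\quad\text{and}\quad m_{\min}((\mathfrak{g}/\mathfrak{h})[1]^0)>C.$$ Let $\tilde{\mathfrak{g}}=\mathfrak{g}\rtimes\mathfrak{l}$ be a semidirect product, where $\mathfrak{l}$ is a free Lie algebra on finitely many homogeneous generators, and suppose that $\mathfrak{l}$ centralizes every odd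 degree element of $\mathfrak{h}$ having slope $C$ in $\mathfrak{h}[1]$, that is, every element of $\mathfrak{h}[1]^0_C$. Then $\mathfrak{h}[1]^0_C$ is central in $\tilde{\mathfrak{g}}$, so that multiplication in $\mathrm{Sym}(\tilde{\mathfrak{g}}[1])$ induces an action of $\mathrm{Sym}(\mathfrak{h}[1]^0_C)$ on $H^{\mathrm{Lie}}_*(\tilde{\mathfrak{g}})$, and each ray of slope $C$ in $H^{\mathrm{Lie}}_*(\tilde{\mathfrak{g}})$ is a finitely generated $\mathrm{Sym}(\mathfrak{h}[1]^0_C)$-submodule. In particular, the bigraded pieces of such a ray are finite dimensional, and its graded dimension is, for all sufficiently large $n$, equal to a quasi-polynomial in $n$ of degree at most $\dim(\mathfrak{h}[1]^0_C)-1$ (the zero polynomial if $\mathfrak{h}[1]^0_C=0$) and of period dividing $\mathrm{lcm}(\mathfrak{h}[1]^0_C)$. -/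

import Mathlib

noncomputable section

/-- The sign `(-1)^n`. -/
def koszulSign (n : ℤ) : ℚ := ((n.negOnePow : ℤ) : ℚ)

theorem koszulSign_even {n : ℤ} (h : Even n) : koszulSign n = 1 := by
  simp [koszulSign, Int.negOnePow_even n h]

theorem koszulSign_odd {n : ℤ} (h : Odd n) : koszulSign n = -1 := by
  simp [koszulSign, Int.negOnePow_odd n h]

theorem koszulSign_add (m n : ℤ) : koszulSign (m + n) = koszulSign m * koszulSign n := by
  simp [koszulSign, Int.negOnePow_add]

/-! ## Graded families of subspaces, shifts, parity and slopes -/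

/-- A `ℤ × ℤ`-indexed family of subspaces of a rational vector space: `V n i` is the part of
weight `n` and (homological) degree `i`. -/
abbrev BigradedFamily (V : Type*) [AddCommGroup V] [Module ℚ V] := ℤ → ℤ → Submodule ℚ V

namespace BigradedFamily

variable {V : Type*} [AddCommGroup V] [Module ℚ V]

/-- The suspension `V[1]`, with `(V[1])_{n,i} = V_{n,i-1}`. -/
def shift (𝒱 : BigradedFamily V) : BigradedFamily V := fun n i => 𝒱 n (i - 1)

open Classical in
/-- The part `V^0` of even homological degree. -/
def even (𝒱 : BigradedFamily V) : BigradedFamily V :=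
  fun n i => if Even i then 𝒱 n i else ⊥

/-- The bigraded pieces of a (homogeneous) subspace `S`. -/
def restrict (𝒱 : BigradedFamily V) (S : Submodule ℚ V) : BigradedFamily V :=
  fun n i => 𝒱 n i ⊓ S

/-- The bigraded pieces of the quotient by a (homogeneous) subspace `S`. -/
def quotient (𝒱 : BigradedFamily V) (S : Submodule ℚ V) : BigradedFamily (V ⧸ S) :=
  fun n i => (𝒱 n i).map S.mkQ

/-- All pieces outside of the first quadrant vanish. -/
def FirstQuadrant (𝒱 : BigradedFamily V) : Prop :=
  ∀ n i : ℤ, n < 0 ∨ i < 0 → 𝒱 n i = ⊥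

/-- The piece of bidegree `(0,0)` vanishes. -/
def Connected (𝒱 : BigradedFamily V) : Prop := 𝒱 0 0 = ⊥

/-- `V` is concentrated in nonzero weights and the slope `i / n` of every nonzero homogeneous
element of bidegree `(n,i)` satisfies `P`. -/
def SlopesSatisfy (𝒱 : BigradedFamily V) (P : ℚ → Prop) : Prop :=
  ∀ n i : ℤ, 𝒱 n i ≠ ⊥ → n ≠ 0 ∧ P ((i : ℚ) / (n : ℚ))

open Classical in
/-- The part `V_C` spanned by the homogeneous elements of slope `C`. -/
def ofSlope (𝒱 : BigradedFamily V) (C : ℚ) : BigradedFamily V :=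
  fun n i => if n ≠ 0 ∧ (i : ℚ) / (n : ℚ) = C then 𝒱 n i else ⊥

/-- The subspace spanned by all the pieces. -/
def total (𝒱 : BigradedFamily V) : Submodule ℚ V := ⨆ p : ℤ × ℤ, 𝒱 p.1 p.2

/-- `lcm(V)`, the least common multiple of the weights in which `V` is nonzero. -/
def weightLcm (𝒱 : BigradedFamily V) : ℕ :=
  sInf {N : ℕ | 0 < N ∧ ∀ n i : ℤ, 𝒱 n i ≠ ⊥ → n ∣ (N : ℤ)}

/-- The ray `⨁_{u ≥ 0} V_{au, bu + i₀}` of slope `C = b / a`, with `a > 0` and `(a,b) = 1`. -/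
def ray (𝒱 : BigradedFamily V) (C : ℚ) (i₀ : ℤ) : Submodule ℚ V :=
  ⨆ u : ℕ, 𝒱 ((C.den : ℤ) * u) (C.num * u + i₀)

open Classical in
/-- The graded dimension of the ray `⨁_{u ≥ 0} V_{au, bu + i₀}` of slope `C = b / a`:
the function `n ↦ dim V_{n, Cn + i₀}` if `a ∣ n`, and `n ↦ 0` otherwise. -/
def rayDim (𝒱 : BigradedFamily V) (C : ℚ) (i₀ : ℤ) (n : ℕ) : ℕ :=
  if C.den ∣ n then Module.finrank ℚ (𝒱 (n : ℤ) (C.num * ((n / C.den : ℕ) : ℤ) + i₀)) else 0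

end BigradedFamily

/-- A bigrading of a rational vector space: `V = ⨁_{n,i} V_{n,i}`. -/
structure Bigrading (V : Type*) [AddCommGroup V] [Module ℚ V] where
  /-- The pieces. -/
  gr : BigradedFamily V
  /-- `V` is the internal direct sum of the pieces. -/
  isInternal : DirectSum.IsInternal (fun p : ℤ × ℤ => gr p.1 p.2)

namespace Bigrading

variable {V : Type*} [AddCommGroup V] [Module ℚ V] (𝒱 : Bigrading V)

/-- The linear operator that multiplies elements of homological degree `i` by `c i`. -/
def diag (c : ℤ → ℚ) : V →ₗ[ℚ] V :=
  (DirectSum.toModule ℚ (ℤ × ℤ) V (fun p => c p.2 • (𝒱.gr p.1 p.2).subtype)) ∘ₗ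
    ((LinearEquiv.ofBijective
      (DirectSum.coeLinearMap (fun p : ℤ × ℤ => 𝒱.gr p.1 p.2)) 𝒱.isInternal).symm : V →ₗ[ℚ] _)

theorem diag_apply (c : ℤ → ℚ) {n i : ℤ} {x : V} (hx : x ∈ 𝒱.gr n i) :
    𝒱.diag c x = c i • x := by
  have h : (LinearEquiv.ofBijective
      (DirectSum.coeLinearMap (fun p : ℤ × ℤ => 𝒱.gr p.1 p.2)) 𝒱.isInternal).symm x =
      DirectSum.lof ℚ (ℤ × ℤ) (fun p => 𝒱.gr p.1 p.2) (n, i) ⟨x, hx⟩ := by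
    rw [LinearEquiv.symm_apply_eq]
    exact (DirectSum.coeLinearMap_lof (fun p : ℤ × ℤ => 𝒱.gr p.1 p.2) (n, i) ⟨x, hx⟩).symm
  simp only [diag, LinearMap.comp_apply, LinearEquiv.coe_coe, h, DirectSum.toModule_lof]
  simp

theorem induction {p : V → Prop} (hom : ∀ (n i : ℤ) (x : V), x ∈ 𝒱.gr n i → p x)
    (zero : p 0) (add : ∀ x y, p x → p y → p (x + y)) (x : V) : p x := by
  have hx : x ∈ ⨆ q : ℤ × ℤ, 𝒱.gr q.1 q.2 := by
    rw [𝒱.isInternal.submodule_iSup_eq_top]; trivial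
  induction hx using Submodule.iSup_induction' with
  | mem q y hy => exact hom _ _ y hy
  | zero => exact zero
  | add x y _ _ h1 h2 => exact add x y h1 h2

/-- The parity operator `x ↦ (-1)^{d(x)} x`. -/
def sign : V →ₗ[ℚ] V := 𝒱.diag koszulSign

open Classical in
/-- The projection onto the part of even homological degree. -/
def evenProj : V →ₗ[ℚ] V := 𝒱.diag (fun i => if Even i then 1 else 0)

open Classical in
/-- The projection onto the part of odd homological degree. -/
def oddProj : V →ₗ[ℚ] V := 𝒱.diag (fun i => if Even i then 0 else 1)

end Bigrading

/-! ## The symmetric algebra with Koszul signs -/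

section Sym

variable {V : Type*} [AddCommGroup V] [Module ℚ V]

/-- The relations `x y = (-1)^{d(x)d(y)} y x` on homogeneous elements. -/
inductive KoszulRel (𝒱 : BigradedFamily V) : TensorAlgebra ℚ V → TensorAlgebra ℚ V → Prop
  | comm {m i n j : ℤ} {x y : V} (hx : x ∈ 𝒱 m i) (hy : y ∈ 𝒱 n j) :
      KoszulRel 𝒱 (TensorAlgebra.ι ℚ x * TensorAlgebra.ι ℚ y)
        (koszulSign (i * j) • (TensorAlgebra.ι ℚ y * TensorAlgebra.ι ℚ x))

/-- The symmetric algebra of a bigraded vector space, with Koszul signs in the homological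
degree (and not in the weight). -/
def KoszulSym (𝒱 : BigradedFamily V) : Type _ := RingQuot (KoszulRel 𝒱)

instance (𝒱 : BigradedFamily V) : Ring (KoszulSym 𝒱) :=
  inferInstanceAs (Ring (RingQuot (KoszulRel 𝒱)))

instance (𝒱 : BigradedFamily V) : Algebra ℚ (KoszulSym 𝒱) :=
  inferInstanceAs (Algebra ℚ (RingQuot (KoszulRel 𝒱)))

namespace KoszulSym

variable (𝒱 : BigradedFamily V)

/-- The projection from the tensor algebra. -/
def mk : TensorAlgebra ℚ V →ₐ[ℚ] KoszulSym 𝒱 := RingQuot.mkAlgHom ℚ (KoszulRel 𝒱)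

/-- The inclusion of the generators. -/
def ι : V →ₗ[ℚ] KoszulSym 𝒱 := (mk 𝒱).toLinearMap ∘ₗ TensorAlgebra.ι ℚ

theorem ι_mul_ι {m i n j : ℤ} {x y : V} (hx : x ∈ 𝒱 m i) (hy : y ∈ 𝒱 n j) :
    ι 𝒱 x * ι 𝒱 y = koszulSign (i * j) • (ι 𝒱 y * ι 𝒱 x) := by
  have h : mk 𝒱 _ = mk 𝒱 _ := RingQuot.mkAlgHom_rel ℚ (KoszulRel.comm (𝒱 := 𝒱) hx hy)
  rw [map_smul, map_mul, map_mul] at h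
  exact h

variable {𝒱} in
/-- The universal property of the symmetric algebra. -/
def lift {A : Type*} [Semiring A] [Algebra ℚ A] (φ : V →ₗ[ℚ] A)
    (hφ : ∀ (m i n j : ℤ) (x y : V), x ∈ 𝒱 m i → y ∈ 𝒱 n j →
      φ x * φ y = koszulSign (i * j) • (φ y * φ x)) : KoszulSym 𝒱 →ₐ[ℚ] A :=
  RingQuot.liftAlgHom ℚ ⟨TensorAlgebra.lift ℚ φ, by
    rintro _ _ ⟨hx, hy⟩
    simpa using hφ _ _ _ _ _ _ hx hy⟩

theorem lift_ι {A : Type*} [Semiring A] [Algebra ℚ A] (φ : V →ₗ[ℚ] A) (hφ) (x : V) :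
    lift (𝒱 := 𝒱) φ hφ (ι 𝒱 x) = φ x :=
  (RingQuot.liftAlgHom_mkAlgHom_apply ℚ _ _ _).trans (TensorAlgebra.lift_ι_apply φ x)

/-- To prove a statement about the symmetric algebra, it suffices to consider left
multiplication by generators. -/
theorem induction {p : KoszulSym 𝒱 → Prop} (one : p 1) (add : ∀ a b, p a → p b → p (a + b))
    (smul : ∀ (r : ℚ) a, p a → p (r • a)) (ι_mul : ∀ x a, p a → p (ι 𝒱 x * a))
    (a : KoszulSym 𝒱) : p a := by
  suffices h : ∀ (t : TensorAlgebra ℚ V) (a : KoszulSym 𝒱), p a → p (mk 𝒱 t * a) by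
    obtain ⟨t, rfl⟩ : ∃ t, mk 𝒱 t = a := RingQuot.mkAlgHom_surjective ℚ (KoszulRel 𝒱) a
    simpa using h t 1 one
  intro t
  induction t using TensorAlgebra.induction with
  | algebraMap r =>
    intro a ha
    rw [AlgHom.commutes, ← Algebra.smul_def]
    exact smul r a ha
  | ι x => intro a ha; exact ι_mul x a ha
  | mul s t hs ht => intro a ha; rw [map_mul, mul_assoc]; exact hs _ (ht _ ha)
  | add s t hs ht => intro a ha; rw [map_add, add_mul]; exact add _ _ (hs _ ha) (ht _ ha)

/-- The bigraded pieces of the symmetric algebra, spanned by the products of homogeneous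
elements whose bidegrees add up to `(n,i)`. -/
def gr : BigradedFamily (KoszulSym 𝒱) := fun n i =>
  Submodule.span ℚ {a | ∃ (k : ℕ) (m d : Fin k → ℤ) (x : Fin k → V),
    (∀ j, x j ∈ 𝒱 (m j) (d j)) ∧ ∑ j, m j = n ∧ ∑ j, d j = i ∧
    a = (List.ofFn (fun j => ι 𝒱 (x j))).prod}

end KoszulSym

end Sym

/-! ## Lie algebras in bigraded vector spaces -/

/-- A Lie algebra in the symmetric monoidal category of bigraded rational vector spaces
(Koszul signs in the homological degree only), with underlying vector space `L`. -/
structure BigradedLieAlgebra (L : Type*) [AddCommGroup L] [Module ℚ L] extends Bigrading L where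
  /-- The bracket. -/
  bracket : L →ₗ[ℚ] L →ₗ[ℚ] L
  bracket_mem : ∀ {m i n j : ℤ} {x y : L}, x ∈ gr m i → y ∈ gr n j →
    bracket x y ∈ gr (m + n) (i + j)
  skew : ∀ {m i n j : ℤ} {x y : L}, x ∈ gr m i → y ∈ gr n j →
    bracket x y + koszulSign (i * j) • bracket y x = 0
  jacobi : ∀ {m i n j o k : ℤ} {x y z : L}, x ∈ gr m i → y ∈ gr n j → z ∈ gr o k →
    koszulSign (i * k) • bracket (bracket x y) z +
    koszulSign (j * i) • bracket (bracket y z) x +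
    koszulSign (k * j) • bracket (bracket z x) y = 0

namespace BigradedLieAlgebra

variable {L : Type*} [AddCommGroup L] [Module ℚ L] (𝔤 : BigradedLieAlgebra L)

/-- Maps of Lie algebras: linear maps that preserve bidegrees and brackets. -/
def IsHom {K : Type*} [AddCommGroup K] [Module ℚ K] (𝔤 : BigradedLieAlgebra L)
    (𝔨 : BigradedLieAlgebra K) (f : L →ₗ[ℚ] K) : Prop :=
  (∀ (n i : ℤ) (x : L), x ∈ 𝔤.gr n i → f x ∈ 𝔨.gr n i) ∧
  ∀ x y : L, f (𝔤.bracket x y) = 𝔨.bracket (f x) (f y)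

/-- `S` is a bigraded subspace all of whose elements are central. Such an `S` is an Abelian
Lie subalgebra. -/
structure IsCentralSubalgebra (S : Submodule ℚ L) : Prop where
  homogeneous : S = ⨆ p : ℤ × ℤ, 𝔤.gr p.1 p.2 ⊓ S
  central : ∀ x ∈ S, ∀ y : L, 𝔤.bracket x y = 0

/-- `𝔩` is a free Lie algebra on finitely many homogeneous generators: there are finitely many
homogeneous elements `e k` of bidegrees `(m k, d k)` such that any choice of elements `y k` of
the same bidegrees in a Lie algebra extends uniquely to a map of Lie algebras from `𝔩`. -/
def IsFreeOfFiniteRank.{u} {L : Type u} [AddCommGroup L] [Module ℚ L]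
    (𝔩 : BigradedLieAlgebra L) : Prop :=
  ∃ (r : ℕ) (m d : Fin r → ℤ) (e : Fin r → L), (∀ k, e k ∈ 𝔩.gr (m k) (d k)) ∧
    ∀ (K : Type u) [AddCommGroup K] [Module ℚ K] (𝔨 : BigradedLieAlgebra K) (y : Fin r → K),
      (∀ k, y k ∈ 𝔨.gr (m k) (d k)) →
      ∃! f : L →ₗ[ℚ] K, 𝔩.IsHom 𝔨 f ∧ ∀ k, f (e k) = y k

/-- The maps of Lie algebras `i : 𝔤 → 𝔢` and `s : 𝔩 → 𝔢` exhibit `𝔢` as a semidirect product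
`𝔤 ⋊ 𝔩`: they are injective, the image of `i` is an ideal, and `𝔢` is the direct sum of the
images of `i` and `s`. The action of `𝔩` on `𝔤` is the restriction of the bracket of `𝔢`. -/
structure IsSemidirectProduct {G K E : Type*} [AddCommGroup G] [Module ℚ G] [AddCommGroup K]
    [Module ℚ K] [AddCommGroup E] [Module ℚ E] (𝔤 : BigradedLieAlgebra G)
    (𝔩 : BigradedLieAlgebra K) (𝔢 : BigradedLieAlgebra E) (i : G →ₗ[ℚ] E) (s : K →ₗ[ℚ] E) :
    Prop where
  isHom_left : 𝔤.IsHom 𝔢 i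
  isHom_right : 𝔩.IsHom 𝔢 s
  injective_left : Function.Injective i
  injective_right : Function.Injective s
  ideal : ∀ (e : E) (x : G), 𝔢.bracket e (i x) ∈ LinearMap.range i
  isCompl : IsCompl (LinearMap.range i) (LinearMap.range s)

/-! ## The Chevalley–Eilenberg complex -/

/-- The underlying vector space `Sym(𝔤[1])` of the Chevalley–Eilenberg complex. -/
abbrev CE : Type _ := KoszulSym 𝔤.gr.shift

/-- The inclusion of `𝔤[1]` in `Sym(𝔤[1])`. -/
abbrev ceι : L →ₗ[ℚ] 𝔤.CE := KoszulSym.ι 𝔤.gr.shift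

/-- Auxiliary operators for the differential. For `y` in `𝔤`, this is the operator
`(p, s, q) ↦ (y p, x ↦ (-1)^{d(x)} [x,y] p ± y s(x), s(y) - (-1)^{d(y)} y q)`
on `Sym(𝔤[1]) × Hom(𝔤, Sym(𝔤[1])) × Sym(𝔤[1])`, where `±` is the Koszul sign
`(-1)^{d(x)(d(y)+1)}`. -/
def ceStep : L →ₗ[ℚ] Module.End ℚ (𝔤.CE × (L →ₗ[ℚ] 𝔤.CE) × 𝔤.CE) :=
  LinearMap.mk₂ ℚ
    (fun y t =>
      (𝔤.ceι y * t.1,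
        LinearMap.mulRight ℚ t.1 ∘ₗ 𝔤.ceι ∘ₗ 𝔤.bracket.flip y ∘ₗ 𝔤.sign +
          LinearMap.mulLeft ℚ (𝔤.ceι (𝔤.oddProj y)) ∘ₗ t.2.1 +
          LinearMap.mulLeft ℚ (𝔤.ceι (𝔤.evenProj y)) ∘ₗ t.2.1 ∘ₗ 𝔤.sign,
        t.2.1 y - 𝔤.ceι (𝔤.sign y) * t.2.2))
    (by
      intro a b c
      refine Prod.ext ?_ (Prod.ext ?_ ?_)
      · simp [add_mul]
      · ext x; simp [add_mul]; abel
      · simp [add_mul]; abel)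
    (by
      intro r a c
      refine Prod.ext ?_ (Prod.ext ?_ ?_)
      · simp
      · ext x; simp [smul_add]
      · simp [smul_sub])
    (by
      intro a b c
      refine Prod.ext ?_ (Prod.ext ?_ ?_)
      · simp [mul_add]
      · ext x; simp [mul_add]; abel
      · simp [mul_add]; abel)
    (by
      intro r a c
      refine Prod.ext ?_ (Prod.ext ?_ ?_)
      · simp
      · ext x; simp [smul_add]
      · simp [smul_sub])


theorem ceStep_fst (y : L) (t) : (𝔤.ceStep y t).1 = 𝔤.ceι y * t.1 := rfl

theorem ceStep_snd {m i o k : ℤ} {x y : L} (hy : y ∈ 𝔤.gr.shift m i) (hx : x ∈ 𝔤.gr o k) (t) :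
    (𝔤.ceStep y t).2.1 x = koszulSign k • (𝔤.ceι (𝔤.bracket x y) * t.1) +
      koszulSign (k * i) • (𝔤.ceι y * t.2.1 x) := by
  have hy' : y ∈ 𝔤.gr m (i - 1) := hy
  simp only [ceStep, LinearMap.mk₂_apply, LinearMap.add_apply, LinearMap.comp_apply,
    LinearMap.mulRight_apply, LinearMap.mulLeft_apply, LinearMap.flip_apply,
    Bigrading.sign, Bigrading.evenProj, Bigrading.oddProj, 𝔤.toBigrading.diag_apply _ hx,
    𝔤.toBigrading.diag_apply _ hy', map_smul, LinearMap.smul_apply, smul_mul_assoc,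
    mul_smul_comm]
  rcases Int.even_or_odd i with hi | hi
  · rw [if_neg (by grind), if_neg (by grind), koszulSign_even (hi.mul_left k)]
    simp
  · rw [if_pos (by grind), if_pos (by grind)]
    rcases Int.even_or_odd k with hk | hk
    · rw [koszulSign_even (hk.mul_right i), koszulSign_even hk]; simp
    · rw [koszulSign_odd (hk.mul hi), koszulSign_odd hk]; simp

theorem ceStep_thd {m i : ℤ} {y : L} (hy : y ∈ 𝔤.gr.shift m i) (t) :
    (𝔤.ceStep y t).2.2 = t.2.1 y + koszulSign i • (𝔤.ceι y * t.2.2) := by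
  have hy' : y ∈ 𝔤.gr m (i - 1) := hy
  simp only [ceStep, LinearMap.mk₂_apply, Bigrading.sign, 𝔤.toBigrading.diag_apply _ hy',
    map_smul, smul_mul_assoc]
  rcases Int.even_or_odd i with hi | hi
  · rw [koszulSign_odd (n := i - 1) (by grind), koszulSign_even hi]; simp
  · rw [koszulSign_even (n := i - 1) (by grind), koszulSign_odd hi]; simp [sub_eq_add_neg]

theorem ceι_bracket_mul {m i n j o k : ℤ} {x y z : L} (hx : x ∈ 𝔤.gr o k)
    (hy : y ∈ 𝔤.gr.shift m i) (hz : z ∈ 𝔤.gr.shift n j) (p : 𝔤.CE) :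
    𝔤.ceι (𝔤.bracket x y) * (𝔤.ceι z * p) =
      koszulSign ((k + i) * j) • (𝔤.ceι z * (𝔤.ceι (𝔤.bracket x y) * p)) := by
  have h : 𝔤.bracket x y ∈ 𝔤.gr.shift (o + m) (k + i) := by
    have := 𝔤.bracket_mem hx hy
    rw [← add_sub_assoc] at this
    exact this
  rw [← mul_assoc, KoszulSym.ι_mul_ι 𝔤.gr.shift h hz, smul_mul_assoc, mul_assoc]

theorem ceStep_comm {m i n j : ℤ} {y z : L} (hy : y ∈ 𝔤.gr.shift m i) (hz : z ∈ 𝔤.gr.shift n j) :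
    𝔤.ceStep y * 𝔤.ceStep z = koszulSign (i * j) • (𝔤.ceStep z * 𝔤.ceStep y) := by
  have hyz : ∀ p : 𝔤.CE, 𝔤.ceι y * (𝔤.ceι z * p) =
      koszulSign (i * j) • (𝔤.ceι z * (𝔤.ceι y * p)) := fun p => by
    rw [← mul_assoc, KoszulSym.ι_mul_ι 𝔤.gr.shift hy hz, smul_mul_assoc, mul_assoc]
  have hy' : y ∈ 𝔤.gr m (i - 1) := hy
  have hz' : z ∈ 𝔤.gr n (j - 1) := hz
  refine LinearMap.ext fun t => Prod.ext ?_ (Prod.ext ?_ ?_)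
  · exact hyz t.1
  · refine LinearMap.ext fun x => ?_
    induction x using 𝔤.toBigrading.induction with
    | zero => simp
    | add a b ha hb => rw [map_add, map_add, ha, hb]
    | hom o k x hx =>
      simp only [Module.End.mul_apply, LinearMap.smul_apply, Prod.smul_snd, Prod.smul_fst,
        𝔤.ceStep_snd hy hx, 𝔤.ceStep_snd hz hx, ceStep_fst, 𝔤.ceι_bracket_mul hx hy hz,
        𝔤.ceι_bracket_mul hx hz hy, mul_add, mul_smul_comm, hyz]
      rcases Int.even_or_odd i with hi | hi <;> rcases Int.even_or_odd j with hj | hj <;>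
      rcases Int.even_or_odd k with hk | hk <;>
      simp [add_mul, koszulSign_add, koszulSign_even, koszulSign_odd, hi, hj, hk,
        Even.mul_left, Even.mul_right, Odd.mul] <;> module
  · have hs : 𝔤.bracket y z = -(koszulSign ((i - 1) * (j - 1)) • 𝔤.bracket z y) :=
      eq_neg_of_add_eq_zero_left (𝔤.skew hy' hz')
    simp only [Module.End.mul_apply, LinearMap.smul_apply, Prod.smul_snd,
        𝔤.ceStep_snd hy hz', 𝔤.ceStep_snd hz hy', 𝔤.ceStep_thd hy, 𝔤.ceStep_thd hz,
        mul_add, mul_smul_comm, hyz, hs, map_neg, map_smul, neg_mul, smul_mul_assoc,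
        sub_mul, mul_sub, one_mul, mul_one]
    rcases Int.even_or_odd i with hi | hi <;> rcases Int.even_or_odd j with hj | hj <;>
      simp [sub_eq_add_neg, koszulSign_add, koszulSign_even, koszulSign_odd, hi, hj,
        Even.mul_left, Even.mul_right, Odd.mul] <;> module

/-- The operators above satisfy the relations of `Sym(𝔤[1])`, which therefore acts. -/
def ceAction : 𝔤.CE →ₐ[ℚ] Module.End ℚ (𝔤.CE × (L →ₗ[ℚ] 𝔤.CE) × 𝔤.CE) :=
  KoszulSym.lift (𝒱 := 𝔤.gr.shift) 𝔤.ceStep fun _ _ _ _ _ _ hy hz => 𝔤.ceStep_comm hy hz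

/-- The operators `θ_x` on `Sym(𝔤[1])`: the derivations, of degree `d(x)`, that extend
`y ↦ (-1)^{d(x)} [x,y]`. -/
def ceθ (x : L) : 𝔤.CE →ₗ[ℚ] 𝔤.CE where
  toFun p := (𝔤.ceAction p (1, 0, 0)).2.1 x
  map_add' p q := by simp
  map_smul' r p := by simp

/-- The Chevalley–Eilenberg differential. It is the coderivation of `Sym(𝔤[1])` with
`∂(x y) = (-1)^{d(x)} [x,y]`, that is,
`∂(x₁ ⋯ xₖ) = ∑_{a < b} ± (-1)^{d(x_a)} [x_a, x_b] x₁ ⋯ x̂_a ⋯ x̂_b ⋯ xₖ`, where `±` is the Koszul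
sign for moving `x_a` and `x_b` to the front. Equivalently, `∂ 1 = 0` and
`∂(x p) = θ_x(p) + (-1)^{d(x) + 1} x ∂(p)`. -/
def ceD : 𝔤.CE →ₗ[ℚ] 𝔤.CE where
  toFun p := (𝔤.ceAction p (1, 0, 0)).2.2
  map_add' p q := by simp
  map_smul' r p := by simp

theorem ceAction_fst (p : 𝔤.CE) (t : 𝔤.CE × (L →ₗ[ℚ] 𝔤.CE) × 𝔤.CE) : (𝔤.ceAction p t).1 = p * t.1 := by
  induction p using KoszulSym.induction with
  | one => simp
  | add a b ha hb => simp [ha, hb, add_mul]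
  | smul r a ha => simp [ha]
  | ι_mul x a ha =>
    rw [map_mul, Module.End.mul_apply, ceAction, KoszulSym.lift_ι, ceStep_fst, mul_assoc]
    exact congrArg _ ha

theorem ceθ_one (x : L) : 𝔤.ceθ x 1 = 0 := by
  simp [ceθ]

theorem ceθ_ι_mul {m i o k : ℤ} {x y : L} (hy : y ∈ 𝔤.gr.shift m i) (hx : x ∈ 𝔤.gr o k)
    (p : 𝔤.CE) : 𝔤.ceθ x (𝔤.ceι y * p) = koszulSign k • (𝔤.ceι (𝔤.bracket x y) * p) +
      koszulSign (k * i) • (𝔤.ceι y * 𝔤.ceθ x p) := by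
  have := 𝔤.ceStep_snd hy hx (𝔤.ceAction p (1, 0, 0))
  rw [ceAction_fst, mul_one] at this
  simp only [ceθ, LinearMap.coe_mk, AddHom.coe_mk, map_mul, Module.End.mul_apply]
  rw [← this, ceAction, KoszulSym.lift_ι]

theorem ceD_one : 𝔤.ceD 1 = 0 := by simp [ceD]

theorem ceD_ι_mul {m i : ℤ} {y : L} (hy : y ∈ 𝔤.gr.shift m i) (p : 𝔤.CE) :
    𝔤.ceD (𝔤.ceι y * p) = 𝔤.ceθ y p + koszulSign i • (𝔤.ceι y * 𝔤.ceD p) := by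
  have := 𝔤.ceStep_thd hy (𝔤.ceAction p (1, 0, 0))
  simp only [ceD, ceθ, LinearMap.coe_mk, AddHom.coe_mk, map_mul, Module.End.mul_apply]
  rw [← this, ceAction, KoszulSym.lift_ι]

/-- The formula that determines the differential. -/
theorem ceD_ι_mul_ι {n i : ℤ} {x : L} (hx : x ∈ 𝔤.gr n i) (y : L) :
    𝔤.ceD (𝔤.ceι x * 𝔤.ceι y) = koszulSign i • 𝔤.ceι (𝔤.bracket x y) := by
  have hx' : x ∈ 𝔤.gr.shift n (i + 1) := by simpa [BigradedFamily.shift] using hx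
  induction y using 𝔤.toBigrading.induction with
  | zero => simp
  | add a b ha hb => rw [map_add, mul_add, map_add, ha, hb, map_add, map_add, smul_add]
  | hom m j y hy =>
    have hy' : y ∈ 𝔤.gr.shift m (j + 1) := by simpa [BigradedFamily.shift] using hy
    have h1 := 𝔤.ceθ_ι_mul hy' hx 1
    have h2 := 𝔤.ceD_ι_mul hy' 1
    rw [mul_one, ceθ_one] at h1 h2
    rw [𝔤.ceD_ι_mul hx', h1, h2, ceD_one]
    simp

theorem ceθ_bracket {m i n j : ℤ} {x y : L} (hx : x ∈ 𝔤.gr m i) (hy : y ∈ 𝔤.gr n j) (p : 𝔤.CE) :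
    𝔤.ceθ (𝔤.bracket x y) p =
      𝔤.ceθ x (𝔤.ceθ y p) - koszulSign (i * j) • 𝔤.ceθ y (𝔤.ceθ x p) := by
  induction p using KoszulSym.induction with
  | one => simp [ceθ_one]
  | add a b ha hb => simp only [map_add, ha, hb]; module
  | smul r a ha => simp only [map_smul, ha]; module
  | ι_mul z p hp =>
    induction z using 𝔤.toBigrading.induction with
    | zero => simp
    | add a b ha hb => rw [map_add, add_mul]; simp only [map_add, ha, hb]; module
    | hom o k z hz =>
      have hz' : z ∈ 𝔤.gr.shift o (k + 1) := by simpa [BigradedFamily.shift] using hz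
      have hxz : 𝔤.bracket x z ∈ 𝔤.gr.shift (m + o) (i + k + 1) := by
        simpa [BigradedFamily.shift] using 𝔤.bracket_mem hx hz
      have hyz : 𝔤.bracket y z ∈ 𝔤.gr.shift (n + o) (j + k + 1) := by
        simpa [BigradedFamily.shift] using 𝔤.bracket_mem hy hz
      have h1 : 𝔤.bracket y z = -(koszulSign (j * k) • 𝔤.bracket z y) :=
        eq_neg_of_add_eq_zero_left (𝔤.skew hy hz)
      have h2 : 𝔤.bracket (𝔤.bracket z x) y =
          -(koszulSign ((k + i) * j) • 𝔤.bracket y (𝔤.bracket z x)) :=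
        eq_neg_of_add_eq_zero_left (𝔤.skew (𝔤.bracket_mem hz hx) hy)
      have h3 : 𝔤.bracket x z = -(koszulSign (i * k) • 𝔤.bracket z x) :=
        eq_neg_of_add_eq_zero_left (𝔤.skew hx hz)
      have h4 : 𝔤.bracket (𝔤.bracket y z) x =
          -(koszulSign ((j + k) * i) • 𝔤.bracket x (𝔤.bracket y z)) :=
        eq_neg_of_add_eq_zero_left (𝔤.skew (𝔤.bracket_mem hy hz) hx)
      have hJ : 𝔤.bracket (𝔤.bracket x y) z = 𝔤.bracket x (𝔤.bracket y z) -
          koszulSign (i * j) • 𝔤.bracket y (𝔤.bracket x z) := by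
        have := 𝔤.jacobi hx hy hz
        rw [h2, h4] at this
        rw [h3, map_neg, map_smul]
        rw [← sub_eq_zero]
        rcases Int.even_or_odd i with hi | hi <;> rcases Int.even_or_odd j with hj | hj <;>
          rcases Int.even_or_odd k with hk | hk <;>
          simp [add_mul, koszulSign_add, koszulSign_even, koszulSign_odd, hi, hj, hk,
            Even.mul_left, Even.mul_right, Odd.mul] at this ⊢ <;>
          first
          | (rw [← this]; module)
          | (rw [← neg_eq_zero, ← this]; module)
      rw [𝔤.ceθ_ι_mul hz' (𝔤.bracket_mem hx hy), 𝔤.ceθ_ι_mul hz' hx, 𝔤.ceθ_ι_mul hz' hy, hJ, hp]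
      simp only [map_add, map_smul, map_sub, 𝔤.ceθ_ι_mul hz' hx, 𝔤.ceθ_ι_mul hz' hy,
        𝔤.ceθ_ι_mul hxz hy, 𝔤.ceθ_ι_mul hyz hx, sub_mul, mul_sub, mul_smul_comm, smul_mul_assoc]
      rcases Int.even_or_odd i with hi | hi <;> rcases Int.even_or_odd j with hj | hj <;>
        rcases Int.even_or_odd k with hk | hk <;>
        simp [add_mul, mul_add, koszulSign_add, koszulSign_even, koszulSign_odd, hi, hj, hk,
          Even.mul_left, Even.mul_right, Odd.mul] <;> module

theorem ceD_ceθ {n k : ℤ} {x : L} (hx : x ∈ 𝔤.gr n k) (p : 𝔤.CE) :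
    𝔤.ceD (𝔤.ceθ x p) = koszulSign k • 𝔤.ceθ x (𝔤.ceD p) := by
  induction p using KoszulSym.induction with
  | one => simp [ceθ_one, ceD_one]
  | add a b ha hb => simp only [map_add, ha, hb]; module
  | smul r a ha => simp only [map_smul, ha]; module
  | ι_mul y p hp =>
    induction y using 𝔤.toBigrading.induction with
    | zero => simp
    | add a b ha hb => rw [map_add, add_mul]; simp only [map_add, ha, hb]; module
    | hom o j y hy =>
      have hy' : y ∈ 𝔤.gr.shift o (j + 1) := by simpa [BigradedFamily.shift] using hy
      have hxy : 𝔤.bracket x y ∈ 𝔤.gr.shift (n + o) (k + j + 1) := by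
        simpa [BigradedFamily.shift] using 𝔤.bracket_mem hx hy
      simp only [map_add, map_smul, 𝔤.ceθ_ι_mul hy' hx, 𝔤.ceD_ι_mul hy', 𝔤.ceD_ι_mul hxy,
        𝔤.ceθ_bracket hx hy, hp]
      rcases Int.even_or_odd j with hj | hj <;> rcases Int.even_or_odd k with hk | hk <;>
        simp [add_mul, mul_add, koszulSign_add, koszulSign_even, koszulSign_odd, hj, hk,
          Even.mul_left, Even.mul_right, Odd.mul] <;> module

/-- The Chevalley–Eilenberg differential squares to zero. -/
theorem ceD_ceD (p : 𝔤.CE) : 𝔤.ceD (𝔤.ceD p) = 0 := by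
  induction p using KoszulSym.induction with
  | one => simp [ceD_one]
  | add a b ha hb => simp [ha, hb]
  | smul r a ha => simp [ha]
  | ι_mul y p hp =>
    induction y using 𝔤.toBigrading.induction with
    | zero => simp
    | add a b ha hb => rw [map_add, add_mul]; simp only [map_add, ha, hb, add_zero]
    | hom o j y hy =>
      have hy' : y ∈ 𝔤.gr.shift o (j + 1) := by simpa [BigradedFamily.shift] using hy
      rw [𝔤.ceD_ι_mul hy', map_add, map_smul, 𝔤.ceD_ι_mul hy', 𝔤.ceD_ceθ hy, hp,
        koszulSign_add, koszulSign_odd odd_one]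
      simp

/-! ## Lie algebra homology and the action of central elements -/

/-- Lie algebra homology: the homology of the Chevalley–Eilenberg complex. -/
abbrev Homology : Type _ :=
  ↥(LinearMap.ker 𝔤.ceD) ⧸ (LinearMap.range 𝔤.ceD).submoduleOf (LinearMap.ker 𝔤.ceD)

/-- The bigraded pieces of Lie algebra homology: the classes of the cycles of bidegree `(n,i)`. -/
def homologyGr : BigradedFamily 𝔤.Homology := fun n i =>
  ((KoszulSym.gr 𝔤.gr.shift n i).comap (LinearMap.ker 𝔤.ceD).subtype).map
    ((LinearMap.range 𝔤.ceD).submoduleOf (LinearMap.ker 𝔤.ceD)).mkQ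

/-- The part of odd degree of `𝔤`, which is the part of even degree of `𝔤[1]`. -/
def oddPart : Submodule ℚ L := Submodule.span ℚ {v | ∃ n i : ℤ, Odd i ∧ v ∈ 𝔤.gr n i}

/-- `y` is a central element in the part of odd degree of `𝔤`. -/
def IsOddCentral (y : L) : Prop := y ∈ 𝔤.oddPart ∧ ∀ z, 𝔤.bracket y z = 0

variable {𝔤}

theorem sign_of_mem_oddPart {y : L} (hy : y ∈ 𝔤.oddPart) : 𝔤.sign y = -y := by
  induction hy using Submodule.span_induction with
  | mem x hx =>
    obtain ⟨n, i, hi, hx⟩ := hx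
    rw [Bigrading.sign, 𝔤.toBigrading.diag_apply _ hx, koszulSign_odd hi]; simp
  | zero => simp
  | add a b _ _ ha hb => rw [map_add, ha, hb]; abel
  | smul r a _ ha => rw [map_smul, ha, smul_neg]

theorem ceι_comm_of_mem_oddPart {y : L} (hy : y ∈ 𝔤.oddPart) (z : L) :
    𝔤.ceι y * 𝔤.ceι z = 𝔤.ceι z * 𝔤.ceι y := by
  induction hy using Submodule.span_induction with
  | mem x hx =>
    obtain ⟨n, i, hi, hx⟩ := hx
    have hx' : x ∈ 𝔤.gr.shift n (i + 1) := by simpa [BigradedFamily.shift] using hx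
    induction z using 𝔤.toBigrading.induction with
    | zero => simp
    | add a b ha hb => rw [map_add, mul_add, add_mul, ha, hb]
    | hom o j z hz =>
      have hz' : z ∈ 𝔤.gr.shift o (j + 1) := by simpa [BigradedFamily.shift] using hz
      rw [KoszulSym.ι_mul_ι 𝔤.gr.shift hx' hz',
        koszulSign_even ((hi.add_odd odd_one).mul_right (j + 1)), one_smul]
  | zero => simp
  | add a b _ _ ha hb => rw [map_add, mul_add, add_mul, ha, hb]
  | smul r a _ ha => rw [map_smul, smul_mul_assoc, ha, mul_smul_comm]

theorem IsOddCentral.ceθ_eq_zero {y : L} (hy : 𝔤.IsOddCentral y) (p : 𝔤.CE) :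
    𝔤.ceθ y p = 0 := by
  induction p using KoszulSym.induction with
  | one => exact 𝔤.ceθ_one y
  | add a b ha hb => rw [map_add, ha, hb, add_zero]
  | smul r a ha => rw [map_smul, ha, smul_zero]
  | ι_mul x a ha =>
    have key : ∀ t : 𝔤.CE × (L →ₗ[ℚ] 𝔤.CE) × 𝔤.CE, t.2.1 y = 0 →
        (𝔤.ceStep x t).2.1 y = 0 := fun t ht => by
      simp [ceStep, sign_of_mem_oddPart hy.1, hy.2, ht]
    simp only [ceθ, LinearMap.coe_mk, AddHom.coe_mk, map_mul, Module.End.mul_apply] at ha ⊢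
    have := key _ ha
    rwa [ceAction, KoszulSym.lift_ι]

/-- Multiplication by an element of odd degree that is central in `𝔤` commutes with the
differential. -/
theorem IsOddCentral.ceD_ι_mul {y : L} (hy : 𝔤.IsOddCentral y) (p : 𝔤.CE) :
    𝔤.ceD (𝔤.ceι y * p) = 𝔤.ceι y * 𝔤.ceD p := by
  have key : ∀ t : 𝔤.CE × (L →ₗ[ℚ] 𝔤.CE) × 𝔤.CE, t.2.1 y = 0 →
      (𝔤.ceStep y t).2.2 = 𝔤.ceι y * t.2.2 := fun t ht => by
    simp [ceStep, sign_of_mem_oddPart hy.1, ht]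
  have h := key (𝔤.ceAction p (1, 0, 0)) (hy.ceθ_eq_zero p)
  simp only [ceD, LinearMap.coe_mk, AddHom.coe_mk, map_mul, Module.End.mul_apply]
  rw [← h, ceAction, KoszulSym.lift_ι]

/-- The operator on the homology of `𝔤` induced by multiplication by a central element of odd
degree on the Chevalley–Eilenberg complex. -/
def IsOddCentral.act {y : L} (hy : 𝔤.IsOddCentral y) : Module.End ℚ 𝔤.Homology :=
  Submodule.mapQ _ _
    ((LinearMap.mulLeft ℚ (𝔤.ceι y)).restrict (p := LinearMap.ker 𝔤.ceD)
      (q := LinearMap.ker 𝔤.ceD) (fun p hp => by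
        rw [LinearMap.mem_ker] at hp ⊢
        rw [LinearMap.mulLeft_apply, hy.ceD_ι_mul, hp, mul_zero]))
    (by
      rintro ⟨_, hp⟩ ⟨q, rfl⟩
      exact ⟨𝔤.ceι y * q, hy.ceD_ι_mul q⟩)

theorem IsOddCentral.act_mk {y : L} (hy : 𝔤.IsOddCentral y) (p : LinearMap.ker 𝔤.ceD)
    (q : LinearMap.ker 𝔤.ceD) (hq : (q : 𝔤.CE) = 𝔤.ceι y * p) :
    hy.act (Submodule.Quotient.mk p) = Submodule.Quotient.mk q := by
  obtain ⟨q, hq'⟩ := q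
  subst hq
  rfl

variable {S : Type*} [AddCommGroup S] [Module ℚ S]

/-- The linear action on homology of a vector space `S` that maps to the central elements of odd
degree. -/
def centralActionLinear (f : S →ₗ[ℚ] L) (hf : ∀ x, 𝔤.IsOddCentral (f x)) :
    S →ₗ[ℚ] Module.End ℚ 𝔤.Homology where
  toFun x := (hf x).act
  map_add' x y := by
    refine LinearMap.ext fun c => ?_
    obtain ⟨p, rfl⟩ := Submodule.Quotient.mk_surjective _ c
    exact (hf (x + y)).act_mk p _ (by
      change 𝔤.ceι (f x) * (p : 𝔤.CE) + 𝔤.ceι (f y) * (p : 𝔤.CE) = _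
      rw [map_add, map_add, add_mul])
  map_smul' r x := by
    refine LinearMap.ext fun c => ?_
    obtain ⟨p, rfl⟩ := Submodule.Quotient.mk_surjective _ c
    exact (hf (r • x)).act_mk p _ (by
      change r • (𝔤.ceι (f x) * (p : 𝔤.CE)) = _
      rw [map_smul, map_smul, smul_mul_assoc])

/-- Let `S` be an Abelian Lie algebra concentrated in odd degrees and `f : S → 𝔤` a map with
central image. The symmetric algebra `Sym(S[1])` (in the usual sense, since `S[1]` is concentrated
in even degrees, so that there are no signs) acts on the homology of `𝔤` through the
multiplication of `Sym(𝔤[1])`. -/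
def centralAction (f : S →ₗ[ℚ] L) (hf : ∀ x, 𝔤.IsOddCentral (f x)) :
    SymmetricAlgebra ℚ S →ₐ[ℚ] Module.End ℚ 𝔤.Homology :=
  RingCon.liftₐ (R := ℚ) (TensorAlgebra.symRingCon ℚ S)
    (TensorAlgebra.lift ℚ (centralActionLinear f hf)) (RingCon.ringConGen_le.2 (by
      rintro _ _ ⟨x, y⟩
      rw [RingCon.ker_apply]
      simp only [AlgHom.toRingHom_eq_coe, RingHom.coe_coe, map_mul, TensorAlgebra.lift_ι_apply]
      refine LinearMap.ext fun c => ?_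
      obtain ⟨p, rfl⟩ := Submodule.Quotient.mk_surjective _ c
      refine congrArg Submodule.Quotient.mk (Subtype.ext ?_)
      change 𝔤.ceι (f x) * (𝔤.ceι (f y) * (p : 𝔤.CE)) = 𝔤.ceι (f y) * (𝔤.ceι (f x) * (p : 𝔤.CE))
      rw [← mul_assoc, ceι_comm_of_mem_oddPart (hf x).1, mul_assoc]))

/-- The action of a generator is induced by multiplication. -/
theorem centralAction_ι (f : S →ₗ[ℚ] L) (hf : ∀ x, 𝔤.IsOddCentral (f x)) (x : S) :
    centralAction f hf (SymmetricAlgebra.ι ℚ S x) = (hf x).act := by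
  have h : centralAction f hf (SymmetricAlgebra.ι ℚ S x) =
      TensorAlgebra.lift ℚ (centralActionLinear f hf) (TensorAlgebra.ι ℚ x) := rfl
  rw [h, TensorAlgebra.lift_ι_apply]
  rfl

variable {G K E : Type*} [AddCommGroup G] [Module ℚ G] [AddCommGroup K] [Module ℚ K]
  [AddCommGroup E] [Module ℚ E] {𝔨 : BigradedLieAlgebra K} {𝔢 : BigradedLieAlgebra E}
  {i : L →ₗ[ℚ] E} {s : K →ₗ[ℚ] E}

variable (𝔤) in
/-- The pieces of `𝔥[1]^0_C`: the elements of odd degree of `𝔥` that have slope `C` in `𝔥[1]`. -/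
def extremal (𝔥 : Submodule ℚ L) (C : ℚ) : BigradedFamily L :=
  (𝔤.gr.restrict 𝔥).shift.even.ofSlope C

/-- If `𝔥` is central in `𝔤` and `𝔩` centralizes `𝔥[1]^0_C`, then `𝔥[1]^0_C` is central in the
semidirect product. -/
theorem IsSemidirectProduct.isOddCentral (h : IsSemidirectProduct 𝔤 𝔨 𝔢 i s)
    {𝔥 : Submodule ℚ L} (h𝔥 : 𝔤.IsCentralSubalgebra 𝔥) {C : ℚ}
    (hC : ∀ x ∈ (𝔤.extremal 𝔥 C).total, ∀ y : K, 𝔢.bracket (s y) (i x) = 0)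
    (x : (𝔤.extremal 𝔥 C).total) :
    𝔢.IsOddCentral ((i ∘ₗ (𝔤.extremal 𝔥 C).total.subtype) x) := by
  obtain ⟨x, hx⟩ := x
  change 𝔢.IsOddCentral (i x)
  have hC' : ∀ p : ℤ × ℤ, ∀ x ∈ 𝔤.extremal 𝔥 C p.1 p.2, ∀ y : K, 𝔢.bracket (s y) (i x) = 0 :=
    fun p x hx => hC x (Submodule.mem_iSup_of_mem p hx)
  clear hC
  induction hx using Submodule.iSup_induction' with
  | zero => exact ⟨by simp, by simp⟩
  | add a b _ _ ha hb =>
    exact ⟨by rw [map_add]; exact add_mem ha.1 hb.1, fun z => by simp [ha.2, hb.2]⟩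
  | mem p x hx =>
    have hc := hC' p x hx
    obtain ⟨n, k⟩ := p
    have hx' : Odd (k - 1) ∧ x ∈ 𝔤.gr n (k - 1) ∧ x ∈ 𝔥 ∨ x = 0 := by
      simp only [extremal, BigradedFamily.ofSlope, BigradedFamily.even] at hx
      split_ifs at hx with h1 h2
      · exact Or.inl ⟨h2.sub_odd odd_one, hx.1, hx.2⟩
      · exact Or.inr (by simpa using hx)
      · exact Or.inr (by simpa using hx)
    obtain ⟨hk, hxk, hxh⟩ | rfl := hx'
    · have hix := h.isHom_left.1 _ _ _ hxk
      refine ⟨Submodule.subset_span ⟨n, k - 1, hk, hix⟩, fun z => ?_⟩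
      obtain ⟨_, ⟨g, rfl⟩, _, ⟨y, rfl⟩, rfl⟩ := Submodule.mem_sup.1
        (h.isCompl.sup_eq_top ▸ Submodule.mem_top : z ∈ LinearMap.range i ⊔ LinearMap.range s)
      rw [map_add, ← h.isHom_left.2, h𝔥.central x hxh g, map_zero, zero_add]
      induction y using 𝔨.toBigrading.induction with
      | zero => simp
      | add a b ha hb => rw [map_add, map_add, ha, hb, add_zero]
      | hom o j y hy =>
        have := 𝔢.skew hix (h.isHom_right.1 _ _ _ hy)
        rwa [hc y, smul_zero, add_zero] at this
    · exact ⟨by simp, by simp⟩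

end BigradedLieAlgebra

/-- `R` is the underlying subspace of a finitely generated `A`-submodule, for an algebra `A` that
acts on the vector space `M`. -/
def IsFinitelyGeneratedOver {A M : Type*} [CommRing A] [Algebra ℚ A] [AddCommGroup M] [Module ℚ M]
    (φ : A →ₐ[ℚ] Module.End ℚ M) (R : Submodule ℚ M) : Prop :=
  letI : Module A M := Module.compHom M φ.toRingHom
  ∃ N : Submodule A M, (N : Set M) = R ∧ N.FG

/-! ## Quasi-polynomials -/

/-- The ring `Π` of periodic functions from `ℤ` to `ℚ`. -/
def periodicFunctions : Subring (ℤ → ℚ) where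
  carrier := {c | ∃ p : ℕ, 0 < p ∧ Function.Periodic c (p : ℤ)}
  mul_mem' := by
    rintro a b ⟨p, hp, ha⟩ ⟨q, hq, hb⟩
    refine ⟨p * q, Nat.mul_pos hp hq, ?_⟩
    have h1 : Function.Periodic a ((p * q : ℕ) : ℤ) := by
      rw [Nat.mul_comm]; push_cast; exact ha.int_mul q
    have h2 : Function.Periodic b ((p * q : ℕ) : ℤ) := by
      push_cast; exact hb.int_mul p
    exact h1.mul h2
  one_mem' := ⟨1, one_pos, fun _ => rfl⟩
  add_mem' := by
    rintro a b ⟨p, hp, ha⟩ ⟨q, hq, hb⟩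
    refine ⟨p * q, Nat.mul_pos hp hq, ?_⟩
    have h1 : Function.Periodic a ((p * q : ℕ) : ℤ) := by
      rw [Nat.mul_comm]; push_cast; exact ha.int_mul q
    have h2 : Function.Periodic b ((p * q : ℕ) : ℤ) := by
      push_cast; exact hb.int_mul p
    exact h1.add h2
  zero_mem' := ⟨1, one_pos, fun _ => rfl⟩
  neg_mem' := by
    rintro a ⟨p, hp, ha⟩
    exact ⟨p, hp, fun x => congrArg Neg.neg (ha x)⟩

/-- A quasi-polynomial is an element of `Π[t]`. -/
abbrev QuasiPolynomial := Polynomial periodicFunctions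

namespace QuasiPolynomial

/-- The value at an integer. -/
def value (q : QuasiPolynomial) (n : ℤ) : ℚ :=
  q.sum fun k c => (c : ℤ → ℚ) n * (n : ℚ) ^ k

/-- The period of a periodic function, its least positive period. -/
def coeffPeriod (c : ℤ → ℚ) : ℕ := sInf {p : ℕ | 0 < p ∧ Function.Periodic c (p : ℤ)}

/-- The least common multiple of the periods of the coefficients. -/
def period (q : QuasiPolynomial) : ℕ :=
  q.support.lcm fun k => coeffPeriod (q.coeff k : ℤ → ℚ)

end QuasiPolynomial

end

/-!
Write `𝔢 = 𝔤 ⋊ 𝔩`, let `g k` be the generators of `𝔩`, and let `S = 𝔥[1]^0_C`. The proof has three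
parts: a small model for the homology of `𝔢`, a finiteness argument for that model, and the theorem
of Hilbert and Serre.

*The small model.* Every class in the homology of `𝔢` is represented by a cycle in
`Sym(𝔤[1]) ⊕ ⨁ₖ g k · Sym(𝔤[1])` (`IsFreeExtension.exists_eq_add_ceD`; the bigraded version is
`IsFreeExtension.exists_homogeneous`). This reflects the fact that a free Lie algebra has homological
dimension one, but neither a spectral sequence nor the theorem of Poincaré, Birkhoff and Witt is
needed. Let `A` be the free associative algebra on the generators, on which `𝔢` acts through `𝔩` by
left multiplication. On the Chevalley–Eilenberg complex `Sym(𝔢[1]) ⊗ A` with coefficients in `A` there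
is an operator `h` (`coefHomotopy`) that vanishes on `Sym(𝔢[1]) ⊗ 1` and whose graded commutator with
the action of `g k` is multiplication by `g k`. Its graded commutator with the action of an iterated
bracket of `a` generators is then `a` times multiplication by this bracket
(`IsFreeExtension.coefHomotopy_coefΘ`), and it follows that `∂ h + h ∂` is diagonalizable and that its
eigenvalues count the generators of `𝔩` that occur in an element. So the complex retracts to its zero
eigenspace `Sym(𝔤[1]) ⊗ 1` (`IsFreeExtension.exists_eq_tmul_one_add`). For a cycle `z` of
`Sym(𝔢[1])`, the boundary of `z ⊗ 1` is a sum of elements `τₖ` times the letters `k`. Each `τₖ` is a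
cycle, hence homologous to some `aₖ ⊗ 1`, and subtracting the elements `± g k · aₖ` from `z` leaves an
element that is homologous to an element of `Sym(𝔤[1])`.

*Finiteness.* Up to sign, `ℓ(n,i) = i - C n` is constant on each ray of slope `C`, negative on the
part of even degree of `𝔤[1]` outside of `S`, and zero on `S`. A product of basis elements of `𝔤[1]`
on a line `ℓ = c` contains every odd basis element at most once, and boundedly many even ones with
`ℓ < 0`; the remaining factors lie in `S`. So the small model is finitely generated over `Sym(S)` along
each such line (`exists_fg_genComplex`). Since `Sym(S)` is Noetherian, so is the part of homology on
this line (`exists_fg_homologyMk_mem`), of which the rays are submodules.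

*Hilbert functions.* A ray is therefore a Noetherian graded module over an algebra that is generated by
`dim S` elements whose weights divide `lcm(S)`, and its Hilbert function is quasi-polynomial
(`IsPositivelyGraded.isEventuallyQuasiPolynomial`), by induction on the number of generators that act
nontrivially on a subquotient.
-/

noncomputable section

/-! ### Bigradings -/

namespace Bigrading

variable {V W : Type*} [AddCommGroup V] [Module ℚ V] [AddCommGroup W] [Module ℚ W]

/-- The linear map that is given by `f n i` on the piece of bidegree `(n,i)`. -/
def lift (𝒱 : Bigrading V) (f : ℤ → ℤ → V →ₗ[ℚ] W) : V →ₗ[ℚ] W :=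
  (DirectSum.toModule ℚ (ℤ × ℤ) W (fun p => f p.1 p.2 ∘ₗ (𝒱.gr p.1 p.2).subtype)) ∘ₗ
    ((LinearEquiv.ofBijective
      (DirectSum.coeLinearMap (fun p : ℤ × ℤ => 𝒱.gr p.1 p.2)) 𝒱.isInternal).symm : V →ₗ[ℚ] _)

theorem lift_apply (𝒱 : Bigrading V) (f : ℤ → ℤ → V →ₗ[ℚ] W) {n i : ℤ} {x : V}
    (hx : x ∈ 𝒱.gr n i) : 𝒱.lift f x = f n i x := by
  have h : (LinearEquiv.ofBijective
      (DirectSum.coeLinearMap (fun p : ℤ × ℤ => 𝒱.gr p.1 p.2)) 𝒱.isInternal).symm x =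
      DirectSum.lof ℚ (ℤ × ℤ) (fun p => 𝒱.gr p.1 p.2) (n, i) ⟨x, hx⟩ := by
    rw [LinearEquiv.symm_apply_eq]
    exact (DirectSum.coeLinearMap_lof (fun p : ℤ × ℤ => 𝒱.gr p.1 p.2) (n, i) ⟨x, hx⟩).symm
  simp only [lift, LinearMap.comp_apply, LinearEquiv.coe_coe, h, DirectSum.toModule_lof]
  simp

open Classical in
/-- The projection onto the piece of bidegree `(n,i)`. -/
def proj (𝒱 : Bigrading V) (n i : ℤ) : V →ₗ[ℚ] V :=
  𝒱.lift fun m j => if m = n ∧ j = i then LinearMap.id else 0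

theorem proj_of_mem (𝒱 : Bigrading V) {n i : ℤ} {x : V} (hx : x ∈ 𝒱.gr n i) :
    𝒱.proj n i x = x := by
  rw [proj, lift_apply _ _ hx]; simp

theorem proj_of_mem_ne (𝒱 : Bigrading V) {n i m j : ℤ} {x : V} (hx : x ∈ 𝒱.gr m j)
    (h : ¬ (m = n ∧ j = i)) : 𝒱.proj n i x = 0 := by
  rw [proj, lift_apply _ _ hx]; simp [h]

theorem proj_mem (𝒱 : Bigrading V) (n i : ℤ) (x : V) : 𝒱.proj n i x ∈ 𝒱.gr n i := by
  induction x using 𝒱.induction with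
  | zero => simp
  | add a b ha hb => rw [map_add]; exact add_mem ha hb
  | hom m j x hx =>
    by_cases h : m = n ∧ j = i
    · obtain ⟨rfl, rfl⟩ := h
      rwa [𝒱.proj_of_mem hx]
    · rw [𝒱.proj_of_mem_ne hx h]; exact zero_mem _

/-- A linear map that preserves bidegrees commutes with the projections. -/
theorem map_proj (𝒱 : Bigrading V) (𝒲 : Bigrading W) {f : V →ₗ[ℚ] W}
    (hf : ∀ (n i : ℤ) (x : V), x ∈ 𝒱.gr n i → f x ∈ 𝒲.gr n i) (n i : ℤ) (x : V) :
    f (𝒱.proj n i x) = 𝒲.proj n i (f x) := by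
  induction x using 𝒱.induction with
  | zero => simp
  | add a b ha hb => simp only [map_add, ha, hb]
  | hom m j x hx =>
    by_cases h : m = n ∧ j = i
    · obtain ⟨rfl, rfl⟩ := h
      rw [𝒱.proj_of_mem hx, 𝒲.proj_of_mem (hf _ _ _ hx)]
    · rw [𝒱.proj_of_mem_ne hx h, 𝒲.proj_of_mem_ne (hf _ _ _ hx) h, map_zero]

/-- A family of subspaces is a bigrading if it spans, and if for all `(n,i)` there is a linear map
that is injective on the piece of bidegree `(n,i)` and vanishes on all the other ones. -/
def ofSeparating (gr : BigradedFamily V) (hsup : ⨆ p : ℤ × ℤ, gr p.1 p.2 = ⊤)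
    (π : ℤ × ℤ → V →ₗ[ℚ] W) (hinj : ∀ p, ∀ x ∈ gr p.1 p.2, π p x = 0 → x = 0)
    (hzero : ∀ p q, p ≠ q → ∀ x ∈ gr q.1 q.2, π p x = 0) : Bigrading V where
  gr := gr
  isInternal := by
    refine DirectSum.isInternal_submodule_of_iSupIndep_of_iSup_eq_top (fun p => ?_) hsup
    rw [Submodule.disjoint_def]
    intro x hx hx'
    refine hinj p x hx ?_
    have : (⨆ q, ⨆ (_ : q ≠ p), gr q.1 q.2) ≤ LinearMap.ker (π p) :=
      iSup₂_le fun q hq y hy => hzero p q hq.symm y hy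
    exact this hx'

end Bigrading

namespace BigradedLieAlgebra

/-! ### Graded associative algebras as Lie algebras -/

section OfAlgebra

variable {A : Type*} [Ring A] [Algebra ℚ A]

/-- The graded commutator `a b - (-1)^{d(a)d(b)} b a`. -/
def commutator (𝒜 : Bigrading A) : A →ₗ[ℚ] A →ₗ[ℚ] A :=
  LinearMap.mul ℚ A - ((LinearMap.mul ℚ A).flip ∘ₗ 𝒜.evenProj) -
    ((LinearMap.mul ℚ A).flip ∘ₗ 𝒜.oddProj).compl₂ 𝒜.sign

theorem commutator_apply (𝒜 : Bigrading A) {m i n j : ℤ} {a b : A} (ha : a ∈ 𝒜.gr m i)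
    (hb : b ∈ 𝒜.gr n j) : commutator 𝒜 a b = a * b - koszulSign (i * j) • (b * a) := by
  simp only [commutator, LinearMap.sub_apply, LinearMap.comp_apply, LinearMap.compl₂_apply,
    LinearMap.flip_apply, LinearMap.mul_apply', Bigrading.evenProj, Bigrading.oddProj,
    Bigrading.sign, 𝒜.diag_apply _ ha, 𝒜.diag_apply _ hb]
  rcases Int.even_or_odd i with hi | hi
  · simp [hi, koszulSign_even, Even.mul_right]
  · rcases Int.even_or_odd j with hj | hj
    · simp [hj, koszulSign_even, Even.mul_left, Int.not_even_iff_odd.2 hi]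
    · simp [hi, hj, koszulSign_odd, Odd.mul, Int.not_even_iff_odd.2 hi]

/-- A bigraded associative algebra is a Lie algebra under the graded commutator. -/
def ofAlgebra (𝒜 : Bigrading A) (hmul : ∀ {m i n j : ℤ} {a b : A}, a ∈ 𝒜.gr m i → b ∈ 𝒜.gr n j →
    a * b ∈ 𝒜.gr (m + n) (i + j)) : BigradedLieAlgebra A where
  toBigrading := 𝒜
  bracket := commutator 𝒜
  bracket_mem {m i n j x y} hx hy := by
    rw [commutator_apply 𝒜 hx hy]
    refine sub_mem (hmul hx hy) (Submodule.smul_mem _ _ ?_)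
    rw [add_comm m, add_comm i]
    exact hmul hy hx
  skew {m i n j x y} hx hy := by
    rw [commutator_apply 𝒜 hx hy, commutator_apply 𝒜 hy hx]
    rcases Int.even_or_odd i with hi | hi <;> rcases Int.even_or_odd j with hj | hj <;>
      simp [koszulSign_even, koszulSign_odd, hi, hj, Even.mul_left, Even.mul_right, Odd.mul]
  jacobi {m i n j o k x y z} hx hy hz := by
    have h {m i n j : ℤ} {a b : A} (ha : a ∈ 𝒜.gr m i) (hb : b ∈ 𝒜.gr n j) :
        commutator 𝒜 a b ∈ 𝒜.gr (m + n) (i + j) := by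
      rw [commutator_apply 𝒜 ha hb]
      refine sub_mem (hmul ha hb) (Submodule.smul_mem _ _ ?_)
      rw [add_comm m, add_comm i]
      exact hmul hb ha
    rw [commutator_apply 𝒜 (h hx hy) hz, commutator_apply 𝒜 (h hy hz) hx,
      commutator_apply 𝒜 (h hz hx) hy, commutator_apply 𝒜 hx hy, commutator_apply 𝒜 hy hz,
      commutator_apply 𝒜 hz hx]
    rcases Int.even_or_odd i with hi | hi <;> rcases Int.even_or_odd j with hj | hj <;>
      rcases Int.even_or_odd k with hk | hk <;>
      simp [koszulSign_add, koszulSign_even, koszulSign_odd, hi, hj, hk, Even.mul_left,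
        Even.mul_right, Odd.mul, add_mul, mul_add, sub_mul, mul_sub, mul_assoc] <;> abel

end OfAlgebra

/-! ### The free associative algebra on bigraded generators -/

section Words

variable {κ : Type*}

/-- The free associative algebra on `κ`, with its basis of words. -/
abbrev WordAlgebra (κ : Type*) : Type _ := AddMonoidAlgebra ℚ (FreeAddMonoid κ)

namespace WordAlgebra

/-- The word `w`. -/
def word (w : List κ) : WordAlgebra κ := AddMonoidAlgebra.single (FreeAddMonoid.ofList w) 1

theorem word_nil : word ([] : List κ) = 1 := rfl

theorem word_append (v w : List κ) : word (v ++ w) = word v * word w := by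
  rw [word, word, word, AddMonoidAlgebra.single_mul_single, one_mul]; rfl

theorem word_cons (k : κ) (w : List κ) : word (k :: w) = word [k] * word w :=
  word_append [k] w

/-- The basis of words. -/
def basis : Module.Basis (List κ) ℚ (WordAlgebra κ) :=
  (AddMonoidAlgebra.basis (FreeAddMonoid κ) ℚ).reindex FreeAddMonoid.toList

theorem basis_apply (w : List κ) : basis w = word w := by
  simp [basis, word]

theorem linearMap_ext {W : Type*} [AddCommGroup W] [Module ℚ W] {f g : WordAlgebra κ →ₗ[ℚ] W}
    (h : ∀ w, f (word w) = g (word w)) : f = g :=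
  basis.ext fun w => by rw [basis_apply]; exact h w

/-- The coefficient of the empty word. -/
def augmentation : WordAlgebra κ →ₗ[ℚ] ℚ := basis.constr ℚ fun w => if w = [] then 1 else 0

theorem augmentation_word (w : List κ) : augmentation (word w) = if w = [] then 1 else 0 := by
  rw [augmentation, ← basis_apply, Module.Basis.constr_basis]

theorem augmentation_mul (a b : WordAlgebra κ) :
    augmentation (a * b) = augmentation a * augmentation b := by
  have key (w : List κ) : augmentation (word w * b) = augmentation (word w) * augmentation b := by
    have : augmentation ∘ₗ LinearMap.mulLeft ℚ (word w) = augmentation (word w) • augmentation :=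
      linearMap_ext fun v => by
        rw [LinearMap.comp_apply, LinearMap.mulLeft_apply, ← word_append, LinearMap.smul_apply]
        simp only [augmentation_word]
        by_cases h1 : w = [] <;> simp [h1]
    exact LinearMap.congr_fun this b
  have : augmentation ∘ₗ LinearMap.mulRight ℚ b = augmentation b • augmentation :=
    linearMap_ext fun w => by
      rw [LinearMap.comp_apply, LinearMap.mulRight_apply, key, mul_comm]; rfl
  rw [mul_comm]
  exact LinearMap.congr_fun this a

open Classical in
/-- The operator that strips the last letter from the words that end with `k`, and that vanishes on
the other words. -/
def strip (k : κ) : WordAlgebra κ →ₗ[ℚ] WordAlgebra κ :=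
  basis.constr ℚ fun w => if w.getLast? = some k then word w.dropLast else 0

theorem strip_nil (k : κ) : strip k (1 : WordAlgebra κ) = 0 := by
  rw [← word_nil, ← basis_apply, strip, Module.Basis.constr_basis]; simp

open Classical in
theorem strip_append (j k : κ) (w : List κ) :
    strip k (word (w ++ [j])) = if j = k then word w else 0 := by
  rw [← basis_apply, strip, Module.Basis.constr_basis]; simp

open Classical in
theorem strip_mul (j k : κ) (a : WordAlgebra κ) :
    strip k (a * word [j]) = if j = k then a else 0 := by
  have : strip k ∘ₗ LinearMap.mulRight ℚ (word [j]) = if j = k then LinearMap.id else 0 :=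
    linearMap_ext fun w => by
      rw [LinearMap.comp_apply, LinearMap.mulRight_apply, ← word_append, strip_append]
      split_ifs <;> simp
  have := LinearMap.congr_fun this a
  rw [LinearMap.comp_apply, LinearMap.mulRight_apply] at this
  rw [this]; split_ifs <;> simp

/-- An element is determined by the coefficient of the empty word and by its parts that end with a
given letter. -/
theorem eq_augmentation_add [Fintype κ] (a : WordAlgebra κ) :
    a = augmentation a • 1 + ∑ k, strip k a * word [k] := by
  classical
  have : LinearMap.id = (LinearMap.toSpanSingleton ℚ _ 1) ∘ₗ augmentation +
      ∑ k : κ, LinearMap.mulRight ℚ (word [k]) ∘ₗ strip k := linearMap_ext fun w => by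
    rw [LinearMap.add_apply, LinearMap.sum_apply]
    simp only [LinearMap.comp_apply, LinearMap.mulRight_apply, LinearMap.id_apply,
      LinearMap.toSpanSingleton_apply, augmentation_word]
    rcases List.eq_nil_or_concat w with rfl | ⟨v, j, rfl⟩
    · simp [word_nil, strip_nil]
    · simp [strip_append, ← word_append]
  have := LinearMap.congr_fun this a
  simpa [LinearMap.sum_apply] using this

variable (m d : κ → ℤ)

/-- The bidegree of a word. -/
def degree : FreeAddMonoid κ →+ ℤ × ℤ := FreeAddMonoid.lift fun k => (m k, d k)

/-- The bigrading of the free algebra in which the letter `k` has bidegree `(m k, d k)`. -/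
def bigrading : Bigrading (WordAlgebra κ) where
  gr n i := AddMonoidAlgebra.gradeBy ℚ (degree m d) (n, i)
  isInternal := AddMonoidAlgebra.gradeBy.isInternal (R := ℚ) (degree m d)

/-- The free associative algebra as a Lie algebra. -/
def lie : BigradedLieAlgebra (WordAlgebra κ) :=
  ofAlgebra (bigrading m d) fun {m' i n j} {_ _} ha hb =>
    SetLike.GradedMul.mul_mem (A := AddMonoidAlgebra.gradeBy ℚ (degree m d))
      (i := (m', i)) (j := (n, j)) ha hb

theorem letter_mem (k : κ) : word [k] ∈ (lie m d).gr (m k) (d k) := by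
  have h : degree m d (FreeAddMonoid.of k) = (m k, d k) := FreeAddMonoid.lift_eval_of _ _
  change _ ∈ AddMonoidAlgebra.gradeBy ℚ (degree m d) (m k, d k)
  rw [← h]
  exact AddMonoidAlgebra.single_mem_gradeBy (R := ℚ) (degree m d) (FreeAddMonoid.of k) 1

end WordAlgebra

end Words

end BigradedLieAlgebra

namespace BigradedLieAlgebra

/-! ### Iterated brackets -/

section IteratedBracket

variable {L κ : Type*} [AddCommGroup L] [Module ℚ L] {𝔩 : BigradedLieAlgebra L}
  {m d : κ → ℤ} {e : κ → L}

variable (𝔩 m d e) in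
/-- `IsIteratedBracket 𝔩 m d e a n i x` means that `x` is an iterated bracket, in some order, of `a`
of the elements `e k`, whose bidegrees `(m k, d k)` add up to `(n,i)`. -/
inductive IsIteratedBracket : ℕ → ℤ → ℤ → L → Prop
  | gen (k : κ) : IsIteratedBracket 1 (m k) (d k) (e k)
  | bracket {a b : ℕ} {n i n' j : ℤ} {x y : L} (hx : IsIteratedBracket a n i x)
      (hy : IsIteratedBracket b n' j y) :
      IsIteratedBracket (a + b) (n + n') (i + j) (𝔩.bracket x y)

theorem IsIteratedBracket.mem (he : ∀ k, e k ∈ 𝔩.gr (m k) (d k)) {a : ℕ} {n i : ℤ} {x : L}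
    (hx : 𝔩.IsIteratedBracket m d e a n i x) : x ∈ 𝔩.gr n i := by
  induction hx with
  | gen k => exact he k
  | bracket _ _ hx hy => exact 𝔩.bracket_mem hx hy

theorem IsIteratedBracket.pos {a : ℕ} {n i : ℤ} {x : L}
    (hx : 𝔩.IsIteratedBracket m d e a n i x) : 0 < a := by
  induction hx with
  | gen k => exact one_pos
  | bracket _ _ hx hy => omega

theorem IsIteratedBracket.map {K : Type*} [AddCommGroup K] [Module ℚ K]
    {𝔨 : BigradedLieAlgebra K} {f : L →ₗ[ℚ] K} (hf : 𝔩.IsHom 𝔨 f) {a : ℕ} {n i : ℤ} {x : L}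
    (hx : 𝔩.IsIteratedBracket m d e a n i x) :
    𝔨.IsIteratedBracket m d (fun k => f (e k)) a n i (f x) := by
  induction hx with
  | gen k => exact .gen k
  | bracket _ _ hx hy => rw [hf.2]; exact hx.bracket hy

end IteratedBracket

/-! ### Free Lie algebras -/

section Free

universe u

/-- The elements `e k`, of bidegrees `(m k, d k)`, freely generate the Lie algebra `𝔩`. -/
def IsFreeOn {L : Type u} [AddCommGroup L] [Module ℚ L] (𝔩 : BigradedLieAlgebra L) {κ : Type u}
    (m d : κ → ℤ) (e : κ → L) : Prop :=
  (∀ k, e k ∈ 𝔩.gr (m k) (d k)) ∧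
    ∀ (K : Type u) [AddCommGroup K] [Module ℚ K] (𝔨 : BigradedLieAlgebra K) (y : κ → K),
      (∀ k, y k ∈ 𝔨.gr (m k) (d k)) →
      ∃! f : L →ₗ[ℚ] K, 𝔩.IsHom 𝔨 f ∧ ∀ k, f (e k) = y k

variable {L : Type u} [AddCommGroup L] [Module ℚ L] {𝔩 : BigradedLieAlgebra L} {κ : Type u}
  {m d : κ → ℤ} {e : κ → L}

theorem IsFreeOfFiniteRank.exists_isFreeOn (h : 𝔩.IsFreeOfFiniteRank) :
    ∃ (κ : Type u) (_ : Fintype κ) (m d : κ → ℤ) (e : κ → L), 𝔩.IsFreeOn m d e := by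
  obtain ⟨r, m, d, e, he, h⟩ := h
  refine ⟨ULift (Fin r), inferInstance, fun k => m k.down, fun k => d k.down, fun k => e k.down,
    fun k => he _, fun K _ _ 𝔨 y hy => ?_⟩
  obtain ⟨f, ⟨hf, hfe⟩, huniq⟩ := h K 𝔨 (fun k => y ⟨k⟩) fun k => hy ⟨k⟩
  exact ⟨f, ⟨hf, fun k => hfe k.down⟩, fun g hg => huniq g ⟨hg.1, fun k => hg.2 ⟨k⟩⟩⟩

/-- An endomorphism that fixes the generators is the identity. -/
theorem IsFreeOn.eq_id (h : 𝔩.IsFreeOn m d e) {f : L →ₗ[ℚ] L} (hf : 𝔩.IsHom 𝔩 f)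
    (hfe : ∀ k, f (e k) = e k) : f = LinearMap.id := by
  obtain ⟨g, -, hg⟩ := h.2 L 𝔩 e h.1
  rw [hg f ⟨hf, hfe⟩, hg LinearMap.id ⟨⟨fun _ _ _ h => h, fun _ _ => rfl⟩, fun _ => rfl⟩]

/-- A bigraded subspace that is closed under the bracket is a Lie algebra. -/
def ofSubspace (𝔩 : BigradedLieAlgebra L) (S : Submodule ℚ L)
    (hS : ∀ x ∈ S, ∀ y ∈ S, 𝔩.bracket x y ∈ S)
    (hgr : ⨆ p : ℤ × ℤ, (𝔩.gr p.1 p.2).comap S.subtype = ⊤) : BigradedLieAlgebra S where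
  toBigrading := Bigrading.ofSeparating (fun n i => (𝔩.gr n i).comap S.subtype) hgr
    (fun p => 𝔩.proj p.1 p.2 ∘ₗ S.subtype)
    (by
      rintro p x hx h
      exact Subtype.ext ((𝔩.proj_of_mem hx).symm.trans h))
    (by
      rintro p q hpq x hx
      exact 𝔩.proj_of_mem_ne hx fun h => hpq (Prod.ext h.1.symm h.2.symm))
  bracket := LinearMap.mk₂ ℚ (fun x y => ⟨𝔩.bracket x y, hS x x.2 y y.2⟩)
    (by intro x y z; ext; simp) (by intro r x y; ext; simp)
    (by intro x y z; ext; simp) (by intro r x y; ext; simp)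
  bracket_mem hx hy := 𝔩.bracket_mem hx hy
  skew hx hy := Subtype.ext (𝔩.skew hx hy)
  jacobi hx hy hz := Subtype.ext (𝔩.jacobi hx hy hz)

/-- A free Lie algebra is spanned by the iterated brackets of its generators: they span a Lie
subalgebra, and the inclusion of this subalgebra has a section. -/
theorem IsFreeOn.span_isIteratedBracket (h : 𝔩.IsFreeOn m d e) :
    Submodule.span ℚ {x | ∃ a n i, 𝔩.IsIteratedBracket m d e a n i x} = ⊤ := by
  set S := Submodule.span ℚ {x | ∃ a n i, 𝔩.IsIteratedBracket m d e a n i x} with hSdef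
  have hS : ∀ x ∈ S, ∀ y ∈ S, 𝔩.bracket x y ∈ S := by
    intro x hx y hy
    induction hx, hy using Submodule.span_induction₂ with
    | mem_mem x y hx hy =>
      obtain ⟨a, n, i, hx⟩ := hx
      obtain ⟨b, n', j, hy⟩ := hy
      exact Submodule.subset_span ⟨_, _, _, hx.bracket hy⟩
    | zero_left y hy => simp
    | zero_right x hx => simp
    | add_left x y z _ _ _ h1 h2 => rw [map_add, LinearMap.add_apply]; exact add_mem h1 h2
    | add_right x y z _ _ _ h1 h2 => rw [map_add]; exact add_mem h1 h2
    | smul_left r x y _ _ h1 => rw [map_smul, LinearMap.smul_apply]; exact S.smul_mem _ h1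
    | smul_right r x y _ _ h1 => rw [map_smul]; exact S.smul_mem _ h1
  have hgr : ⨆ p : ℤ × ℤ, (𝔩.gr p.1 p.2).comap S.subtype = ⊤ := by
    refine eq_top_iff.2 ?_
    rintro ⟨x, hx⟩ -
    induction hx using Submodule.span_induction with
    | mem x hx =>
      obtain ⟨a, n, i, hx⟩ := hx
      exact Submodule.mem_iSup_of_mem (n, i) (hx.mem h.1)
    | zero => exact zero_mem _
    | add x y hx hy h1 h2 => exact add_mem h1 h2
    | smul r x hx h1 => exact Submodule.smul_mem _ r h1
  obtain ⟨f, ⟨hf, hfe⟩, -⟩ := h.2 S (𝔩.ofSubspace S hS hgr)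
    (fun k => ⟨e k, Submodule.subset_span ⟨_, _, _, .gen k⟩⟩) h.1
  have : S.subtype ∘ₗ f = LinearMap.id :=
    h.eq_id ⟨hf.1, fun x y => congrArg Subtype.val (hf.2 x y)⟩ fun k => congrArg Subtype.val (hfe k)
  refine eq_top_iff.2 fun x _ => ?_
  rw [← LinearMap.id_apply (R := ℚ) x, ← this]
  exact (f x).2

end Free

/-! ### The projection of a semidirect product -/

section Semidirect

variable {G K E : Type*} [AddCommGroup G] [Module ℚ G] [AddCommGroup K]
    [Module ℚ K] [AddCommGroup E] [Module ℚ E] {𝔤 : BigradedLieAlgebra G}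
    {𝔩 : BigradedLieAlgebra K} {𝔢 : BigradedLieAlgebra E} {i : G →ₗ[ℚ] E} {s : K →ₗ[ℚ] E}

/-- The semidirect product `𝔢 = 𝔤 ⋊ 𝔩` is spanned by homogeneous elements of `𝔤` and of `𝔩`. -/
theorem IsSemidirectProduct.induction (h : IsSemidirectProduct 𝔤 𝔩 𝔢 i s) {p : E → Prop}
    (left : ∀ (n k : ℤ) (x : G), x ∈ 𝔤.gr n k → p (i x))
    (right : ∀ x : K, p (s x)) (zero : p 0)
    (add : ∀ x y, p x → p y → p (x + y)) (x : E) : p x := by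
  obtain ⟨_, ⟨g, rfl⟩, _, ⟨y, rfl⟩, rfl⟩ := Submodule.mem_sup.1
    (h.isCompl.sup_eq_top ▸ Submodule.mem_top : x ∈ LinearMap.range i ⊔ LinearMap.range s)
  refine add _ _ ?_ (right y)
  induction g using 𝔤.toBigrading.induction with
  | zero => simpa using zero
  | add a b ha hb => rw [map_add]; exact add _ _ ha hb
  | hom n k x hx => exact left n k x hx

/-- A semidirect product `𝔤 ⋊ 𝔩` projects to `𝔩`. -/
theorem IsSemidirectProduct.exists_projection (h : IsSemidirectProduct 𝔤 𝔩 𝔢 i s) :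
    ∃ π : E →ₗ[ℚ] K, 𝔢.IsHom 𝔩 π ∧ (∀ x, π (i x) = 0) ∧ ∀ x, π (s x) = x := by
  let π : E →ₗ[ℚ] K := LinearMap.linearProjOfIsCompl (LinearMap.range i) s h.injective_right
    h.isCompl.symm
  have h1 (x : G) : π (i x) = 0 := LinearMap.linearProjOfIsCompl_apply_right' _ _ _ _ _ ⟨x, rfl⟩
  have h2 (x : K) : π (s x) = x := LinearMap.linearProjOfIsCompl_apply_left _ _ _ _ _
  have hg : ∀ n k x, π (𝔢.proj n k x) = 𝔩.proj n k (π x) := by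
    intro n k x
    induction x using h.induction with
    | zero => simp
    | add a b ha hb => simp only [map_add, ha, hb]
    | left _ _ x _ => rw [← 𝔤.map_proj 𝔢.toBigrading h.isHom_left.1, h1, h1, map_zero]
    | right x => rw [← 𝔩.map_proj 𝔢.toBigrading h.isHom_right.1, h2, h2]
  refine ⟨π, ⟨fun n k x hx => ?_, fun x y => ?_⟩, h1, h2⟩
  · rw [← 𝔢.proj_of_mem hx, hg]
    exact 𝔩.proj_mem _ _ _
  · have hr (x : E) (y : G) : π (𝔢.bracket x (i y)) = 0 := by
      obtain ⟨z, hz⟩ := h.ideal x y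
      rw [← hz, h1]
    have hl (x : E) (y : G) : π (𝔢.bracket (i y) x) = 0 := by
      induction y using 𝔤.toBigrading.induction with
      | zero => simp
      | add a b ha hb => simp only [map_add, LinearMap.add_apply, ha, hb, add_zero]
      | hom n k y hy =>
        induction x using 𝔢.toBigrading.induction with
        | zero => simp
        | add a b ha hb => simp only [map_add, ha, hb, add_zero]
        | hom o j x hx =>
          rw [eq_neg_of_add_eq_zero_left (𝔢.skew (h.isHom_left.1 _ _ _ hy) hx), map_neg, map_smul,
            hr, smul_zero, neg_zero]
    induction x using h.induction with
    | zero => simp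
    | add a b ha hb => simp only [map_add, LinearMap.add_apply, ha, hb]
    | left _ _ x _ => rw [hl, h1, map_zero, LinearMap.zero_apply]
    | right x =>
      induction y using h.induction with
      | zero => simp
      | add a b ha hb => simp only [map_add, ha, hb]
      | left _ _ y _ => rw [hr, h1, map_zero]
      | right y => rw [← h.isHom_right.2, h2, h2, h2]

end Semidirect

end BigradedLieAlgebra

namespace BigradedLieAlgebra

open TensorProduct

variable {E : Type*} [AddCommGroup E] [Module ℚ E] (𝔢 : BigradedLieAlgebra E)

/-! ### Parity automorphisms of the Chevalley–Eilenberg complex -/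

/-- The automorphism of `Sym(𝔢[1])` that multiplies elements of degree `i` by `(-1)^{k i}`, where a
generator from `𝔢` has its degree in `𝔢[1]`. -/
def ceSign (k : ℤ) : 𝔢.CE →ₐ[ℚ] 𝔢.CE :=
  KoszulSym.lift (𝒱 := 𝔢.gr.shift) (𝔢.ceι ∘ₗ 𝔢.diag fun i => koszulSign (k * (i + 1))) (by
    intro m i n j x y hx hy
    simp only [LinearMap.comp_apply, 𝔢.toBigrading.diag_apply _ (show x ∈ 𝔢.gr m (i - 1) from hx),
      𝔢.toBigrading.diag_apply _ (show y ∈ 𝔢.gr n (j - 1) from hy), map_smul, smul_mul_assoc,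
      mul_smul_comm, KoszulSym.ι_mul_ι 𝔢.gr.shift hx hy]
    module)

variable {𝔢}

theorem ceSign_ι_mul {m i k : ℤ} {y : E} (hy : y ∈ 𝔢.gr.shift m i) (p : 𝔢.CE) :
    𝔢.ceSign k (𝔢.ceι y * p) = koszulSign (k * i) • (𝔢.ceι y * 𝔢.ceSign k p) := by
  rw [map_mul, ceSign, KoszulSym.lift_ι, LinearMap.comp_apply,
    𝔢.toBigrading.diag_apply _ (show y ∈ 𝔢.gr m (i - 1) from hy)]
  simp

theorem koszulSign_mul_self (k : ℤ) : koszulSign k * koszulSign k = 1 := by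
  rcases Int.even_or_odd k with hk | hk <;> simp [koszulSign_even, koszulSign_odd, hk]

theorem ceSign_ceSign (j k : ℤ) (p : 𝔢.CE) : 𝔢.ceSign j (𝔢.ceSign k p) = 𝔢.ceSign (j + k) p := by
  induction p using KoszulSym.induction with
  | one => simp
  | add a b ha hb => simp only [map_add, ha, hb]
  | smul r a ha => simp only [map_smul, ha]
  | ι_mul y p hp =>
    induction y using 𝔢.toBigrading.induction with
    | zero => simp
    | add a b ha hb => rw [map_add, add_mul]; simp only [map_add, ha, hb]
    | hom o j y hy =>
      have hy' : y ∈ 𝔢.gr.shift o (j + 1) := by simpa [BigradedFamily.shift] using hy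
      simp only [ceSign_ι_mul hy', map_smul, hp, add_mul, koszulSign_add, smul_smul, mul_comm]

theorem ceSign_even {k : ℤ} (hk : Even k) (p : 𝔢.CE) : 𝔢.ceSign k p = p := by
  induction p using KoszulSym.induction with
  | one => simp
  | add a b ha hb => simp only [map_add, ha, hb]
  | smul r a ha => simp only [map_smul, ha]
  | ι_mul y p hp =>
    induction y using 𝔢.toBigrading.induction with
    | zero => simp
    | add a b ha hb => rw [map_add, add_mul]; simp only [map_add, ha, hb]
    | hom o j y hy =>
      have hy' : y ∈ 𝔢.gr.shift o (j + 1) := by simpa [BigradedFamily.shift] using hy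
      simp only [ceSign_ι_mul hy', hp, koszulSign_even (hk.mul_right _), one_smul]

theorem ceSign_odd {k : ℤ} (hk : Odd k) (p : 𝔢.CE) : 𝔢.ceSign k p = 𝔢.ceSign 1 p := by
  obtain ⟨j, rfl⟩ := hk
  rw [← ceSign_ceSign, ceSign_even (even_two_mul j)]

theorem ceSign_self (k : ℤ) (p : 𝔢.CE) : 𝔢.ceSign k (𝔢.ceSign k p) = p := by
  rw [ceSign_ceSign, ceSign_even ⟨k, rfl⟩]

theorem ceSign_ceθ {n j k : ℤ} {x : E} (hx : x ∈ 𝔢.gr n j) (p : 𝔢.CE) :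
    𝔢.ceSign k (𝔢.ceθ x p) = koszulSign (k * j) • 𝔢.ceθ x (𝔢.ceSign k p) := by
  induction p using KoszulSym.induction with
  | one => simp [ceθ_one]
  | add a b ha hb => simp only [map_add, ha, hb, smul_add]
  | smul r a ha => simp only [map_smul, ha, smul_comm r]
  | ι_mul y p hp =>
    induction y using 𝔢.toBigrading.induction with
    | zero => simp
    | add a b ha hb => rw [map_add, add_mul]; simp only [map_add, ha, hb, smul_add]
    | hom o i y hy =>
      have hy' : y ∈ 𝔢.gr.shift o (i + 1) := by simpa [BigradedFamily.shift] using hy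
      have hxy : 𝔢.bracket x y ∈ 𝔢.gr.shift (n + o) (j + i + 1) := by
        simpa [BigradedFamily.shift] using 𝔢.bracket_mem hx hy
      simp only [𝔢.ceθ_ι_mul hy' hx, ceSign_ι_mul hy', ceSign_ι_mul hxy, map_add, map_smul, hp,
        mul_smul_comm, smul_add, smul_smul, mul_add, koszulSign_add]
      congr 1 <;> congr 1 <;> ring

theorem ceSign_ceD (k : ℤ) (p : 𝔢.CE) :
    𝔢.ceSign k (𝔢.ceD p) = koszulSign k • 𝔢.ceD (𝔢.ceSign k p) := by
  induction p using KoszulSym.induction with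
  | one => simp [ceD_one]
  | add a b ha hb => simp only [map_add, ha, hb, smul_add]
  | smul r a ha => simp only [map_smul, ha, smul_comm r]
  | ι_mul y p hp =>
    induction y using 𝔢.toBigrading.induction with
    | zero => simp
    | add a b ha hb => rw [map_add, add_mul]; simp only [map_add, ha, hb, smul_add]
    | hom o i y hy =>
      have hy' : y ∈ 𝔢.gr.shift o (i + 1) := by simpa [BigradedFamily.shift] using hy
      simp only [𝔢.ceD_ι_mul hy', ceSign_ι_mul hy', ceSign_ceθ hy, map_add, map_smul, hp,
        mul_smul_comm, smul_add, smul_smul, mul_add, mul_one, koszulSign_add]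
      have := koszulSign_mul_self k
      congr 2
      · linear_combination (-koszulSign (k * i)) * this
      · ring

/-! ### The complex with coefficients in an algebra -/

section Coefficients

variable {A : Type*} [Ring A] [Algebra ℚ A]

variable (A) in
/-- Multiplication by `x` on the complex `Sym(𝔢[1]) ⊗ A` with coefficients in `A`. -/
def coefι (x : E) : Module.End ℚ (𝔢.CE ⊗[ℚ] A) :=
  LinearMap.rTensor A (LinearMap.mulLeft ℚ (𝔢.ceι x))

theorem coefι_tmul (x : E) (p : 𝔢.CE) (u : A) : coefι A x (p ⊗ₜ u) = (𝔢.ceι x * p) ⊗ₜ[ℚ] u := rfl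

variable (𝔢) in
/-- Right multiplication by `u` on the coefficients. -/
def coefR (u : A) : Module.End ℚ (𝔢.CE ⊗[ℚ] A) := LinearMap.lTensor 𝔢.CE (LinearMap.mulRight ℚ u)

theorem coefR_tmul (p : 𝔢.CE) (u v : A) : 𝔢.coefR v (p ⊗ₜ u) = p ⊗ₜ[ℚ] (u * v) := rfl

theorem coefR_coefι (x : E) (u : A) (ξ : 𝔢.CE ⊗[ℚ] A) :
    𝔢.coefR u (coefι A x ξ) = coefι A x (𝔢.coefR u ξ) := by
  induction ξ with
  | zero => simp
  | add a b ha hb => simp only [map_add, ha, hb]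
  | tmul p v => simp only [coefι_tmul, coefR_tmul]

theorem coefι_coefι {m i n j : ℤ} {x y : E} (hx : x ∈ 𝔢.gr.shift m i) (hy : y ∈ 𝔢.gr.shift n j)
    (ξ : 𝔢.CE ⊗[ℚ] A) :
    coefι A x (coefι A y ξ) = koszulSign (i * j) • coefι A y (coefι A x ξ) := by
  induction ξ with
  | zero => simp
  | add a b ha hb => simp only [map_add, ha, hb, smul_add]
  | tmul p v =>
    simp only [coefι_tmul, smul_tmul', ← mul_assoc, KoszulSym.ι_mul_ι 𝔢.gr.shift hx hy,
      smul_mul_assoc]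

theorem coefι_add (x y : E) (ξ : 𝔢.CE ⊗[ℚ] A) :
    coefι A (x + y) ξ = coefι A x ξ + coefι A y ξ := by
  induction ξ with
  | zero => simp
  | add a b ha hb => simp only [map_add, ha, hb]; abel
  | tmul p v => simp only [coefι_tmul, map_add, add_mul, add_tmul]

theorem coefι_smul (r : ℚ) (x : E) (ξ : 𝔢.CE ⊗[ℚ] A) :
    coefι A (r • x) ξ = r • coefι A x ξ := by
  induction ξ with
  | zero => simp
  | add a b ha hb => simp only [map_add, ha, hb, smul_add]
  | tmul p v => simp only [coefι_tmul, smul_tmul', map_smul, smul_mul_assoc]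

/-- To prove a statement about `Sym(𝔢[1]) ⊗ A`, it suffices to treat `1 ⊗ A` and multiplication by
homogeneous elements of `𝔢`. -/
theorem coef_induction {p : 𝔢.CE ⊗[ℚ] A → Prop} (one : ∀ u, p (1 ⊗ₜ u))
    (add : ∀ ξ η, p ξ → p η → p (ξ + η))
    (ι : ∀ (m i : ℤ) (x : E), x ∈ 𝔢.gr m i → ∀ ξ, p ξ → p (coefι A x ξ)) (ξ : 𝔢.CE ⊗[ℚ] A) :
    p ξ := by
  have zero : p 0 := by simpa using one 0
  have key : ∀ (a : 𝔢.CE) (u : A), p (a ⊗ₜ u) := by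
    intro a
    induction a using KoszulSym.induction with
    | one => exact one
    | add a b ha hb => intro u; rw [add_tmul]; exact add _ _ (ha u) (hb u)
    | smul r a ha => intro u; rw [smul_tmul]; exact ha _
    | ι_mul y a ha =>
      intro u
      induction y using 𝔢.toBigrading.induction with
      | zero => simpa using zero
      | add b c hb hc => rw [map_add, add_mul, add_tmul]; exact add _ _ hb hc
      | hom o i y hy => exact ι o i y hy _ (ha u)
  induction ξ with
  | zero => exact zero
  | add a b ha hb => exact add _ _ ha hb
  | tmul a u => exact key a u

variable (ρ : E →ₗ[ℚ] A)

/-- The action of an element `x` of degree `k` on `Sym(𝔢[1]) ⊗ A`, where `x` acts on `A` through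
left multiplication by `ρ x`. -/
def coefΘ (k : ℤ) (x : E) : Module.End ℚ (𝔢.CE ⊗[ℚ] A) :=
  LinearMap.rTensor A (𝔢.ceθ x) +
    TensorProduct.map (𝔢.ceSign k).toLinearMap (LinearMap.mulLeft ℚ (ρ x))

theorem coefΘ_tmul (k : ℤ) (x : E) (p : 𝔢.CE) (u : A) :
    coefΘ ρ k x (p ⊗ₜ u) = 𝔢.ceθ x p ⊗ₜ[ℚ] u + 𝔢.ceSign k p ⊗ₜ[ℚ] (ρ x * u) := rfl

theorem coefΘ_coefι {m i o k : ℤ} {x y : E} (hy : y ∈ 𝔢.gr.shift m i) (hx : x ∈ 𝔢.gr o k)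
    (ξ : 𝔢.CE ⊗[ℚ] A) : coefΘ ρ k x (coefι A y ξ) =
      koszulSign k • coefι A (𝔢.bracket x y) ξ + koszulSign (k * i) • coefι A y (coefΘ ρ k x ξ) := by
  induction ξ with
  | zero => simp
  | add a b ha hb => simp only [map_add, ha, hb, smul_add]; abel
  | tmul p v =>
    simp only [coefι_tmul, coefΘ_tmul, 𝔢.ceθ_ι_mul hy hx, ceSign_ι_mul hy, map_add, smul_add,
      smul_tmul', add_tmul]
    abel

/-- Auxiliary operators for the differential: the operator `(p, ξ) ↦ (y p, ± p ⊗ ρ y ± y ξ)`, where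
the first sign is the Koszul sign for moving `y` past `p` and the second one is `-(-1)^{d(y)}`. -/
def coefStep : E →ₗ[ℚ] Module.End ℚ (𝔢.CE × (𝔢.CE ⊗[ℚ] A)) :=
  LinearMap.mk₂ ℚ
    (fun y t => (𝔢.ceι y * t.1, t.1 ⊗ₜ ρ (𝔢.evenProj y) + 𝔢.ceSign 1 t.1 ⊗ₜ ρ (𝔢.oddProj y) -
      coefι A (𝔢.sign y) t.2))
    (by
      intro a b c
      refine Prod.ext ?_ ?_
      · simp [add_mul]
      · simp only [coefι_add, map_add, tmul_add, Prod.snd_add]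
        abel)
    (by
      intro r a c
      refine Prod.ext ?_ ?_
      · simp
      · simp only [coefι_smul, map_smul, tmul_smul, Prod.smul_snd, smul_add, smul_sub])
    (by
      intro a b c
      refine Prod.ext ?_ ?_
      · simp [mul_add]
      · simp only [map_add, add_tmul, Prod.snd_add, Prod.fst_add]
        abel)
    (by
      intro r a c
      refine Prod.ext ?_ ?_
      · simp
      · simp only [map_smul, ← smul_tmul', Prod.smul_snd, Prod.smul_fst, smul_add, smul_sub])

theorem coefStep_fst (y : E) (t) : (𝔢.coefStep ρ y t).1 = 𝔢.ceι y * t.1 := rfl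

theorem coefStep_snd {m i : ℤ} {y : E} (hy : y ∈ 𝔢.gr.shift m i) (t : 𝔢.CE × (𝔢.CE ⊗[ℚ] A)) :
    (𝔢.coefStep ρ y t).2 =
      𝔢.ceSign (i - 1) t.1 ⊗ₜ ρ y + koszulSign i • coefι A y t.2 := by
  have hy' : y ∈ 𝔢.gr m (i - 1) := hy
  have h : coefι A (𝔢.sign y) t.2 = koszulSign (i - 1) • coefι A y t.2 := by
    rw [Bigrading.sign, 𝔢.toBigrading.diag_apply _ hy', coefι_smul]
  change _ ⊗ₜ _ + _ - coefι A (𝔢.sign y) t.2 = _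
  rw [h]
  simp only [Bigrading.evenProj, Bigrading.oddProj, 𝔢.toBigrading.diag_apply _ hy']
  rcases Int.even_or_odd i with hi | hi
  · have hi' : Odd (i - 1) := hi.sub_odd odd_one
    rw [koszulSign_odd hi', koszulSign_even hi, ceSign_odd hi', if_neg (Int.not_even_iff_odd.2 hi'),
      if_neg (Int.not_even_iff_odd.2 hi')]
    simp
  · have hi' : Even (i - 1) := hi.sub_odd odd_one
    rw [koszulSign_even hi', koszulSign_odd hi, ceSign_even hi', if_pos hi', if_pos hi']
    simp [sub_eq_add_neg]

theorem coefStep_comm {m i n j : ℤ} {y z : E} (hy : y ∈ 𝔢.gr.shift m i)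
    (hz : z ∈ 𝔢.gr.shift n j) :
    𝔢.coefStep ρ y * 𝔢.coefStep ρ z = koszulSign (i * j) • (𝔢.coefStep ρ z * 𝔢.coefStep ρ y) := by
  refine LinearMap.ext fun t => Prod.ext ?_ ?_
  · change 𝔢.ceι y * (𝔢.ceι z * t.1) = koszulSign (i * j) • (𝔢.ceι z * (𝔢.ceι y * t.1))
    rw [← mul_assoc, KoszulSym.ι_mul_ι 𝔢.gr.shift hy hz, smul_mul_assoc, mul_assoc]
  · simp only [Module.End.mul_apply, LinearMap.smul_apply, Prod.smul_snd, coefStep_snd ρ hy,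
      coefStep_snd ρ hz, coefStep_fst, ceSign_ι_mul hy, ceSign_ι_mul hz, map_add, map_smul,
      coefι_tmul, coefι_coefι hy hz, smul_add, ← smul_tmul', smul_smul]
    rcases Int.even_or_odd i with hi | hi <;> rcases Int.even_or_odd j with hj | hj <;>
      simp [sub_eq_add_neg, koszulSign_add, koszulSign_even, koszulSign_odd, hi, hj,
        add_mul, Even.mul_left, Even.mul_right, Odd.mul] <;> abel

variable (𝔢) in
/-- The operators above satisfy the relations of `Sym(𝔢[1])`, which therefore acts. -/
def coefAction : 𝔢.CE →ₐ[ℚ] Module.End ℚ (𝔢.CE × (𝔢.CE ⊗[ℚ] A)) :=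
  KoszulSym.lift (𝒱 := 𝔢.gr.shift) (𝔢.coefStep ρ) fun _ _ _ _ _ _ hy hz => coefStep_comm ρ hy hz

variable (𝔢) in
/-- The part of the differential that involves the coefficients: the map
`Sym(𝔢[1]) → Sym(𝔢[1]) ⊗ A` that takes a product to the sum over its factors `x` of the products of
the other factors, times `ρ x`. -/
def coefJ : 𝔢.CE →ₗ[ℚ] 𝔢.CE ⊗[ℚ] A where
  toFun p := (𝔢.coefAction ρ p (1, 0)).2
  map_add' p q := by simp
  map_smul' r p := by simp

theorem coefAction_fst (p : 𝔢.CE) (t : 𝔢.CE × (𝔢.CE ⊗[ℚ] A)) :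
    (𝔢.coefAction ρ p t).1 = p * t.1 := by
  induction p using KoszulSym.induction with
  | one => simp
  | add a b ha hb => simp [ha, hb, add_mul]
  | smul r a ha => simp [ha]
  | ι_mul x a ha =>
    rw [map_mul, Module.End.mul_apply, coefAction, KoszulSym.lift_ι, coefStep_fst, mul_assoc]
    exact congrArg _ ha

theorem coefJ_one : 𝔢.coefJ ρ 1 = 0 := by simp [coefJ]

theorem coefJ_ι_mul {m i : ℤ} {y : E} (hy : y ∈ 𝔢.gr.shift m i) (p : 𝔢.CE) :
    𝔢.coefJ ρ (𝔢.ceι y * p) =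
      𝔢.ceSign (i - 1) p ⊗ₜ ρ y + koszulSign i • coefι A y (𝔢.coefJ ρ p) := by
  have := coefStep_snd ρ hy (𝔢.coefAction ρ p (1, 0))
  rw [coefAction_fst, mul_one] at this
  simp only [coefJ, LinearMap.coe_mk, AddHom.coe_mk, map_mul, Module.End.mul_apply]
  rw [← this, coefAction, KoszulSym.lift_ι]

variable (𝔢) in
/-- The differential of the complex `Sym(𝔢[1]) ⊗ A`. -/
def coefD : Module.End ℚ (𝔢.CE ⊗[ℚ] A) :=
  LinearMap.rTensor A 𝔢.ceD + TensorProduct.lift (LinearMap.mk₂ ℚ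
    (fun p u => 𝔢.coefR u (𝔢.coefJ ρ p)) (fun p q u => by simp) (fun r p u => by simp)
    (fun p u v => by
      simp only [coefR, show LinearMap.mulRight ℚ (u + v) = LinearMap.mulRight ℚ u +
        LinearMap.mulRight ℚ v by ext; simp [mul_add], LinearMap.lTensor_add, LinearMap.add_apply])
    (fun r p u => by
      simp only [coefR, show LinearMap.mulRight ℚ (r • u) = r • LinearMap.mulRight ℚ u by ext; simp,
        LinearMap.lTensor_smul, LinearMap.smul_apply]))

theorem coefD_tmul (p : 𝔢.CE) (u : A) :
    𝔢.coefD ρ (p ⊗ₜ u) = 𝔢.ceD p ⊗ₜ u + 𝔢.coefR u (𝔢.coefJ ρ p) := rfl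

theorem coefD_one_tmul (u : A) : 𝔢.coefD ρ (1 ⊗ₜ u) = 0 := by
  rw [coefD_tmul, ceD_one, coefJ_one]; simp

theorem coefD_coefR (u : A) (ξ : 𝔢.CE ⊗[ℚ] A) :
    𝔢.coefD ρ (𝔢.coefR u ξ) = 𝔢.coefR u (𝔢.coefD ρ ξ) := by
  have h (u v : A) (η : 𝔢.CE ⊗[ℚ] A) : 𝔢.coefR (u * v) η = 𝔢.coefR v (𝔢.coefR u η) := by
    induction η with
    | zero => simp
    | add a b ha hb => simp only [map_add, ha, hb]
    | tmul p w => simp only [coefR_tmul, mul_assoc]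
  induction ξ with
  | zero => simp
  | add a b ha hb => simp only [map_add, ha, hb]
  | tmul p v => simp only [coefD_tmul, coefR_tmul, map_add, h]

/-- Cartan's formula: the graded commutator of the differential with multiplication by `y` is the
action of `y`. -/
theorem coefD_coefι {m i : ℤ} {y : E} (hy : y ∈ 𝔢.gr.shift m i) (ξ : 𝔢.CE ⊗[ℚ] A) :
    𝔢.coefD ρ (coefι A y ξ) =
      coefΘ ρ (i - 1) y ξ + koszulSign i • coefι A y (𝔢.coefD ρ ξ) := by
  induction ξ with
  | zero => simp
  | add a b ha hb => simp only [map_add, ha, hb, smul_add]; abel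
  | tmul p u =>
    simp only [coefι_tmul, coefD_tmul, coefΘ_tmul, 𝔢.ceD_ι_mul hy, coefJ_ι_mul ρ hy, map_add,
      map_smul, coefR_tmul, coefR_coefι, add_tmul, ← smul_tmul', smul_add]
    abel

/-- The map `ρ` takes brackets to graded commutators, so that `𝔢` acts on `A` by left
multiplication. -/
structure MapsToCommutators (𝔢 : BigradedLieAlgebra E) (ρ : E →ₗ[ℚ] A) : Prop where
  map_bracket : ∀ {m i n j : ℤ} {x y : E}, x ∈ 𝔢.gr m i → y ∈ 𝔢.gr n j →
    ρ (𝔢.bracket x y) = ρ x * ρ y - koszulSign (i * j) • (ρ y * ρ x)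

variable {ρ}

/-- The operators `coefΘ` are an action of `𝔢`. -/
theorem MapsToCommutators.coefΘ_bracket (hρ : 𝔢.MapsToCommutators ρ) {m i n j : ℤ} {x y : E}
    (hx : x ∈ 𝔢.gr m i) (hy : y ∈ 𝔢.gr n j) (ξ : 𝔢.CE ⊗[ℚ] A) : coefΘ ρ (i + j) (𝔢.bracket x y) ξ =
      coefΘ ρ i x (coefΘ ρ j y ξ) - koszulSign (i * j) • coefΘ ρ j y (coefΘ ρ i x ξ) := by
  induction ξ with
  | zero => simp
  | add a b ha hb => simp only [map_add, ha, hb, smul_add]; abel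
  | tmul p u =>
    simp only [coefΘ_tmul, map_add, 𝔢.ceθ_bracket hx hy, hρ.map_bracket hx hy, ceSign_ceθ hx,
      ceSign_ceθ hy, ceSign_ceSign, sub_tmul, sub_mul, tmul_sub, smul_mul_assoc, tmul_smul, ← smul_tmul', smul_add,
      smul_smul, mul_assoc, add_comm j i, mul_comm j i, koszulSign_mul_self, one_smul]
    abel

theorem MapsToCommutators.coefD_coefΘ (hρ : 𝔢.MapsToCommutators ρ) {n k : ℤ} {x : E}
    (hx : x ∈ 𝔢.gr n k) (ξ : 𝔢.CE ⊗[ℚ] A) :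
    𝔢.coefD ρ (coefΘ ρ k x ξ) = koszulSign k • coefΘ ρ k x (𝔢.coefD ρ ξ) := by
  induction ξ using coef_induction with
  | one u =>
    rw [coefD_one_tmul, map_zero, smul_zero, coefΘ_tmul, ceθ_one, map_one, zero_tmul, zero_add,
      coefD_one_tmul]
  | add a b ha hb => simp only [map_add, ha, hb]; module
  | ι o j y hy ξ hξ =>
    have hy' : y ∈ 𝔢.gr.shift o (j + 1) := by simpa [BigradedFamily.shift] using hy
    have hxy : 𝔢.bracket x y ∈ 𝔢.gr.shift (n + o) (k + j + 1) := by
      simpa [BigradedFamily.shift] using 𝔢.bracket_mem hx hy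
    simp only [map_add, map_smul, coefΘ_coefι ρ hy' hx, coefD_coefι ρ hy', coefD_coefι ρ hxy,
      add_sub_cancel_right, hρ.coefΘ_bracket hx hy, hξ]
    rcases Int.even_or_odd j with hj | hj <;> rcases Int.even_or_odd k with hk | hk <;>
      simp [mul_add, koszulSign_add, koszulSign_even, koszulSign_odd, hj, hk,
        Even.mul_left, Even.mul_right, Odd.mul] <;> module

theorem MapsToCommutators.coefD_coefD (hρ : 𝔢.MapsToCommutators ρ) (ξ : 𝔢.CE ⊗[ℚ] A) :
    𝔢.coefD ρ (𝔢.coefD ρ ξ) = 0 := by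
  induction ξ using coef_induction with
  | one u => rw [coefD_one_tmul, map_zero]
  | add a b ha hb => simp only [map_add, ha, hb, add_zero]
  | ι o j y hy ξ hξ =>
    have hy' : y ∈ 𝔢.gr.shift o (j + 1) := by simpa [BigradedFamily.shift] using hy
    rw [coefD_coefι ρ hy', map_add, map_smul, coefD_coefι ρ hy', add_sub_cancel_right,
      hρ.coefD_coefΘ hy, hξ, koszulSign_add, koszulSign_odd odd_one]
    simp

end Coefficients

end BigradedLieAlgebra

namespace BigradedLieAlgebra

open TensorProduct WordAlgebra

/-! ### The contracting homotopy -/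

section Homotopy

variable {E : Type*} [AddCommGroup E] [Module ℚ E] {𝔢 : BigradedLieAlgebra E} {κ : Type*}
  {m d : κ → ℤ} {g : κ → E} {ρ : E →ₗ[ℚ] WordAlgebra κ}

variable (d g ρ) in
/-- The homotopy on `Sym(𝔢[1]) ⊗ word w`, by recursion on the length of the word. -/
def wordHomotopy : List κ → 𝔢.CE →ₗ[ℚ] 𝔢.CE ⊗[ℚ] WordAlgebra κ
  | [] => 0
  | k :: w => (koszulSign (d k) • (coefΘ ρ (d k) (g k) ∘ₗ wordHomotopy w) +
      (TensorProduct.mk ℚ _ _).flip (word w) ∘ₗ LinearMap.mulLeft ℚ (𝔢.ceι (g k)) -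
      wordHomotopy w ∘ₗ 𝔢.ceθ (g k)) ∘ₗ (𝔢.ceSign (d k)).toLinearMap

variable (𝔢 d g ρ) in
/-- The homotopy `h` on `Sym(𝔢[1]) ⊗ A`. It is determined by `h(p ⊗ 1) = 0` and by its graded
commutators with the actions of the generators `g k`, which are multiplication by `g k`. -/
def coefHomotopy : Module.End ℚ (𝔢.CE ⊗[ℚ] WordAlgebra κ) :=
  TensorProduct.lift (WordAlgebra.basis.constr ℚ (wordHomotopy (𝔢 := 𝔢) d g ρ)).flip

theorem coefHomotopy_tmul_word (p : 𝔢.CE) (w : List κ) :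
    𝔢.coefHomotopy d g ρ (p ⊗ₜ word w) = wordHomotopy d g ρ w p := by
  rw [coefHomotopy, TensorProduct.lift.tmul, LinearMap.flip_apply, ← basis_apply,
    Module.Basis.constr_basis]

theorem coefHomotopy_tmul_one (p : 𝔢.CE) : 𝔢.coefHomotopy d g ρ (p ⊗ₜ 1) = 0 := by
  rw [← word_nil, coefHomotopy_tmul_word]; rfl

theorem tmul_word_induction {p : 𝔢.CE ⊗[ℚ] WordAlgebra κ → Prop}
    (tmul : ∀ a w, p (a ⊗ₜ word w)) (add : ∀ ξ η, p ξ → p η → p (ξ + η))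
    (ξ : 𝔢.CE ⊗[ℚ] WordAlgebra κ) : p ξ := by
  have zero : p 0 := by simpa using tmul 0 []
  induction ξ with
  | zero => exact zero
  | add a b ha hb => exact add _ _ ha hb
  | tmul a u =>
    have hu : u ∈ Submodule.span ℚ (Set.range (WordAlgebra.basis (κ := κ))) := by
      rw [Module.Basis.span_eq]; trivial
    suffices h : ∀ a : 𝔢.CE, p (a ⊗ₜ u) from h a
    induction hu using Submodule.span_induction with
    | mem u hu => obtain ⟨w, rfl⟩ := hu; intro a; rw [basis_apply]; exact tmul a w
    | zero => intro a; simpa using zero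
    | add u v _ _ hu hv => intro a; rw [tmul_add]; exact add _ _ (hu a) (hv a)
    | smul r u _ hu => intro a; rw [← smul_tmul]; exact hu _

/-- Prepending a letter `k` amounts to acting by `g k`, up to a term with a shorter word. This permits
induction on the length of words. -/
theorem tmul_word_cons (hρg : ∀ k, ρ (g k) = word [k]) (p : 𝔢.CE) (k : κ) (w : List κ) :
    p ⊗ₜ[ℚ] word (k :: w) = coefΘ ρ (d k) (g k) (𝔢.ceSign (d k) p ⊗ₜ word w) -
      𝔢.ceθ (g k) (𝔢.ceSign (d k) p) ⊗ₜ word w := by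
  rw [coefΘ_tmul, ceSign_self, hρg, ← word_cons]
  abel

theorem coefHomotopy_coefΘ_gen (hρg : ∀ k, ρ (g k) = word [k]) (k : κ)
    (ξ : 𝔢.CE ⊗[ℚ] WordAlgebra κ) :
    𝔢.coefHomotopy d g ρ (coefΘ ρ (d k) (g k) ξ) =
      koszulSign (d k) • coefΘ ρ (d k) (g k) (𝔢.coefHomotopy d g ρ ξ) + coefι _ (g k) ξ := by
  induction ξ using tmul_word_induction with
  | add a b ha hb => simp only [map_add, ha, hb, smul_add]; abel
  | tmul p w =>
    rw [coefΘ_tmul, hρg, ← word_cons, map_add, coefHomotopy_tmul_word, coefHomotopy_tmul_word,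
      coefHomotopy_tmul_word, wordHomotopy, coefι_tmul]
    simp [ceSign_self]

/-- The homotopy commutes with multiplication by elements of `𝔢`, in the graded sense. -/
theorem coefHomotopy_coefι (hρg : ∀ k, ρ (g k) = word [k]) (hg : ∀ k, g k ∈ 𝔢.gr (m k) (d k))
    {n i : ℤ} {x : E} (hx : x ∈ 𝔢.gr.shift n i) (ξ : 𝔢.CE ⊗[ℚ] WordAlgebra κ) :
    𝔢.coefHomotopy d g ρ (coefι _ x ξ) = koszulSign i • coefι _ x (𝔢.coefHomotopy d g ρ ξ) := by
  induction ξ using tmul_word_induction with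
  | add a b ha hb => simp only [map_add, ha, hb, smul_add]
  | tmul p w =>
    induction w generalizing p x n i with
    | nil => rw [word_nil, coefι_tmul, coefHomotopy_tmul_one, coefHomotopy_tmul_one]; simp
    | cons k w ih =>
      have hg' : g k ∈ 𝔢.gr.shift (m k) (d k + 1) := by
        simpa [BigradedFamily.shift] using hg k
      have hkx : 𝔢.bracket (g k) x ∈ 𝔢.gr.shift (m k + n) (d k + i) := by
        have := 𝔢.bracket_mem (hg k) hx
        rwa [← add_sub_assoc] at this
      rw [tmul_word_cons (d := d) hρg]
      set η := 𝔢.ceSign (d k) p ⊗ₜ[ℚ] word w with hη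
      have h1 := coefΘ_coefι ρ hx (hg k) η
      have h1' := congrArg (𝔢.coefHomotopy d g ρ) h1
      have h2 := coefΘ_coefι ρ hx (hg k) (𝔢.coefHomotopy d g ρ η)
      have h3 := coefι_coefι (A := WordAlgebra κ) hg' hx η
      rw [map_add, map_smul, map_smul, coefHomotopy_coefΘ_gen hρg, hη, ih hx, ih hkx, ← hη,
        map_smul] at h1'
      have h4 : koszulSign (d k * i) • 𝔢.coefHomotopy d g ρ (coefι _ x (coefΘ ρ (d k) (g k) η)) =
        koszulSign (d k) • koszulSign i • coefΘ ρ (d k) (g k) (coefι _ x (𝔢.coefHomotopy d g ρ η)) +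
        coefι _ (g k) (coefι _ x η) - koszulSign (d k) • koszulSign (d k + i) •
          coefι _ (𝔢.bracket (g k) x) (𝔢.coefHomotopy d g ρ η) := by
        rw [h1']; abel
      have h5 : 𝔢.coefHomotopy d g ρ (coefι _ x (coefΘ ρ (d k) (g k) η)) =
        koszulSign (d k * i) • koszulSign (d k * i) •
          𝔢.coefHomotopy d g ρ (coefι _ x (coefΘ ρ (d k) (g k) η)) := by
        rw [smul_smul, koszulSign_mul_self, one_smul]
      rw [map_sub, map_sub, map_sub, map_sub, ih hx, h5, h4, h2, h3, coefHomotopy_coefΘ_gen hρg]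
      simp only [map_add, map_smul]
      rcases Int.even_or_odd i with hi | hi <;> rcases Int.even_or_odd (d k) with hk | hk <;>
        simp [add_mul, koszulSign_add, koszulSign_even, koszulSign_odd, hi, hk,
          Even.mul_left, Even.mul_right, Odd.mul] <;> module

end Homotopy

end BigradedLieAlgebra

namespace BigradedLieAlgebra

open TensorProduct WordAlgebra

/-! ### Extensions of free Lie algebras -/

section FreeExtension

variable {E : Type*} [AddCommGroup E] [Module ℚ E] {𝔢 : BigradedLieAlgebra E} {I : Submodule ℚ E}
  {κ : Type*} {m d : κ → ℤ} {g : κ → E} {ρ : E →ₗ[ℚ] WordAlgebra κ}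

/-- The setting of an extension of a free Lie algebra by an ideal `I`: the elements `g k` of `𝔢`, of
bidegrees `(m k, d k)`, lift the generators, and `ρ` is the map from `𝔢` to the free associative
algebra that vanishes on `I` and takes `g k` to the letter `k`. The iterated brackets of the `g k` span
`𝔢` together with `I`. -/
structure IsFreeExtension (𝔢 : BigradedLieAlgebra E) (I : Submodule ℚ E) (m d : κ → ℤ)
    (g : κ → E) (ρ : E →ₗ[ℚ] WordAlgebra κ) : Prop where
  mem : ∀ k, g k ∈ 𝔢.gr (m k) (d k)
  ideal : ∀ x, ∀ y ∈ I, 𝔢.bracket x y ∈ I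
  commutators : 𝔢.MapsToCommutators ρ
  map_ideal : ∀ x ∈ I, ρ x = 0
  map_gen : ∀ k, ρ (g k) = word [k]
  span_eq_top : Submodule.span ℚ ({x | x ∈ I ∧ ∃ n k, x ∈ 𝔢.gr n k} ∪
    {x | ∃ a n k, 𝔢.IsIteratedBracket m d g a n k x}) = ⊤

variable (𝔢 I m d g) in
/-- `IsGradedProduct 𝔢 I m d g a p` means that `p` is a product, in `Sym(𝔢[1])`, of homogeneous
elements of `I` and of iterated brackets of altogether `a` of the elements `g k`. -/
inductive IsGradedProduct : ℕ → 𝔢.CE → Prop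
  | one : IsGradedProduct 0 1
  | ideal {a : ℕ} {n k : ℤ} {x : E} {p : 𝔢.CE} (hx : x ∈ 𝔢.gr n k) (hxI : x ∈ I)
      (hp : IsGradedProduct a p) : IsGradedProduct a (𝔢.ceι x * p)
  | iterated {a b : ℕ} {n k : ℤ} {x : E} {p : 𝔢.CE} (hx : 𝔢.IsIteratedBracket m d g a n k x)
      (hp : IsGradedProduct b p) : IsGradedProduct (a + b) (𝔢.ceι x * p)

variable (𝔢 I) in
/-- The image of `Sym(I[1])` in `Sym(𝔢[1])`. -/
def symIdeal : Submodule ℚ 𝔢.CE :=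
  (Algebra.adjoin ℚ (𝔢.ceι '' {x | x ∈ I ∧ ∃ n k, x ∈ 𝔢.gr n k})).toSubmodule

theorem one_mem_symIdeal : 1 ∈ 𝔢.symIdeal I := one_mem (Algebra.adjoin ℚ _)

theorem ι_mul_mem_symIdeal {n k : ℤ} {x : E} (hx : x ∈ 𝔢.gr n k) (hxI : x ∈ I) {p : 𝔢.CE}
    (hp : p ∈ 𝔢.symIdeal I) : 𝔢.ceι x * p ∈ 𝔢.symIdeal I :=
  mul_mem (S := Subalgebra ℚ 𝔢.CE) (Algebra.subset_adjoin ⟨x, ⟨hxI, n, k, hx⟩, rfl⟩) hp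

/-- To prove a statement about `Sym(I[1])`, it suffices to consider left multiplication by homogeneous
elements of `I`. -/
theorem symIdeal_induction {p : ∀ a, a ∈ 𝔢.symIdeal I → Prop} (one : p 1 one_mem_symIdeal)
    (zero : p 0 (zero_mem _)) (add : ∀ a b ha hb, p a ha → p b hb → p (a + b) (add_mem ha hb))
    (smul : ∀ (r : ℚ) a ha, p a ha → p (r • a) (Submodule.smul_mem _ r ha))
    (ι_mul : ∀ (n k : ℤ) (x : E) (hx : x ∈ 𝔢.gr n k) (hxI : x ∈ I) (a) (ha : a ∈ 𝔢.symIdeal I),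
      p a ha → p (𝔢.ceι x * a) (ι_mul_mem_symIdeal hx hxI ha)) {a : 𝔢.CE}
    (ha : a ∈ 𝔢.symIdeal I) : p a ha := by
  suffices h : ∃ h : a ∈ 𝔢.symIdeal I, p a h from h.2
  rw [symIdeal, Algebra.adjoin_eq_span] at ha
  induction ha using Submodule.span_induction with
  | mem a ha =>
    induction ha using Submonoid.closure_induction_left with
    | one => exact ⟨_, one⟩
    | mul_left x hx a ha hpa =>
      obtain ⟨x, ⟨hxI, n, k, hx⟩, rfl⟩ := hx
      exact ⟨_, ι_mul n k x hx hxI a hpa.1 hpa.2⟩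
  | zero => exact ⟨_, zero⟩
  | add a b _ _ ha hb => exact ⟨_, add a b _ _ ha.2 hb.2⟩
  | smul r a _ ha => exact ⟨_, smul r a _ ha.2⟩

theorem IsGradedProduct.mem_symIdeal {a : ℕ} {p : 𝔢.CE} (hp : 𝔢.IsGradedProduct I m d g a p)
    (ha : a = 0) : p ∈ 𝔢.symIdeal I := by
  induction hp with
  | one => exact one_mem_symIdeal
  | ideal hx hxI hp ih => exact ι_mul_mem_symIdeal hx hxI (ih ha)
  | iterated hx hp ih => have := hx.pos; omega

variable (𝔢 I g) in
/-- The subspace `Sym(I[1]) + ∑ₖ g k · Sym(I[1])` of `Sym(𝔢[1])`, which is a direct sum and a subcomplex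
in the setting of `IsFreeExtension`. -/
def genComplex : Submodule ℚ 𝔢.CE :=
  𝔢.symIdeal I ⊔ ⨆ k, (𝔢.symIdeal I).map (LinearMap.mulLeft ℚ (𝔢.ceι (g k)))

namespace IsFreeExtension

theorem ceSign_mem_symIdeal (k : ℤ) {p : 𝔢.CE} (hp : p ∈ 𝔢.symIdeal I) :
    𝔢.ceSign k p ∈ 𝔢.symIdeal I := by
  induction hp using symIdeal_induction with
  | one => simpa using one_mem_symIdeal
  | zero => simp
  | add a b _ _ ha hb => rw [map_add]; exact add_mem ha hb
  | smul r a _ ha => rw [map_smul]; exact Submodule.smul_mem _ r ha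
  | ι_mul n j x hx hxI a _ ha =>
    have hx' : x ∈ 𝔢.gr.shift n (j + 1) := by simpa [BigradedFamily.shift] using hx
    rw [ceSign_ι_mul hx']
    exact Submodule.smul_mem _ _ (ι_mul_mem_symIdeal hx hxI ha)

theorem ceθ_mem_symIdeal (h : 𝔢.IsFreeExtension I m d g ρ) (k : κ) {p : 𝔢.CE}
    (hp : p ∈ 𝔢.symIdeal I) : 𝔢.ceθ (g k) p ∈ 𝔢.symIdeal I := by
  induction hp using symIdeal_induction with
  | one => rw [ceθ_one]; exact zero_mem _
  | zero => simp
  | add a b _ _ ha hb => rw [map_add]; exact add_mem ha hb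
  | smul r a _ ha => rw [map_smul]; exact Submodule.smul_mem _ r ha
  | ι_mul n j x hx hxI a ha0 ha =>
    have hx' : x ∈ 𝔢.gr.shift n (j + 1) := by simpa [BigradedFamily.shift] using hx
    rw [𝔢.ceθ_ι_mul hx' (h.mem k)]
    exact add_mem (Submodule.smul_mem _ _ (ι_mul_mem_symIdeal (𝔢.bracket_mem (h.mem k) hx)
      (h.ideal _ _ hxI) ha0)) (Submodule.smul_mem _ _ (ι_mul_mem_symIdeal hx hxI ha))

theorem coefJ_symIdeal (h : 𝔢.IsFreeExtension I m d g ρ) {p : 𝔢.CE}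
    (hp : p ∈ 𝔢.symIdeal I) : 𝔢.coefJ ρ p = 0 := by
  induction hp using symIdeal_induction with
  | one => exact coefJ_one ρ
  | zero => simp
  | add a b _ _ ha hb => rw [map_add, ha, hb, add_zero]
  | smul r a _ ha => rw [map_smul, ha, smul_zero]
  | ι_mul n j x hx hxI a _ ha =>
    have hx' : x ∈ 𝔢.gr.shift n (j + 1) := by simpa [BigradedFamily.shift] using hx
    rw [coefJ_ι_mul ρ hx', ha, h.map_ideal x hxI]
    simp

theorem augmentation_iterated (h : 𝔢.IsFreeExtension I m d g ρ) {a : ℕ} {n k : ℤ} {x : E}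
    (hx : 𝔢.IsIteratedBracket m d g a n k x) : augmentation (ρ x) = 0 := by
  induction hx with
  | gen k => rw [h.map_gen, augmentation_word]; simp
  | bracket hx hy h1 h2 =>
    rw [h.commutators.map_bracket (hx.mem h.mem) (hy.mem h.mem), map_sub, map_smul, augmentation_mul,
      augmentation_mul, h1, h2]
    simp

theorem augmentation_map (h : 𝔢.IsFreeExtension I m d g ρ) (x : E) : augmentation (ρ x) = 0 := by
  have hx : x ∈ Submodule.span ℚ ({x | x ∈ I ∧ ∃ n k, x ∈ 𝔢.gr n k} ∪
    {x | ∃ a n k, 𝔢.IsIteratedBracket m d g a n k x}) := by rw [h.span_eq_top]; trivial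
  induction hx using Submodule.span_induction with
  | mem x hx =>
    rcases hx with ⟨hx, -⟩ | ⟨a, n, k, hx⟩
    · rw [h.map_ideal x hx, map_zero]
    · exact h.augmentation_iterated hx
  | zero => simp
  | add a b _ _ ha hb => rw [map_add, map_add, ha, hb, add_zero]
  | smul r a _ ha => rw [map_smul, map_smul, ha, smul_zero]

/-- The graded commutator of the homotopy with the action of an iterated bracket `x` of `a`
generators is multiplication by `a x`, since both sides are derivations in `x`. -/
theorem coefHomotopy_coefΘ (h : 𝔢.IsFreeExtension I m d g ρ) {a : ℕ} {n k : ℤ} {x : E}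
    (hx : 𝔢.IsIteratedBracket m d g a n k x) (ξ : 𝔢.CE ⊗[ℚ] WordAlgebra κ) :
    𝔢.coefHomotopy d g ρ (coefΘ ρ k x ξ) =
      koszulSign k • coefΘ ρ k x (𝔢.coefHomotopy d g ρ ξ) + (a : ℚ) • coefι _ x ξ := by
  induction hx generalizing ξ with
  | gen k => rw [coefHomotopy_coefΘ_gen h.map_gen]; simp
  | @bracket a b n i n' j x y hx hy ihx ihy =>
    have hx0 := hx.mem h.mem
    have hy0 := hy.mem h.mem
    have hx' : x ∈ 𝔢.gr.shift n (i + 1) := by simpa [BigradedFamily.shift] using hx0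
    have hy' : y ∈ 𝔢.gr.shift n' (j + 1) := by simpa [BigradedFamily.shift] using hy0
    have hyx : coefι (WordAlgebra κ) (𝔢.bracket y x) ξ =
        -(koszulSign (i * j) • coefι (WordAlgebra κ) (𝔢.bracket x y) ξ) := by
      rw [eq_neg_of_add_eq_zero_left (𝔢.skew hy0 hx0), ← neg_smul, coefι_smul, mul_comm j i,
        neg_smul]
    rw [h.commutators.coefΘ_bracket hx0 hy0, h.commutators.coefΘ_bracket hx0 hy0]
    simp only [map_sub, map_smul, map_add, ihx, ihy, coefΘ_coefι ρ hx' hy0, coefΘ_coefι ρ hy' hx0,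
      hyx]
    rcases Int.even_or_odd i with hi | hi <;> rcases Int.even_or_odd j with hj | hj <;>
      simp [mul_add, koszulSign_add, koszulSign_even, koszulSign_odd, hi, hj,
        Even.mul_left, Even.mul_right, Odd.mul] <;> module

end IsFreeExtension

/-! ### The eigenspaces of `∂ h + h ∂` -/

variable (𝔢 d g ρ) in
/-- The operator `∂ h + h ∂`. -/
def coefLaplacian : Module.End ℚ (𝔢.CE ⊗[ℚ] WordAlgebra κ) :=
  𝔢.coefD ρ * 𝔢.coefHomotopy d g ρ + 𝔢.coefHomotopy d g ρ * 𝔢.coefD ρ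

theorem coefLaplacian_apply (ξ : 𝔢.CE ⊗[ℚ] WordAlgebra κ) :
    𝔢.coefLaplacian d g ρ ξ =
      𝔢.coefD ρ (𝔢.coefHomotopy d g ρ ξ) + 𝔢.coefHomotopy d g ρ (𝔢.coefD ρ ξ) := rfl

variable (𝔢 I m d g ρ) in
/-- The elements obtained from `p ⊗ 1`, where `p` is a graded product, by the actions of the
generators; the first index counts the generators that are involved. -/
inductive IsDiagonal : ℕ → 𝔢.CE ⊗[ℚ] WordAlgebra κ → Prop
  | base {a : ℕ} {p : 𝔢.CE} (hp : 𝔢.IsGradedProduct I m d g a p) : IsDiagonal a (p ⊗ₜ 1)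
  | step {a : ℕ} {ξ : 𝔢.CE ⊗[ℚ] WordAlgebra κ} (k : κ) (hξ : IsDiagonal a ξ) :
      IsDiagonal (a + 1) (coefΘ ρ (d k) (g k) ξ)

namespace IsFreeExtension

theorem coefLaplacian_coefD (h : 𝔢.IsFreeExtension I m d g ρ) (ξ : 𝔢.CE ⊗[ℚ] WordAlgebra κ) :
    𝔢.coefLaplacian d g ρ (𝔢.coefD ρ ξ) = 𝔢.coefD ρ (𝔢.coefLaplacian d g ρ ξ) := by
  simp only [coefLaplacian_apply, map_add, h.commutators.coefD_coefD, map_zero, add_zero, zero_add]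

theorem coefLaplacian_coefΘ_gen (h : 𝔢.IsFreeExtension I m d g ρ) (k : κ)
    (ξ : 𝔢.CE ⊗[ℚ] WordAlgebra κ) :
    𝔢.coefLaplacian d g ρ (coefΘ ρ (d k) (g k) ξ) =
      coefΘ ρ (d k) (g k) (𝔢.coefLaplacian d g ρ ξ) + coefΘ ρ (d k) (g k) ξ := by
  have hg' : g k ∈ 𝔢.gr.shift (m k) (d k + 1) := by simpa [BigradedFamily.shift] using h.mem k
  simp only [coefLaplacian_apply, coefHomotopy_coefΘ_gen h.map_gen, map_add, map_smul,
    h.commutators.coefD_coefΘ (h.mem k), coefD_coefι ρ hg', add_sub_cancel_right, smul_add,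
    smul_smul, koszulSign_mul_self, koszulSign_add, koszulSign_odd odd_one]
  module

theorem coefLaplacian_coefι (h : 𝔢.IsFreeExtension I m d g ρ) {n k : ℤ} {x : E}
    (hx : x ∈ 𝔢.gr n k) (ξ : 𝔢.CE ⊗[ℚ] WordAlgebra κ) :
    𝔢.coefLaplacian d g ρ (coefι _ x ξ) = coefι _ x (𝔢.coefLaplacian d g ρ ξ) +
      (𝔢.coefHomotopy d g ρ (coefΘ ρ k x ξ) -
        koszulSign k • coefΘ ρ k x (𝔢.coefHomotopy d g ρ ξ)) := by
  have hx' : x ∈ 𝔢.gr.shift n (k + 1) := by simpa [BigradedFamily.shift] using hx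
  simp only [coefLaplacian_apply, coefHomotopy_coefι h.map_gen h.mem hx', coefD_coefι ρ hx',
    map_add, map_smul, add_sub_cancel_right, smul_add, smul_smul, koszulSign_mul_self]
  simp only [koszulSign_add, koszulSign_odd odd_one]
  module

theorem coefLaplacian_gradedProduct (h : 𝔢.IsFreeExtension I m d g ρ) {a : ℕ} {p : 𝔢.CE}
    (hp : 𝔢.IsGradedProduct I m d g a p) :
    𝔢.coefLaplacian d g ρ (p ⊗ₜ 1) = (a : ℚ) • p ⊗ₜ 1 := by
  induction hp with
  | one => rw [coefLaplacian_apply, coefHomotopy_tmul_one, coefD_one_tmul]; simp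
  | @ideal a n k x p hx hxI hp ih =>
    have := h.coefLaplacian_coefι hx (p ⊗ₜ[ℚ] 1)
    rw [ih, coefΘ_tmul, h.map_ideal x hxI, coefHomotopy_tmul_one] at this
    rw [← coefι_tmul, this]
    simp [coefHomotopy_tmul_one]
  | @iterated a b n k x p hx hp ih =>
    have := h.coefLaplacian_coefι (hx.mem h.mem) (p ⊗ₜ[ℚ] 1)
    rw [ih, h.coefHomotopy_coefΘ hx] at this
    rw [← coefι_tmul, this, map_smul]
    push_cast
    module

theorem coefLaplacian_diagonal (h : 𝔢.IsFreeExtension I m d g ρ) {a : ℕ}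
    {ξ : 𝔢.CE ⊗[ℚ] WordAlgebra κ} (hξ : 𝔢.IsDiagonal I m d g ρ a ξ) :
    𝔢.coefLaplacian d g ρ ξ = (a : ℚ) • ξ := by
  induction hξ with
  | base hp => exact h.coefLaplacian_gradedProduct hp
  | step k hξ ih => rw [h.coefLaplacian_coefΘ_gen, ih, map_smul]; push_cast; module

theorem mem_span_gradedProduct (h : 𝔢.IsFreeExtension I m d g ρ) (p : 𝔢.CE) :
    p ∈ Submodule.span ℚ {p | ∃ a, 𝔢.IsGradedProduct I m d g a p} := by
  induction p using KoszulSym.induction with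
  | one => exact Submodule.subset_span ⟨0, .one⟩
  | add a b ha hb => exact add_mem ha hb
  | smul r a ha => exact Submodule.smul_mem _ r ha
  | ι_mul x p hp =>
    have hx : x ∈ Submodule.span ℚ ({x | x ∈ I ∧ ∃ n k, x ∈ 𝔢.gr n k} ∪
      {x | ∃ a n k, 𝔢.IsIteratedBracket m d g a n k x}) := by rw [h.span_eq_top]; trivial
    induction hp using Submodule.span_induction with
    | zero => simp
    | add a b _ _ ha hb => rw [mul_add]; exact add_mem ha hb
    | smul r a _ ha => rw [mul_smul_comm]; exact Submodule.smul_mem _ r ha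
    | mem p hp =>
      obtain ⟨b, hp⟩ := hp
      induction hx using Submodule.span_induction with
      | zero => simp
      | add a b _ _ ha hb => rw [map_add, add_mul]; exact add_mem ha hb
      | smul r a _ ha => rw [map_smul, smul_mul_assoc]; exact Submodule.smul_mem _ r ha
      | mem x hx =>
        rcases hx with ⟨hxI, n, k, hx⟩ | ⟨a, n, k, hx⟩
        · exact Submodule.subset_span ⟨_, .ideal hx hxI hp⟩
        · exact Submodule.subset_span ⟨_, .iterated hx hp⟩

/-- The elements on which `∂ h + h ∂` is known to act by a scalar span. -/
theorem iSup_diagonal (h : 𝔢.IsFreeExtension I m d g ρ) :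
    ⨆ a, Submodule.span ℚ {ξ | 𝔢.IsDiagonal I m d g ρ a ξ} = ⊤ := by
  set T := ⨆ a, Submodule.span ℚ {ξ | 𝔢.IsDiagonal I m d g ρ a ξ}
  have hT {a : ℕ} {ξ} (hξ : 𝔢.IsDiagonal I m d g ρ a ξ) : ξ ∈ T :=
    Submodule.mem_iSup_of_mem a (Submodule.subset_span hξ)
  have hstep (k : κ) {ξ} (hξ : ξ ∈ T) : coefΘ ρ (d k) (g k) ξ ∈ T := by
    induction hξ using Submodule.iSup_induction' with
    | zero => simp
    | add a b _ _ ha hb => rw [map_add]; exact add_mem ha hb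
    | mem a ξ hξ =>
      induction hξ using Submodule.span_induction with
      | zero => simp
      | add a b _ _ ha hb => rw [map_add]; exact add_mem ha hb
      | smul r a _ ha => rw [map_smul]; exact Submodule.smul_mem _ r ha
      | mem ξ hξ => exact hT (.step k hξ)
  refine (Submodule.eq_top_iff' (p := T)).2 fun ξ => ?_
  induction ξ using tmul_word_induction with
  | add a b ha hb => exact add_mem ha hb
  | tmul p w =>
    induction w generalizing p with
    | cons k w ih =>
      rw [tmul_word_cons (d := d) h.map_gen]
      exact sub_mem (hstep k (ih _)) (ih _)
    | nil =>
      rw [word_nil]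
      have hp := h.mem_span_gradedProduct p
      induction hp using Submodule.span_induction with
      | zero => simp
      | add a b _ _ ha hb => rw [add_tmul]; exact add_mem ha hb
      | smul r a _ ha => rw [← smul_tmul']; exact Submodule.smul_mem _ r ha
      | mem p hp => obtain ⟨a, hp⟩ := hp; exact hT (.base hp)

/-- An element whose boundary is killed by `∂ h + h ∂` is homologous to an element of `Sym(I[1])`.
Here the zero eigenspace of `∂ h + h ∂` is `Sym(I[1]) ⊗ 1`, and `h` contracts the other ones. -/
theorem exists_eq_tmul_one_add (h : 𝔢.IsFreeExtension I m d g ρ) {ξ : 𝔢.CE ⊗[ℚ] WordAlgebra κ}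
    (hξ : 𝔢.coefLaplacian d g ρ (𝔢.coefD ρ ξ) = 0) :
    ∃ a ∈ 𝔢.symIdeal I, ∃ η, ξ = a ⊗ₜ 1 + 𝔢.coefD ρ η := by
  set N := 𝔢.coefLaplacian d g ρ with hN
  have hmem : ξ ∈ ⨆ a, Submodule.span ℚ {ξ | 𝔢.IsDiagonal I m d g ρ a ξ} := by
    rw [h.iSup_diagonal]; trivial
  obtain ⟨f, hf, rfl⟩ := (Submodule.mem_iSup_iff_exists_finsupp _ _).1 hmem
  have hNf (n : ℕ) : N (f n) = (n : ℚ) • f n := by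
    have := hf n
    generalize f n = ξ at this
    induction this using Submodule.span_induction with
    | zero => simp
    | add a b _ _ ha hb => rw [map_add, ha, hb, smul_add]
    | smul r a _ ha => rw [map_smul, ha, smul_comm]
    | mem ξ hξ => exact h.coefLaplacian_diagonal hξ
  have hNd (n : ℕ) : N (𝔢.coefD ρ (f n)) = (n : ℚ) • 𝔢.coefD ρ (f n) := by
    rw [hN, h.coefLaplacian_coefD, ← hN, hNf, map_smul]
  have hind : iSupIndep fun n : ℕ => N.eigenspace (n : ℚ) :=
    N.eigenspaces_iSupIndep.comp Nat.cast_injective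
  -- The boundaries of the components of `ξ` lie in different eigenspaces, so each is killed.
  have hzero : ∀ n ∈ f.support, (n : ℚ) • 𝔢.coefD ρ (f n) = 0 := by
    refine (iSupIndep_iff_finsetSum_eq_zero_imp_eq_zero _).1 hind f.support
      (fun n => (n : ℚ) • 𝔢.coefD ρ (f n)) (fun n _ => ?_) ?_
    · refine Submodule.smul_mem _ _ ?_
      rw [Module.End.mem_eigenspace_iff]
      exact hNd n
    · rw [Finsupp.sum, map_sum, map_sum] at hξ
      rw [← hξ]
      exact Finset.sum_congr rfl fun n _ => (hNd n).symm
  have key : ∀ n, ∃ a ∈ 𝔢.symIdeal I, ∃ η, f n = a ⊗ₜ 1 + 𝔢.coefD ρ η := by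
    intro n
    by_cases hn : n = 0
    · subst hn
      have := hf 0
      generalize f 0 = ξ at this
      induction this using Submodule.span_induction with
      | zero => exact ⟨0, zero_mem _, 0, by simp⟩
      | add _ _ _ _ h1 h2 =>
        obtain ⟨a, ha, η, rfl⟩ := h1
        obtain ⟨b, hb, η', rfl⟩ := h2
        exact ⟨a + b, add_mem ha hb, η + η', by rw [add_tmul, map_add]; abel⟩
      | smul r _ _ h1 =>
        obtain ⟨a, ha, η, rfl⟩ := h1
        exact ⟨r • a, Submodule.smul_mem _ r ha, r • η, by rw [map_smul, smul_add, smul_tmul']⟩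
      | mem ξ hξ =>
        simp only [Set.mem_ofPred_eq] at hξ
        generalize hz : (0 : ℕ) = z at hξ
        cases hξ with
        | base hp => exact ⟨_, hp.mem_symIdeal hz.symm, 0, by simp⟩
        | step k hξ => omega
    -- On the eigenspace of `n ≠ 0`, the operator `h / n` is a contraction.
    · refine ⟨0, zero_mem _, (n : ℚ)⁻¹ • 𝔢.coefHomotopy d g ρ (f n), ?_⟩
      have hn' : (n : ℚ) ≠ 0 := Nat.cast_ne_zero.2 hn
      have hd : 𝔢.coefD ρ (f n) = 0 := by
        by_cases hs : n ∈ f.support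
        · exact (smul_eq_zero.1 (hzero n hs)).resolve_left hn'
        · rw [Finsupp.notMem_support_iff.1 hs, map_zero]
      have := hNf n
      rw [hN, coefLaplacian_apply, hd, map_zero, add_zero] at this
      rw [map_smul, this, zero_tmul, zero_add, smul_smul, inv_mul_cancel₀ hn', one_smul]
  choose a ha η hη using key
  refine ⟨∑ n ∈ f.support, a n, sum_mem fun n _ => ha n, ∑ n ∈ f.support, η n, ?_⟩
  rw [Finsupp.sum, sum_tmul, map_sum, ← Finset.sum_add_distrib]
  exact Finset.sum_congr rfl fun n _ => hη n

theorem coefLaplacian_symIdeal_tmul_one (h : 𝔢.IsFreeExtension I m d g ρ) {a : 𝔢.CE}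
    (ha : a ∈ 𝔢.symIdeal I) : 𝔢.coefLaplacian d g ρ (a ⊗ₜ 1) = 0 := by
  rw [coefLaplacian_apply, coefHomotopy_tmul_one, coefD_tmul, h.coefJ_symIdeal ha]
  simp [coefHomotopy_tmul_one]

/-! ### Representing cycles -/

/-- The map `Sym(𝔢[1]) ⊗ A → Sym(𝔢[1])` given by the augmentation of `A`. -/
def coefAugmentation (𝔢 : BigradedLieAlgebra E) : 𝔢.CE ⊗[ℚ] WordAlgebra κ →ₗ[ℚ] 𝔢.CE :=
  (TensorProduct.rid ℚ 𝔢.CE).toLinearMap ∘ₗ LinearMap.lTensor 𝔢.CE augmentation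

theorem coefAugmentation_tmul (p : 𝔢.CE) (u : WordAlgebra κ) :
    coefAugmentation 𝔢 (p ⊗ₜ u) = augmentation u • p := rfl

theorem coefAugmentation_coefι (x : E) (ξ : 𝔢.CE ⊗[ℚ] WordAlgebra κ) :
    coefAugmentation 𝔢 (coefι _ x ξ) = 𝔢.ceι x * coefAugmentation 𝔢 ξ := by
  induction ξ with
  | zero => simp
  | add a b ha hb => simp only [map_add, ha, hb, mul_add]
  | tmul p u => rw [coefι_tmul, coefAugmentation_tmul, coefAugmentation_tmul, mul_smul_comm]

theorem coefAugmentation_coefR (u : WordAlgebra κ) (ξ : 𝔢.CE ⊗[ℚ] WordAlgebra κ) :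
    coefAugmentation 𝔢 (𝔢.coefR u ξ) = augmentation u • coefAugmentation 𝔢 ξ := by
  induction ξ with
  | zero => simp
  | add a b ha hb => simp only [map_add, ha, hb, smul_add]
  | tmul p v =>
    rw [coefR_tmul, coefAugmentation_tmul, coefAugmentation_tmul, augmentation_mul, smul_smul,
      mul_comm]

theorem coefAugmentation_coefJ (h : 𝔢.IsFreeExtension I m d g ρ) (p : 𝔢.CE) :
    coefAugmentation 𝔢 (𝔢.coefJ ρ p) = 0 := by
  induction p using KoszulSym.induction with
  | one => rw [coefJ_one, map_zero]
  | add a b ha hb => rw [map_add, map_add, ha, hb, add_zero]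
  | smul r a ha => rw [map_smul, map_smul, ha, smul_zero]
  | ι_mul y p hp =>
    induction y using 𝔢.toBigrading.induction with
    | zero => simp
    | add a b ha hb => rw [map_add, add_mul, map_add, map_add, ha, hb, add_zero]
    | hom o j y hy =>
      have hy' : y ∈ 𝔢.gr.shift o (j + 1) := by simpa [BigradedFamily.shift] using hy
      rw [coefJ_ι_mul ρ hy', map_add, map_smul, coefAugmentation_tmul, coefAugmentation_coefι, hp,
        h.augmentation_map]
      simp

theorem coefAugmentation_coefD (h : 𝔢.IsFreeExtension I m d g ρ) (ξ : 𝔢.CE ⊗[ℚ] WordAlgebra κ) :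
    coefAugmentation 𝔢 (𝔢.coefD ρ ξ) = 𝔢.ceD (coefAugmentation 𝔢 ξ) := by
  induction ξ with
  | zero => simp
  | add a b ha hb => simp only [map_add, ha, hb]
  | tmul p u =>
    rw [coefD_tmul, map_add, coefAugmentation_coefR, h.coefAugmentation_coefJ,
      coefAugmentation_tmul, coefAugmentation_tmul, map_smul, smul_zero, add_zero]

/-- The operator on `Sym(𝔢[1]) ⊗ A` that strips the last letter `k`. -/
def coefStrip (𝔢 : BigradedLieAlgebra E) (k : κ) : Module.End ℚ (𝔢.CE ⊗[ℚ] WordAlgebra κ) :=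
  LinearMap.lTensor 𝔢.CE (strip k)

open Classical in
theorem coefStrip_coefR (j k : κ) (ξ : 𝔢.CE ⊗[ℚ] WordAlgebra κ) :
    coefStrip 𝔢 k (𝔢.coefR (word [j]) ξ) = if j = k then ξ else 0 := by
  induction ξ with
  | zero => simp
  | add a b ha hb => rw [map_add, map_add, ha, hb]; split_ifs <;> simp
  | tmul p v =>
    rw [coefR_tmul, coefStrip, LinearMap.lTensor_tmul, strip_mul]
    split_ifs <;> simp

theorem eq_augmentation_add_coefStrip [Fintype κ] (ξ : 𝔢.CE ⊗[ℚ] WordAlgebra κ) :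
    ξ = coefAugmentation 𝔢 ξ ⊗ₜ 1 + ∑ k, 𝔢.coefR (word [k]) (coefStrip 𝔢 k ξ) := by
  induction ξ with
  | zero => simp
  | add a b ha hb =>
    conv_lhs => rw [ha, hb]
    simp only [map_add, add_tmul, Finset.sum_add_distrib]
    abel
  | tmul p v =>
    conv_lhs => rw [eq_augmentation_add v]
    simp only [coefAugmentation_tmul, coefStrip, LinearMap.lTensor_tmul, coefR_tmul, tmul_add,
      tmul_sum, tmul_smul, smul_tmul']

/-- Every cycle of the Chevalley–Eilenberg complex is homologous to a cycle of the subcomplex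
`Sym(I[1]) ⊕ ⨁ₖ g k · Sym(I[1])`. -/
theorem exists_eq_add_ceD [Fintype κ] (h : 𝔢.IsFreeExtension I m d g ρ) {z : 𝔢.CE}
    (hz : 𝔢.ceD z = 0) : ∃ f ∈ 𝔢.genComplex I g, ∃ b, z = f + 𝔢.ceD b := by
  classical
  have hz1 : 𝔢.coefD ρ (z ⊗ₜ 1) = ∑ k, 𝔢.coefR (word [k]) (coefStrip 𝔢 k (𝔢.coefJ ρ z)) := by
    have hR : 𝔢.coefR (1 : WordAlgebra κ) (𝔢.coefJ ρ z) = 𝔢.coefJ ρ z := by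
      simp [coefR]
    rw [coefD_tmul, hz, zero_tmul, zero_add, hR]
    conv_lhs => rw [eq_augmentation_add_coefStrip (𝔢.coefJ ρ z)]
    rw [h.coefAugmentation_coefJ, zero_tmul, zero_add]
  set τ := fun k => coefStrip 𝔢 k (𝔢.coefJ ρ z) with hτ
  -- Stripping the last letter shows that each `τ k` is a cycle.
  have hτ0 (k : κ) : 𝔢.coefD ρ (τ k) = 0 := by
    have h1 := h.commutators.coefD_coefD (z ⊗ₜ 1)
    rw [hz1, map_sum] at h1
    simp only [coefD_coefR] at h1
    have h2 := congrArg (coefStrip 𝔢 k) h1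
    rw [map_sum] at h2
    simpa [coefStrip_coefR] using h2
  have hτ1 (k : κ) : ∃ a ∈ 𝔢.symIdeal I, ∃ η, τ k = a ⊗ₜ 1 + 𝔢.coefD ρ η :=
    h.exists_eq_tmul_one_add (by rw [hτ0, map_zero])
  choose a ha η hη using hτ1
  have hDa (k : κ) : 𝔢.ceD (a k) = 0 := by
    have h1 := hτ0 k
    rw [hη, map_add, h.commutators.coefD_coefD, add_zero] at h1
    have h2 := congrArg (coefAugmentation 𝔢) h1
    rw [h.coefAugmentation_coefD, coefAugmentation_tmul, map_zero, ← word_nil,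
      augmentation_word] at h2
    simpa using h2
  set a' := fun k => 𝔢.ceSign (d k) (a k) with ha'
  have hDa' (k : κ) : 𝔢.ceD (a' k) = 0 := by
    have h1 := ceSign_ceD (d k) (a k)
    rw [hDa, map_zero] at h1
    have h2 := congrArg (koszulSign (d k) • ·) h1
    simpa [smul_smul, koszulSign_mul_self] using h2.symm
  have ha'mem (k : κ) : a' k ∈ 𝔢.symIdeal I := ceSign_mem_symIdeal _ (ha k)
  -- The boundary of `g k · a' k ⊗ 1` cancels `a k ⊗ word [k]`, up to an element of `Sym(I[1])`.
  have hga (k : κ) : 𝔢.coefD ρ ((𝔢.ceι (g k) * a' k) ⊗ₜ 1) =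
      𝔢.ceθ (g k) (a' k) ⊗ₜ 1 + a k ⊗ₜ word [k] := by
    have hg' : g k ∈ 𝔢.gr.shift (m k) (d k + 1) := by simpa [BigradedFamily.shift] using h.mem k
    rw [← coefι_tmul, coefD_coefι ρ hg', add_sub_cancel_right, coefD_tmul, hDa',
      h.coefJ_symIdeal (ha'mem k), coefΘ_tmul, ha', ceSign_self, h.map_gen, mul_one]
    simp
  set ω := z ⊗ₜ[ℚ] (1 : WordAlgebra κ) - ∑ k, 𝔢.coefR (word [k]) (η k) -
    ∑ k, (𝔢.ceι (g k) * a' k) ⊗ₜ[ℚ] (1 : WordAlgebra κ) with hω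
  have hDω : 𝔢.coefD ρ ω = (-∑ k, 𝔢.ceθ (g k) (a' k)) ⊗ₜ 1 := by
    have h1 (k : κ) : 𝔢.coefR (word [k]) (τ k) =
        a k ⊗ₜ word [k] + 𝔢.coefR (word [k]) (𝔢.coefD ρ (η k)) := by
      rw [hη, map_add, coefR_tmul, one_mul]
    rw [hω, map_sub, map_sub, map_sum, map_sum, hz1]
    simp only [coefD_coefR, hga]
    change ∑ k, 𝔢.coefR (word [k]) (τ k) - _ - _ = _
    simp only [h1, Finset.sum_add_distrib, neg_tmul, sum_tmul]
    abel
  obtain ⟨c, hc, ζ, hζ⟩ := h.exists_eq_tmul_one_add (ξ := ω) (by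
    rw [hDω]
    exact h.coefLaplacian_symIdeal_tmul_one
      (neg_mem (sum_mem fun k _ => h.ceθ_mem_symIdeal k (ha'mem k))))
  have haug1 : augmentation (1 : WordAlgebra κ) = 1 := by rw [← word_nil, augmentation_word]; simp
  have hfin := congrArg (coefAugmentation 𝔢) hζ
  rw [map_add, h.coefAugmentation_coefD, coefAugmentation_tmul, haug1, one_smul, hω, map_sub,
    map_sub, map_sum, map_sum, coefAugmentation_tmul, haug1, one_smul] at hfin
  simp only [coefAugmentation_coefR, coefAugmentation_tmul, haug1, one_smul] at hfin
  have haugk (k : κ) : augmentation (word [k]) = 0 := by rw [augmentation_word]; simp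
  simp only [haugk, zero_smul, Finset.sum_const_zero, sub_zero] at hfin
  refine ⟨c + ∑ k, 𝔢.ceι (g k) * a' k, ?_, coefAugmentation 𝔢 ζ, ?_⟩
  · refine add_mem (Submodule.mem_sup_left hc) (sum_mem fun k _ => Submodule.mem_sup_right ?_)
    exact Submodule.mem_iSup_of_mem k ⟨a' k, ha'mem k, rfl⟩
  · rw [sub_eq_iff_eq_add] at hfin
    rw [hfin]; abel

end IsFreeExtension

end FreeExtension

end BigradedLieAlgebra

/-! ### The bigrading of the Chevalley–Eilenberg complex -/

namespace Bigrading

variable {V : Type*} [AddCommGroup V] [Module ℚ V]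

/-- The suspension of a bigrading. -/
def shift (𝒱 : Bigrading V) : Bigrading V :=
  ofSeparating 𝒱.gr.shift
    (by
      refine (Submodule.eq_top_iff' (p := _)).2 fun x => ?_
      induction x using 𝒱.induction with
      | zero => exact zero_mem _
      | add a b ha hb => exact add_mem ha hb
      | hom n i x hx =>
        exact Submodule.mem_iSup_of_mem (n, i + 1) (by simpa [BigradedFamily.shift] using hx))
    (fun p => 𝒱.proj p.1 (p.2 - 1))
    (fun p x hx h => by rwa [𝒱.proj_of_mem hx] at h)
    (fun p q hpq x hx => 𝒱.proj_of_mem_ne hx fun h => hpq (Prod.ext h.1.symm (by have := h.2; omega)))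

end Bigrading

namespace KoszulSym

variable {V : Type*} [AddCommGroup V] [Module ℚ V] {𝒱 : BigradedFamily V}

theorem one_mem_gr : (1 : KoszulSym 𝒱) ∈ gr 𝒱 0 0 :=
  Submodule.subset_span ⟨0, Fin.elim0, Fin.elim0, Fin.elim0, fun j => j.elim0, by simp, by simp,
    by simp⟩

theorem ι_mul_mem_gr {m j n i : ℤ} {x : V} {a : KoszulSym 𝒱} (hx : x ∈ 𝒱 m j)
    (ha : a ∈ gr 𝒱 n i) : ι 𝒱 x * a ∈ gr 𝒱 (m + n) (j + i) := by
  induction ha using Submodule.span_induction with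
  | mem a ha =>
    obtain ⟨k, m', d', x', hx', rfl, rfl, rfl⟩ := ha
    refine Submodule.subset_span ⟨k + 1, Fin.cons m m', Fin.cons j d', Fin.cons x x', ?_, ?_, ?_, ?_⟩
    · refine Fin.cases ?_ ?_
      · exact hx
      · exact hx'
    · simp [Fin.sum_univ_succ]
    · simp [Fin.sum_univ_succ]
    · simp [List.ofFn_succ]
  | zero => simp
  | add a b _ _ ha hb => rw [mul_add]; exact add_mem ha hb
  | smul r a _ ha => rw [mul_smul_comm]; exact Submodule.smul_mem _ r ha

theorem gr_induction {p : ∀ n i a, a ∈ gr 𝒱 n i → Prop} (one : p 0 0 1 one_mem_gr)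
    (zero : ∀ n i, p n i 0 (zero_mem _))
    (add : ∀ n i a b ha hb, p n i a ha → p n i b hb → p n i (a + b) (add_mem ha hb))
    (smul : ∀ n i (r : ℚ) a ha, p n i a ha → p n i (r • a) (Submodule.smul_mem _ r ha))
    (ι_mul : ∀ m j n i x a (hx : x ∈ 𝒱 m j) (ha : a ∈ gr 𝒱 n i), p n i a ha →
      p (m + n) (j + i) (ι 𝒱 x * a) (ι_mul_mem_gr hx ha))
    {n i : ℤ} {a : KoszulSym 𝒱} (ha : a ∈ gr 𝒱 n i) : p n i a ha := by
  suffices h : ∃ h : a ∈ gr 𝒱 n i, p n i a h from h.2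
  induction ha using Submodule.span_induction with
  | mem a ha =>
    obtain ⟨k, m', d', x', hx', rfl, rfl, rfl⟩ := ha
    induction k with
    | zero => simpa using ⟨one_mem_gr, one⟩
    | succ k ih =>
      obtain ⟨h1, h2⟩ := ih (fun j => m' j.succ) (fun j => d' j.succ) (fun j => x' j.succ)
        fun j => hx' j.succ
      rw [Fin.sum_univ_succ, Fin.sum_univ_succ, List.ofFn_succ, List.prod_cons]
      exact ⟨ι_mul_mem_gr (hx' 0) h1, ι_mul _ _ _ _ _ _ (hx' 0) h1 h2⟩
  | zero => exact ⟨_, zero n i⟩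
  | add a b _ _ ha hb => exact ⟨_, add n i a b _ _ ha.2 hb.2⟩
  | smul r a _ ha => exact ⟨_, smul n i r a _ ha.2⟩

/-- The coaction that multiplies an element of bidegree `p` by the group-like element `p`. -/
def coaction (𝒱 : Bigrading V) :
    KoszulSym 𝒱.gr →ₐ[ℚ] AddMonoidAlgebra (KoszulSym 𝒱.gr) (ℤ × ℤ) :=
  lift (𝒱 := 𝒱.gr) (𝒱.lift fun n i => AddMonoidAlgebra.lsingle (R := ℚ) (n, i) ∘ₗ ι 𝒱.gr) (by
    intro m i n j x y hx hy
    rw [𝒱.lift_apply _ hx, 𝒱.lift_apply _ hy]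
    simp only [LinearMap.comp_apply, AddMonoidAlgebra.lsingle_apply,
      AddMonoidAlgebra.single_mul_single, AddMonoidAlgebra.smul_single, ι_mul_ι 𝒱.gr hx hy]
    rw [add_comm])

theorem coaction_of_mem {𝒱 : Bigrading V} {n i : ℤ} {a : KoszulSym 𝒱.gr} (ha : a ∈ gr 𝒱.gr n i) :
    coaction 𝒱 a = AddMonoidAlgebra.single (n, i) a := by
  induction ha using gr_induction with
  | one => rw [map_one]; rfl
  | zero => simp
  | add n i a b _ _ ha hb => rw [map_add, ha, hb, AddMonoidAlgebra.single_add]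
  | smul n i r a _ ha => rw [map_smul, ha, AddMonoidAlgebra.smul_single]
  | ι_mul m j n i x a hx _ ha =>
    rw [map_mul, ha, coaction, lift_ι, 𝒱.lift_apply _ hx]
    simp [AddMonoidAlgebra.single_mul_single]

/-- The bigrading of the symmetric algebra. -/
def bigrading (𝒱 : Bigrading V) : Bigrading (KoszulSym 𝒱.gr) :=
  Bigrading.ofSeparating (gr 𝒱.gr)
    (by
      refine (Submodule.eq_top_iff' (p := _)).2 fun a => ?_
      induction a using KoszulSym.induction with
      | one => exact Submodule.mem_iSup_of_mem (0, 0) one_mem_gr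
      | add a b ha hb => exact add_mem ha hb
      | smul r a ha => exact Submodule.smul_mem _ r ha
      | ι_mul x a ha =>
        induction ha using Submodule.iSup_induction' with
        | zero => simp
        | add a b _ _ ha hb => rw [mul_add]; exact add_mem ha hb
        | mem p a ha =>
          induction x using 𝒱.induction with
          | zero => simp
          | add a b ha hb => rw [map_add, add_mul]; exact add_mem ha hb
          | hom n i x hx =>
            exact Submodule.mem_iSup_of_mem (n + p.1, i + p.2) (ι_mul_mem_gr hx ha))
    (fun p => Finsupp.lapply p ∘ₗ (AddMonoidAlgebra.coeffLinearEquiv ℚ).toLinearMap ∘ₗ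
      (coaction 𝒱).toLinearMap)
    (by
      intro p x hx h
      simpa [coaction_of_mem hx] using h)
    (by
      intro p q hpq x hx
      have : q ≠ p := hpq.symm
      simp [coaction_of_mem hx, this])

end KoszulSym

namespace BigradedLieAlgebra

variable {E : Type*} [AddCommGroup E] [Module ℚ E] {𝔢 : BigradedLieAlgebra E}

variable (𝔢) in
/-- The bigrading of the Chevalley–Eilenberg complex. -/
def ceBigrading : Bigrading 𝔢.CE := KoszulSym.bigrading 𝔢.toBigrading.shift

theorem ceι_mul_mem {m j n i : ℤ} {x : E} {a : 𝔢.CE} (hx : x ∈ 𝔢.gr.shift m j)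
    (ha : a ∈ 𝔢.ceBigrading.gr n i) : 𝔢.ceι x * a ∈ 𝔢.ceBigrading.gr (m + n) (j + i) :=
  KoszulSym.ι_mul_mem_gr hx ha

theorem ceθ_mem {o k n i : ℤ} {x : E} (hx : x ∈ 𝔢.gr o k) {a : 𝔢.CE}
    (ha : a ∈ 𝔢.ceBigrading.gr n i) : 𝔢.ceθ x a ∈ 𝔢.ceBigrading.gr (o + n) (k + i) := by
  induction ha using KoszulSym.gr_induction with
  | one => rw [ceθ_one]; exact zero_mem _
  | zero => simp
  | add n i a b _ _ ha hb => rw [map_add]; exact add_mem ha hb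
  | smul n i r a _ ha => rw [map_smul]; exact Submodule.smul_mem _ r ha
  | ι_mul m j n i y a hy ha0 ha =>
    rw [𝔢.ceθ_ι_mul hy hx]
    have hxy : 𝔢.bracket x y ∈ 𝔢.gr.shift (o + m) (k + j) := by
      have := 𝔢.bracket_mem hx hy
      rwa [← add_sub_assoc] at this
    refine add_mem (Submodule.smul_mem _ _ ?_) (Submodule.smul_mem _ _ ?_)
    · rw [← add_assoc, ← add_assoc]
      exact ceι_mul_mem hxy ha0
    · rw [add_left_comm, add_left_comm k]
      exact ceι_mul_mem hy ha

theorem ceD_mem {n i : ℤ} {a : 𝔢.CE} (ha : a ∈ 𝔢.ceBigrading.gr n i) :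
    𝔢.ceD a ∈ 𝔢.ceBigrading.gr n (i - 1) := by
  induction ha using KoszulSym.gr_induction with
  | one => rw [ceD_one]; exact zero_mem _
  | zero => simp
  | add n i a b _ _ ha hb => rw [map_add]; exact add_mem ha hb
  | smul n i r a _ ha => rw [map_smul]; exact Submodule.smul_mem _ r ha
  | ι_mul m j n i y a hy ha0 ha =>
    rw [𝔢.ceD_ι_mul hy]
    refine add_mem ?_ (Submodule.smul_mem _ _ ?_)
    · rw [add_comm j i, add_sub_assoc, add_comm i]
      exact ceθ_mem hy ha0
    · rw [add_sub_assoc]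
      exact ceι_mul_mem hy ha

theorem proj_ceD (n i : ℤ) (a : 𝔢.CE) :
    𝔢.ceBigrading.proj n i (𝔢.ceD a) = 𝔢.ceD (𝔢.ceBigrading.proj n (i + 1) a) := by
  induction a using 𝔢.ceBigrading.induction with
  | zero => simp
  | add a b ha hb => simp only [map_add, ha, hb]
  | hom m j a ha =>
    by_cases h : m = n ∧ j = i + 1
    · obtain ⟨rfl, rfl⟩ := h
      have := ceD_mem ha
      rw [add_sub_cancel_right] at this
      rw [Bigrading.proj_of_mem _ ha, Bigrading.proj_of_mem _ this]
    · rw [Bigrading.proj_of_mem_ne _ ha h, map_zero, Bigrading.proj_of_mem_ne _ (ceD_mem ha)]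
      omega

theorem proj_ceι_mul {m j : ℤ} {x : E} (hx : x ∈ 𝔢.gr.shift m j) (n i : ℤ) (a : 𝔢.CE) :
    𝔢.ceBigrading.proj n i (𝔢.ceι x * a) =
      𝔢.ceι x * 𝔢.ceBigrading.proj (n - m) (i - j) a := by
  induction a using 𝔢.ceBigrading.induction with
  | zero => simp
  | add a b ha hb => simp only [map_add, mul_add, ha, hb]
  | hom n' i' a ha =>
    have := ceι_mul_mem hx ha
    by_cases h : n' = n - m ∧ i' = i - j
    · obtain ⟨rfl, rfl⟩ := h
      rw [add_sub_cancel, add_sub_cancel] at this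
      rw [Bigrading.proj_of_mem _ ha, Bigrading.proj_of_mem _ this]
    · rw [Bigrading.proj_of_mem_ne _ ha h, mul_zero, Bigrading.proj_of_mem_ne _ this]
      omega

theorem proj_mem_symIdeal {I : Submodule ℚ E} {a : 𝔢.CE} (ha : a ∈ 𝔢.symIdeal I) (n i : ℤ) :
    𝔢.ceBigrading.proj n i a ∈ 𝔢.symIdeal I := by
  induction ha using symIdeal_induction generalizing n i with
  | one =>
    by_cases h : 0 = n ∧ 0 = i
    · obtain ⟨rfl, rfl⟩ := h
      rw [Bigrading.proj_of_mem _ KoszulSym.one_mem_gr]; exact one_mem_symIdeal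
    · rw [Bigrading.proj_of_mem_ne _ KoszulSym.one_mem_gr h]; exact zero_mem _
  | zero => simp
  | add a b _ _ ha hb => rw [map_add]; exact add_mem (ha n i) (hb n i)
  | smul r a _ ha => rw [map_smul]; exact Submodule.smul_mem _ r (ha n i)
  | ι_mul m k x hx hxI a _ ha =>
    have hx' : x ∈ 𝔢.gr.shift m (k + 1) := by simpa [BigradedFamily.shift] using hx
    rw [proj_ceι_mul hx']
    exact ι_mul_mem_symIdeal hx hxI (ha _ _)

theorem proj_mem_genComplex {I : Submodule ℚ E} {κ : Type*} {m d : κ → ℤ} {g : κ → E}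
    (hg : ∀ k, g k ∈ 𝔢.gr (m k) (d k)) {a : 𝔢.CE} (ha : a ∈ 𝔢.genComplex I g) (n i : ℤ) :
    𝔢.ceBigrading.proj n i a ∈ 𝔢.genComplex I g := by
  suffices h : 𝔢.genComplex I g ≤ (𝔢.genComplex I g).comap (𝔢.ceBigrading.proj n i) from h ha
  refine sup_le (fun a ha => Submodule.mem_sup_left (proj_mem_symIdeal ha n i))
    (iSup_le fun k => ?_)
  rintro _ ⟨a, ha, rfl⟩
  have hg' : g k ∈ 𝔢.gr.shift (m k) (d k + 1) := by simpa [BigradedFamily.shift] using hg k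
  refine Submodule.mem_sup_right (Submodule.mem_iSup_of_mem k ?_)
  rw [LinearMap.mulLeft_apply, proj_ceι_mul hg']
  exact ⟨_, proj_mem_symIdeal ha _ _, rfl⟩

/-- Every homogeneous cycle is homologous to a homogeneous cycle of the subcomplex
`Sym(I[1]) ⊕ ⨁ₖ g k · Sym(I[1])`. -/
theorem IsFreeExtension.exists_homogeneous {I : Submodule ℚ E} {κ : Type*} [Fintype κ]
    {m d : κ → ℤ} {g : κ → E} {ρ : E →ₗ[ℚ] WordAlgebra κ} (h : 𝔢.IsFreeExtension I m d g ρ)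
    {n i : ℤ} {z : 𝔢.CE} (hzn : z ∈ 𝔢.ceBigrading.gr n i) (hz : 𝔢.ceD z = 0) :
    ∃ f ∈ 𝔢.genComplex I g, f ∈ 𝔢.ceBigrading.gr n i ∧ ∃ b, z = f + 𝔢.ceD b := by
  obtain ⟨f, hf, b, hb⟩ := h.exists_eq_add_ceD hz
  refine ⟨_, proj_mem_genComplex h.mem hf n i, Bigrading.proj_mem _ n i f,
    𝔢.ceBigrading.proj n (i + 1) b, ?_⟩
  rw [← proj_ceD, ← map_add, ← hb, Bigrading.proj_of_mem _ hzn]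

/-- A semidirect product with a free Lie algebra is a free extension. -/
theorem IsSemidirectProduct.exists_isFreeExtension.{u} {G E : Type*} {L : Type u}
    [AddCommGroup G] [Module ℚ G] [AddCommGroup L] [Module ℚ L] [AddCommGroup E] [Module ℚ E]
    {𝔤 : BigradedLieAlgebra G} {𝔩 : BigradedLieAlgebra L} {𝔢 : BigradedLieAlgebra E}
    {i : G →ₗ[ℚ] E} {s : L →ₗ[ℚ] E} (hsemi : IsSemidirectProduct 𝔤 𝔩 𝔢 i s)
    (hfree : 𝔩.IsFreeOfFiniteRank) :
    ∃ (κ : Type u) (_ : Fintype κ) (m d : κ → ℤ) (g : κ → E) (ρ : E →ₗ[ℚ] WordAlgebra κ),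
      𝔢.IsFreeExtension (LinearMap.range i) m d g ρ := by
  obtain ⟨κ, _, m, d, e, he⟩ := hfree.exists_isFreeOn
  obtain ⟨π, hπ, hπi, hπs⟩ := hsemi.exists_projection
  obtain ⟨ρ, ⟨hρ, hρe⟩, -⟩ := he.2 (WordAlgebra κ) (WordAlgebra.lie m d)
    (fun k => WordAlgebra.word [k]) (WordAlgebra.letter_mem m d)
  refine ⟨κ, inferInstance, m, d, fun k => s (e k), ρ ∘ₗ π, ?_⟩
  refine { mem := ?_, ideal := ?_, commutators := ⟨?_⟩, map_ideal := ?_, map_gen := ?_,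
           span_eq_top := ?_ }
  · exact fun k => hsemi.isHom_right.1 _ _ _ (he.1 k)
  · rintro x _ ⟨y, rfl⟩
    exact hsemi.ideal x y
  · intro n k n' j x y hx hy
    rw [LinearMap.comp_apply, hπ.2, hρ.2]
    exact commutator_apply (WordAlgebra.bigrading m d) (hρ.1 _ _ _ (hπ.1 _ _ _ hx))
      (hρ.1 _ _ _ (hπ.1 _ _ _ hy))
  · rintro _ ⟨x, rfl⟩
    rw [LinearMap.comp_apply, hπi, map_zero]
  · intro k
    rw [LinearMap.comp_apply, hπs, hρe]
  · refine (Submodule.eq_top_iff' (p := _)).2 fun x => ?_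
    induction x using hsemi.induction with
    | zero => exact zero_mem _
    | add a b ha hb => exact add_mem ha hb
    | left n k x hx =>
      exact Submodule.subset_span (Or.inl ⟨⟨x, rfl⟩, n, k, hsemi.isHom_left.1 _ _ _ hx⟩)
    | right x =>
      have hx : x ∈ Submodule.span ℚ {x | ∃ a n i, 𝔩.IsIteratedBracket m d e a n i x} := by
        rw [he.span_isIteratedBracket]; trivial
      induction hx using Submodule.span_induction with
      | zero => simp
      | add a b _ _ ha hb => rw [map_add]; exact add_mem ha hb
      | smul r a _ ha => rw [map_smul]; exact Submodule.smul_mem _ r ha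
      | mem x hx =>
        obtain ⟨a, n, k, hx⟩ := hx
        exact Submodule.subset_span (Or.inr ⟨a, n, k, hx.map hsemi.isHom_right⟩)

end BigradedLieAlgebra

/-! ### Finite generation along lines -/

section AdjoinPowers

variable {R P : Type*} [CommRing R] [AddCommGroup P] [Module R P]

/-- A family of finitely generated submodules, indexed by rational numbers, that vanishes above some
bound. -/
structure IsFGBounded (M : ℚ → Submodule R P) : Prop where
  fg : ∀ c, (M c).FG
  bounded : ∃ c₀, ∀ c, c₀ < c → M c = ⊥

/-- The family generated by `M` under an operator `b` that shifts the index by `e`. -/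
def adjoinPowers (M : ℚ → Submodule R P) (b : P →ₗ[R] P) (e : ℚ) : ℚ → Submodule R P :=
  fun c => ⨆ j : ℕ, (M (c - j * e)).map (b ^ j)

/-- The supremum that defines `adjoinPowers` is finite: either `M (c - j e)` vanishes for large `j`, or
`b ^ j` does. -/
theorem IsFGBounded.adjoinPowers {M : ℚ → Submodule R P} (hM : IsFGBounded M) {b : P →ₗ[R] P}
    {e : ℚ} (hb : e < 0 ∨ b * b = 0) : IsFGBounded (adjoinPowers M b e) := by
  obtain ⟨c₀, hc₀⟩ := hM.bounded
  have hfin (c : ℚ) (J : ℕ) (hJ : ∀ j, J ≤ j → (M (c - j * e)).map (b ^ j) = ⊥) :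
      (_root_.adjoinPowers M b e c).FG := by
    have : _root_.adjoinPowers M b e c = ⨆ j ∈ Finset.range J, (M (c - j * e)).map (b ^ j) := by
      refine le_antisymm (iSup_le fun j => ?_) (iSup₂_le fun j _ => le_iSup
        (fun j : ℕ => (M (c - j * e)).map (b ^ j)) j)
      by_cases hj : j < J
      · exact le_iSup₂_of_le (f := fun j _ => (M (c - (j : ℕ) * e)).map (b ^ j)) j
          (Finset.mem_range.2 hj) le_rfl
      · rw [hJ j (not_lt.1 hj)]; exact bot_le
    rw [this]
    exact Submodule.fg_biSup _ _ fun j _ => (hM.fg _).map _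
  rcases hb with he | hb
  · refine ⟨fun c => ?_, c₀, fun c hc => ?_⟩
    · obtain ⟨J, hJ⟩ := exists_nat_gt ((c₀ - c) / (-e))
      rw [div_lt_iff₀ (by linarith)] at hJ
      refine hfin c J fun j hj => ?_
      have : (J : ℚ) ≤ j := Nat.cast_le.2 hj
      rw [hc₀ _ (by nlinarith), Submodule.map_bot]
    · refine iSup_eq_bot.2 fun j => ?_
      have : (0 : ℚ) ≤ j := Nat.cast_nonneg j
      rw [hc₀ _ (by nlinarith), Submodule.map_bot]
  · have hb2 : ∀ j, 2 ≤ j → b ^ j = 0 := fun j hj => by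
      obtain ⟨k, rfl⟩ := Nat.exists_eq_add_of_le hj
      rw [pow_add, pow_two, hb, zero_mul]
    refine ⟨fun c => hfin c 2 fun j hj => by rw [hb2 j hj, Submodule.map_zero], c₀ + |e|,
      fun c hc => ?_⟩
    refine iSup_eq_bot.2 fun j => ?_
    by_cases hj : 2 ≤ j
    · rw [hb2 j hj, Submodule.map_zero]
    · have h1 := le_abs_self e
      have h2 := abs_nonneg e
      rw [hc₀, Submodule.map_bot]
      interval_cases j <;> push_cast <;> linarith

theorem mem_adjoinPowers {M : ℚ → Submodule R P} {b : P →ₗ[R] P} {e c : ℚ} {p : P}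
    (hp : p ∈ M c) : p ∈ adjoinPowers M b e c :=
  Submodule.mem_iSup_of_mem 0 ⟨p, by simpa using hp, by simp⟩

theorem apply_mem_adjoinPowers {M : ℚ → Submodule R P} {b : P →ₗ[R] P} {e c : ℚ} {p : P}
    (hp : p ∈ adjoinPowers M b e c) : b p ∈ adjoinPowers M b e (c + e) := by
  induction hp using Submodule.iSup_induction' with
  | zero => simp
  | add a b _ _ ha hb => rw [map_add]; exact add_mem ha hb
  | mem j p hp =>
    obtain ⟨q, hq, rfl⟩ := hp
    refine Submodule.mem_iSup_of_mem (j + 1) ⟨q, ?_, ?_⟩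
    · rwa [show c + e - ((j + 1 : ℕ) : ℚ) * e = c - j * e by push_cast; ring]
    · rw [pow_succ', Module.End.mul_apply]

/-- An operator that preserves the family `M` and commutes with `b` up to a sign preserves
`adjoinPowers M b e`. -/
theorem apply_mem_adjoinPowers_of_comm [Algebra ℚ R] [Module ℚ P] [IsScalarTower ℚ R P]
    {M : ℚ → Submodule R P} {a b : P →ₗ[R] P} {e e' : ℚ} {ε : ℚ}
    (hab : ∀ p, a (b p) = ε • b (a p)) (ha : ∀ c, ∀ p ∈ M c, a p ∈ M (c + e')) {c : ℚ} {p : P}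
    (hp : p ∈ adjoinPowers M b e c) : a p ∈ adjoinPowers M b e (c + e') := by
  induction hp using Submodule.iSup_induction' with
  | zero => simp
  | add a b _ _ ha hb => rw [map_add]; exact add_mem ha hb
  | mem j p hp =>
    obtain ⟨q, hq, rfl⟩ := hp
    have hcomm : ∀ (j : ℕ) (q : P), a ((b ^ j) q) = ε ^ j • (b ^ j) (a q) := by
      intro j
      induction j with
      | zero => simp
      | succ j ih =>
        intro q
        rw [pow_succ, Module.End.mul_apply, ih, hab, Module.End.mul_apply,
          ← algebraMap_smul R ε, map_smul, algebraMap_smul, smul_smul, pow_succ]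
    rw [hcomm]
    refine Submodule.smul_of_tower_mem _ _ (Submodule.mem_iSup_of_mem j ⟨a q, ?_, rfl⟩)
    have := ha _ q hq
    rwa [show c - j * e + e' = c + e' - j * e by ring] at this

end AdjoinPowers

namespace BigradedLieAlgebra

variable {E : Type*} [AddCommGroup E] [Module ℚ E] {𝔢 : BigradedLieAlgebra E}

section Line

variable (ℓ : ℤ × ℤ →+ ℚ)

open Classical in
variable (𝔢) in
/-- The projection of `Sym(𝔢[1])` onto the pieces on a line `ℓ = c`. -/
def lineProj (c : ℚ) : 𝔢.CE →ₗ[ℚ] 𝔢.CE :=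
  𝔢.ceBigrading.lift fun n i => if ℓ (n, i) = c then LinearMap.id else 0

open Classical in
theorem lineProj_apply {n i : ℤ} {a : 𝔢.CE} (ha : a ∈ 𝔢.ceBigrading.gr n i) (c : ℚ) :
    𝔢.lineProj ℓ c a = if ℓ (n, i) = c then a else 0 := by
  rw [lineProj, Bigrading.lift_apply _ _ ha]; split_ifs <;> rfl

theorem lineProj_ceι_mul {m j : ℤ} {x : E} (hx : x ∈ 𝔢.gr.shift m j) (c : ℚ) (a : 𝔢.CE) :
    𝔢.lineProj ℓ c (𝔢.ceι x * a) = 𝔢.ceι x * 𝔢.lineProj ℓ (c - ℓ (m, j)) a := by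
  induction a using 𝔢.ceBigrading.induction with
  | zero => simp
  | add a b ha hb => simp only [map_add, mul_add, ha, hb]
  | hom n i a ha =>
    rw [lineProj_apply ℓ ha, lineProj_apply ℓ (ceι_mul_mem hx ha),
      show ((m + n, j + i) : ℤ × ℤ) = (m, j) + (n, i) from rfl, map_add]
    by_cases h : ℓ (n, i) = c - ℓ (m, j)
    · rw [if_pos h, if_pos (by rw [h]; ring)]
    · rw [if_neg h, if_neg (fun h' => h (by rw [← h']; ring)), mul_zero]

variable {R : Type*} [CommRing R] [Module R 𝔢.CE]

/-- Multiplication by an element of `𝔢` as an `R`-linear map. -/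
def ceMulLeft (hR : ∀ (r : R) (x : E) (p : 𝔢.CE), 𝔢.ceι x * (r • p) = r • (𝔢.ceι x * p)) (x : E) :
    𝔢.CE →ₗ[R] 𝔢.CE where
  toFun p := 𝔢.ceι x * p
  map_add' := mul_add _
  map_smul' r p := hR r x p

variable [Algebra ℚ R] [IsScalarTower ℚ R 𝔢.CE]

/-- Let `R` act on `Sym(𝔢[1])`, compatibly with multiplication, and consider finitely many
homogeneous elements of `𝔢[1]`, each of which has odd degree, or a bidegree where `ℓ` is negative,
or a bidegree where `ℓ` vanishes and acts through `R`. The `R`-module that is spanned by their products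
is finitely generated along each line `ℓ = c`: elements of odd degree square to zero, and the number of
factors with `ℓ < 0` is bounded on each line. -/
theorem exists_isFGBounded
    (hR : ∀ (r : R) (x : E) (p : 𝔢.CE), 𝔢.ceι x * (r • p) = r • (𝔢.ceι x * p))
    (xs : List (ℤ × ℤ × E)) (hxs : ∀ t ∈ xs, t.2.2 ∈ 𝔢.gr.shift t.1 t.2.1 ∧
      (Odd t.2.1 ∨ ℓ (t.1, t.2.1) < 0 ∨
        ℓ (t.1, t.2.1) = 0 ∧ ∃ r : R, ∀ p, 𝔢.ceι t.2.2 * p = r • p)) :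
    ∃ M : ℚ → Submodule R 𝔢.CE, IsFGBounded M ∧ 1 ∈ M 0 ∧
      ∀ t ∈ xs, ∀ c, ∀ p ∈ M c, 𝔢.ceι t.2.2 * p ∈ M (c + ℓ (t.1, t.2.1)) := by
  classical
  induction xs with
  | nil =>
    refine ⟨fun c => if c = 0 then Submodule.span R {1} else ⊥, ⟨fun c => ?_, 0, fun c hc => ?_⟩,
      ?_, by simp⟩
    · split_ifs
      · exact Submodule.fg_span_singleton 1
      · exact Submodule.fg_bot
    · exact if_neg hc.ne'
    · change (1 : 𝔢.CE) ∈ if (0 : ℚ) = 0 then Submodule.span R {1} else ⊥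
      rw [if_pos rfl]; exact Submodule.mem_span_singleton_self 1
  | cons t xs ih =>
    obtain ⟨M, hM, hM1, hMxs⟩ := ih fun t ht => hxs t (List.mem_cons_of_mem _ ht)
    obtain ⟨n, k, x⟩ := t
    obtain ⟨hx, hcase⟩ := hxs _ List.mem_cons_self
    dsimp only at hx hcase
    have hadj (h : ℓ (n, k) < 0 ∨ ceMulLeft hR x * ceMulLeft hR x = 0) :
        ∃ M : ℚ → Submodule R 𝔢.CE, IsFGBounded M ∧ 1 ∈ M 0 ∧ ∀ t ∈ (n, k, x) :: xs, ∀ c,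
          ∀ p ∈ M c, 𝔢.ceι t.2.2 * p ∈ M (c + ℓ (t.1, t.2.1)) := by
      refine ⟨adjoinPowers M (ceMulLeft hR x) (ℓ (n, k)), hM.adjoinPowers h, mem_adjoinPowers hM1,
        fun t ht c p hp => ?_⟩
      rcases List.mem_cons.1 ht with rfl | ht
      · exact apply_mem_adjoinPowers hp
      · refine apply_mem_adjoinPowers_of_comm (a := ceMulLeft hR t.2.2)
          (ε := koszulSign (t.2.1 * k)) (fun p => ?_) (hMxs t ht) hp
        change 𝔢.ceι t.2.2 * (𝔢.ceι x * p) = _ • (𝔢.ceι x * (𝔢.ceι t.2.2 * p))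
        rw [← mul_assoc, KoszulSym.ι_mul_ι 𝔢.gr.shift
          (hxs t (List.mem_cons_of_mem _ ht)).1 hx, smul_mul_assoc, mul_assoc]
    rcases hcase with hk | hneg | ⟨h0, r, hr⟩
    · refine hadj (Or.inr (LinearMap.ext fun p => ?_))
      have hsq : 𝔢.ceι x * 𝔢.ceι x = 0 := by
        have h1 := KoszulSym.ι_mul_ι 𝔢.gr.shift hx hx
        rw [koszulSign_odd (hk.mul hk), neg_one_smul] at h1
        have h2 : (2 : ℚ) • (𝔢.ceι x * 𝔢.ceι x) = 0 := by
          rw [two_smul]; nth_rewrite 1 [h1]; exact neg_add_cancel _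
        exact (smul_eq_zero.1 h2).resolve_left two_ne_zero
      change 𝔢.ceι x * (𝔢.ceι x * p) = 0
      rw [← mul_assoc, hsq, zero_mul]
    · exact hadj (Or.inl hneg)
    · refine ⟨M, hM, hM1, fun t ht c p hp => ?_⟩
      rcases List.mem_cons.1 ht with rfl | ht
      · dsimp only
        rw [hr, h0, add_zero]
        exact Submodule.smul_mem _ r hp
      · exact hMxs t ht c p hp

/-- If `I` is spanned by elements as in `exists_isFGBounded`, then the part of
`Sym(I[1]) + ∑ₖ g k · Sym(I[1])` on a line is contained in a finitely generated module. -/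
theorem exists_fg_genComplex
    (hR : ∀ (r : R) (x : E) (p : 𝔢.CE), 𝔢.ceι x * (r • p) = r • (𝔢.ceι x * p))
    (xs : List (ℤ × ℤ × E)) (hxs : ∀ t ∈ xs, t.2.2 ∈ 𝔢.gr.shift t.1 t.2.1 ∧
      (Odd t.2.1 ∨ ℓ (t.1, t.2.1) < 0 ∨
        ℓ (t.1, t.2.1) = 0 ∧ ∃ r : R, ∀ p, 𝔢.ceι t.2.2 * p = r • p))
    {I : Submodule ℚ E} (hI : I ≤ Submodule.span ℚ {x | ∃ t ∈ xs, t.2.2 = x})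
    {κ : Type*} [Fintype κ] {m d : κ → ℤ} {g : κ → E} (hg : ∀ k, g k ∈ 𝔢.gr (m k) (d k)) (c : ℚ) :
    ∃ T : Submodule R 𝔢.CE, T.FG ∧ ∀ n i, ℓ (n, i) = c → ∀ p ∈ 𝔢.genComplex I g,
      p ∈ 𝔢.ceBigrading.gr n i → p ∈ T := by
  obtain ⟨M, hM, hM1, hMxs⟩ := exists_isFGBounded ℓ hR xs hxs
  have hsym {a : 𝔢.CE} (ha : a ∈ 𝔢.symIdeal I) : ∀ c, 𝔢.lineProj ℓ c a ∈ M c := by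
    induction ha using symIdeal_induction with
    | one =>
      intro c
      rw [lineProj_apply ℓ (show (1 : 𝔢.CE) ∈ 𝔢.ceBigrading.gr 0 0 from KoszulSym.one_mem_gr), show ((0, 0) : ℤ × ℤ) = 0 from rfl, map_zero]
      split_ifs with h
      · rwa [← h]
      · exact zero_mem _
    | zero => simp
    | add a b _ _ ha hb => intro c; rw [map_add]; exact add_mem (ha c) (hb c)
    | smul r a _ ha =>
      intro c
      rw [map_smul]
      exact Submodule.smul_of_tower_mem _ r (ha c)
    | ι_mul n k x hxg hxI a _ ha =>
      intro c
      have hx := hI hxI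
      clear hxg hxI
      induction hx using Submodule.span_induction with
      | zero => simp
      | add x y _ _ hx hy => rw [map_add, add_mul, map_add]; exact add_mem hx hy
      | smul r x _ hx =>
        rw [map_smul, smul_mul_assoc, map_smul]
        exact Submodule.smul_of_tower_mem _ r hx
      | mem x hx =>
        obtain ⟨t, ht, rfl⟩ := hx
        rw [lineProj_ceι_mul ℓ (hxs t ht).1]
        have := hMxs t ht _ _ (ha (c - ℓ (t.1, t.2.1)))
        rwa [sub_add_cancel] at this
  refine ⟨M c ⊔ ⨆ k, (M (c - ℓ (m k, d k + 1))).map (ceMulLeft hR (g k)),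
    (hM.fg c).sup (Submodule.fg_iSup _ fun k => (hM.fg _).map _), fun n i hc p hp hpn => ?_⟩
  have hpc : 𝔢.lineProj ℓ c p = p := by rw [lineProj_apply ℓ hpn, if_pos hc]
  rw [← hpc]
  obtain ⟨a, ha, b, hb, rfl⟩ := Submodule.mem_sup.1 hp
  rw [map_add]
  refine add_mem (Submodule.mem_sup_left (hsym ha c)) (Submodule.mem_sup_right ?_)
  clear hp hpn hpc
  induction hb using Submodule.iSup_induction' with
  | zero => simp
  | add a b _ _ ha hb => rw [map_add]; exact add_mem ha hb
  | mem k b hb =>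
    obtain ⟨a, ha, rfl⟩ := hb
    have hg' : g k ∈ 𝔢.gr.shift (m k) (d k + 1) := by simpa [BigradedFamily.shift] using hg k
    refine Submodule.mem_iSup_of_mem k ?_
    rw [LinearMap.mulLeft_apply, lineProj_ceι_mul ℓ hg']
    exact ⟨_, hsym ha _, rfl⟩

end Line

/-! ### The action on chains -/

section ChainAction

variable {S : Type*} [AddCommGroup S] [Module ℚ S]

/-- The action of `Sym(S[1])` on the Chevalley–Eilenberg complex, which induces the action on
homology. -/
def centralChainAction (f : S →ₗ[ℚ] E) (hf : ∀ x, 𝔢.IsOddCentral (f x)) :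
    SymmetricAlgebra ℚ S →ₐ[ℚ] Module.End ℚ 𝔢.CE :=
  RingCon.liftₐ (R := ℚ) (TensorAlgebra.symRingCon ℚ S)
    (TensorAlgebra.lift ℚ ((LinearMap.mul ℚ 𝔢.CE) ∘ₗ 𝔢.ceι ∘ₗ f)) (RingCon.ringConGen_le.2 (by
      rintro _ _ ⟨x, y⟩
      rw [RingCon.ker_apply]
      simp only [AlgHom.toRingHom_eq_coe, RingHom.coe_coe, map_mul, TensorAlgebra.lift_ι_apply]
      refine LinearMap.ext fun p => ?_
      change 𝔢.ceι (f x) * (𝔢.ceι (f y) * p) = 𝔢.ceι (f y) * (𝔢.ceι (f x) * p)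
      rw [← mul_assoc, ceι_comm_of_mem_oddPart (hf x).1, mul_assoc]))

variable {f : S →ₗ[ℚ] E} {hf : ∀ x, 𝔢.IsOddCentral (f x)}

theorem centralChainAction_ι (x : S) (p : 𝔢.CE) :
    centralChainAction f hf (SymmetricAlgebra.ι ℚ S x) p = 𝔢.ceι (f x) * p := by
  have h : centralChainAction f hf (SymmetricAlgebra.ι ℚ S x) =
      TensorAlgebra.lift ℚ ((LinearMap.mul ℚ 𝔢.CE) ∘ₗ 𝔢.ceι ∘ₗ f) (TensorAlgebra.ι ℚ x) := rfl
  rw [h, TensorAlgebra.lift_ι_apply]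
  rfl

theorem ceι_mul_centralChainAction (r : SymmetricAlgebra ℚ S) (x : E) (p : 𝔢.CE) :
    𝔢.ceι x * centralChainAction f hf r p = centralChainAction f hf r (𝔢.ceι x * p) := by
  induction r using SymmetricAlgebra.induction generalizing p with
  | algebraMap r => simp [Algebra.algebraMap_eq_smul_one]
  | ι y =>
    rw [centralChainAction_ι, centralChainAction_ι, ← mul_assoc,
      ← ceι_comm_of_mem_oddPart (hf y).1, mul_assoc]
  | mul a b ha hb => rw [map_mul, Module.End.mul_apply, ha, hb, Module.End.mul_apply]
  | add a b ha hb => simp only [map_add, LinearMap.add_apply, mul_add, ha, hb]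

theorem ceD_centralChainAction (r : SymmetricAlgebra ℚ S) (p : 𝔢.CE) :
    𝔢.ceD (centralChainAction f hf r p) = centralChainAction f hf r (𝔢.ceD p) := by
  induction r using SymmetricAlgebra.induction generalizing p with
  | algebraMap r => simp [Algebra.algebraMap_eq_smul_one]
  | ι y => rw [centralChainAction_ι, centralChainAction_ι, (hf y).ceD_ι_mul]
  | mul a b ha hb => rw [map_mul, Module.End.mul_apply, ha, hb, Module.End.mul_apply]
  | add a b ha hb => simp only [map_add, LinearMap.add_apply, ha, hb]

theorem centralAction_mk (r : SymmetricAlgebra ℚ S) (p q : LinearMap.ker 𝔢.ceD)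
    (h : (q : 𝔢.CE) = centralChainAction f hf r p) :
    centralAction f hf r (Submodule.Quotient.mk p) = Submodule.Quotient.mk q := by
  induction r using SymmetricAlgebra.induction generalizing p q with
  | algebraMap r =>
    have hq : q = r • p := Subtype.ext (by rw [h]; simp [Algebra.algebraMap_eq_smul_one])
    rw [hq]; simp [Algebra.algebraMap_eq_smul_one]
  | ι y => rw [centralAction_ι, (hf y).act_mk p q (by rw [h, centralChainAction_ι])]
  | mul a b ha hb =>
    have hmem : centralChainAction f hf b (p : 𝔢.CE) ∈ LinearMap.ker 𝔢.ceD := by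
      rw [LinearMap.mem_ker, ceD_centralChainAction, LinearMap.mem_ker.1 p.2, map_zero]
    rw [map_mul, Module.End.mul_apply, hb p ⟨_, hmem⟩ rfl, ha _ q (by rw [h, map_mul]; rfl)]
  | add a b ha hb =>
    have hmem (r : SymmetricAlgebra ℚ S) :
        centralChainAction f hf r (p : 𝔢.CE) ∈ LinearMap.ker 𝔢.ceD := by
      rw [LinearMap.mem_ker, ceD_centralChainAction, LinearMap.mem_ker.1 p.2, map_zero]
    have hq : q = ⟨_, hmem a⟩ + ⟨_, hmem b⟩ := Subtype.ext (by rw [h, map_add]; rfl)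
    rw [map_add, LinearMap.add_apply, ha p ⟨_, hmem a⟩ rfl, hb p ⟨_, hmem b⟩ rfl, hq,
      Submodule.Quotient.mk_add]

end ChainAction

end BigradedLieAlgebra

/-- The symmetric algebra of a finite dimensional vector space is a polynomial ring. -/
instance SymmetricAlgebra.isNoetherianRing {K V : Type*} [Field K] [AddCommGroup V] [Module K V]
    [FiniteDimensional K V] : IsNoetherianRing (SymmetricAlgebra K V) :=
  isNoetherianRing_of_ringEquiv _
    (SymmetricAlgebra.equivMvPolynomial (Module.finBasis K V)).symm.toRingEquiv

/-! ### Eventually quasi-polynomial functions -/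

section EventuallyPolynomial

open Polynomial Filter

/-- On each residue class modulo `D`, the function `h` is eventually given by a polynomial of degree
less than `k`. -/
def IsEventuallyQuasiPolynomial (D k : ℕ) (h : ℕ → ℚ) : Prop :=
  ∃ P : ℕ → ℚ[X], (∀ r, (P r).degree < k) ∧ ∀ᶠ n in atTop, h n = (P (n % D)).eval (n : ℚ)

namespace IsEventuallyQuasiPolynomial

variable {D k : ℕ} {h h' : ℕ → ℚ}

theorem of_eventually_eq_zero (hh : ∀ᶠ n in atTop, h n = 0) :
    IsEventuallyQuasiPolynomial D k h :=
  ⟨fun _ => 0, fun _ => by simp, hh.mono fun n hn => by simp [hn]⟩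

theorem sub (hh : IsEventuallyQuasiPolynomial D k h) (hh' : IsEventuallyQuasiPolynomial D k h') :
    IsEventuallyQuasiPolynomial D k (fun n => h n - h' n) := by
  obtain ⟨P, hP, hPh⟩ := hh
  obtain ⟨Q, hQ, hQh⟩ := hh'
  refine ⟨fun r => P r - Q r, fun r => (degree_sub_le _ _).trans_lt (max_lt (hP r) (hQ r)), ?_⟩
  filter_upwards [hPh, hQh] with n h1 h2
  rw [h1, h2, eval_sub]

theorem sum {s : Finset ℕ} {h : ℕ → ℕ → ℚ}
    (hh : ∀ t ∈ s, IsEventuallyQuasiPolynomial D k (h t)) :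
    IsEventuallyQuasiPolynomial D k (fun n => ∑ t ∈ s, h t n) := by
  choose! P hP hPh using hh
  refine ⟨fun r => ∑ t ∈ s, P t r, fun r => (mem_degreeLT).1 (sum_mem fun t ht =>
    mem_degreeLT.2 (hP t ht r)), ?_⟩
  filter_upwards [(Finset.eventually_all s).2 hPh] with n hn
  rw [eval_finsetSum]
  exact Finset.sum_congr rfl hn

theorem comp_add (hh : IsEventuallyQuasiPolynomial D k h) (d : ℕ) :
    IsEventuallyQuasiPolynomial D k (fun n => h (n + d)) := by
  obtain ⟨P, hP, hPh⟩ := hh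
  refine ⟨fun r => taylor (d : ℚ) (P ((r + d) % D)), fun r => by rw [degree_taylor]; exact hP _, ?_⟩
  filter_upwards [(tendsto_add_atTop_nat d).eventually hPh] with n hn
  rw [hn, taylor_eval, Nat.mod_add_mod, Nat.cast_add, add_comm (n : ℚ)]

theorem congr (hh : IsEventuallyQuasiPolynomial D k h) (e : ∀ᶠ n in atTop, h' n = h n) :
    IsEventuallyQuasiPolynomial D k h' := by
  obtain ⟨P, hP, hPh⟩ := hh
  refine ⟨P, hP, ?_⟩
  filter_upwards [hPh, e] with n h1 h2
  rw [h2, h1]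

end IsEventuallyQuasiPolynomial

/-- Every polynomial is a difference `Q (X + D) - Q`. -/
theorem Polynomial.exists_taylor_sub_eq {D : ℚ} (hD : D ≠ 0) {k : ℕ} {P : ℚ[X]}
    (hP : P.degree < k) :
    ∃ Q : ℚ[X], Q.degree < (k + 1 : ℕ) ∧ taylor D Q - Q = P := by
  induction k generalizing P with
  | zero =>
    have : P = 0 := by
      by_contra h
      rw [Nat.cast_zero, degree_eq_natDegree h] at hP
      exact absurd (WithBot.coe_lt_coe.1 hP) (Nat.not_lt_zero _)
    exact ⟨0, by simp, by simp [this]⟩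
  | succ k ih =>
    -- The leading term of `(X + D)^(k+1) - X^(k+1)` is `(k+1) D X^k`.
    set a : ℚ := P.coeff k / ((k + 1) * D) with ha
    have hk : ((k : ℚ) + 1) ≠ 0 := by positivity
    have haD : a * ((k + 1) * D) = P.coeff k := by rw [ha]; field_simp
    set Q₀ : ℚ[X] := C a * X ^ (k + 1) with hQ₀
    obtain ⟨Q, hQ, hQP⟩ := ih (P := P - (taylor D Q₀ - Q₀)) (by
      rw [degree_lt_iff_coeff_zero]
      intro m hm
      have h1 : taylor D Q₀ = C a * (X + C D) ^ (k + 1) := by simp [hQ₀, taylor_mul, taylor_pow]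
      rw [h1, hQ₀, coeff_sub, coeff_sub, coeff_C_mul, coeff_C_mul, coeff_X_add_C_pow, coeff_X_pow]
      rcases hm.eq_or_lt with rfl | hm
      · rw [if_neg (by omega), show k + 1 - k = 1 by omega, Nat.choose_succ_self_right, ← haD]
        push_cast; ring
      · rw [coeff_eq_zero_of_degree_lt (hP.trans_le (by exact_mod_cast hm))]
        rcases (Nat.succ_le_of_lt hm).eq_or_lt with rfl | hm
        · simp
        · rw [Nat.choose_eq_zero_of_lt hm, if_neg (by omega)]; simp)
    refine ⟨Q + Q₀, ?_, ?_⟩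
    · refine (degree_add_le _ _).trans_lt (max_lt (hQ.trans ?_) ?_)
      · exact_mod_cast Nat.lt_succ_self _
      · exact (degree_C_mul_X_pow_le _ _).trans_lt (by exact_mod_cast Nat.lt_succ_self _)
    · rw [map_add, add_sub_add_comm, hQP]; ring

theorem IsEventuallyQuasiPolynomial.of_difference {D k d : ℕ} {h : ℕ → ℚ} (hD : 0 < D)
    (hd : d ∣ D) (hh : IsEventuallyQuasiPolynomial D k (fun n => h (n + d) - h n)) :
    IsEventuallyQuasiPolynomial D (k + 1) h := by
  have hstep : IsEventuallyQuasiPolynomial D k (fun n => h (n + D) - h n) := by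
    obtain ⟨e, rfl⟩ := hd
    refine (sum (s := Finset.range e) (h := fun t n => h (n + d * t + d) - h (n + d * t))
      fun t _ => hh.comp_add (d * t)).congr (Eventually.of_forall fun n => ?_)
    have := Finset.sum_range_sub (fun t => h (n + d * t)) e
    simp only [mul_add, mul_one, ← add_assoc, mul_zero, add_zero] at this
    exact this.symm
  obtain ⟨P, hP, hPh⟩ := hstep
  choose Q hQ hQP using fun r => exists_taylor_sub_eq (D := (D : ℚ)) (by positivity) (hP r)
  obtain ⟨N, hN⟩ := eventually_atTop.1 hPh
  have hconst : ∀ m t, N ≤ m → h (m + D * t) - (Q (m % D)).eval ((m + D * t : ℕ) : ℚ) =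
      h m - (Q (m % D)).eval (m : ℚ) := by
    intro m t hm
    induction t with
    | zero => simp
    | succ t ih =>
      rw [← ih]
      have h1 := hN (m + D * t) (by omega)
      rw [Nat.add_mul_mod_self_left, ← hQP, eval_sub, taylor_eval] at h1
      have h2 : ((m + D * (t + 1) : ℕ) : ℚ) = (D : ℚ) + ((m + D * t : ℕ) : ℚ) := by
        push_cast; ring
      rw [h2, mul_add, mul_one, ← add_assoc, add_comm (D : ℚ)]
      dsimp only at h1
      linarith
  -- A starting point `N ≤ a r` in each residue class `r`.
  set a : ℕ → ℕ := fun r => D * N + r with ha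
  refine ⟨fun r => Q r + C (h (a r) - (Q r).eval (a r : ℚ)), fun r => ?_,
    eventually_atTop.2 ⟨D * N + D, fun n hn => ?_⟩⟩
  · exact (degree_add_le _ _).trans_lt (max_lt (hQ r) (degree_C_le.trans_lt (by
      exact_mod_cast Nat.succ_pos k)))
  · have hlt := Nat.mod_lt n hD
    have hdm := Nat.mod_add_div n D
    have hNn : N ≤ n / D := (Nat.le_div_iff_mul_le hD).2 (by rw [mul_comm]; omega)
    have hn' : n = a (n % D) + D * (n / D - N) := by
      have : D * (n / D) = D * N + D * (n / D - N) := by rw [← mul_add]; congr 1; omega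
      simp only [ha]; omega
    have ham : a (n % D) % D = n % D := by simp [ha]
    have := hconst (a (n % D)) (n / D - N) (by
      simp only [ha]
      exact (Nat.le_mul_of_pos_left N hD).trans (Nat.le_add_right _ _))
    rw [ham, ← hn'] at this
    rw [eval_add, eval_C]
    linarith

/-- The quasi-polynomial that is given by polynomials on the residue classes modulo `D`. -/
theorem IsEventuallyQuasiPolynomial.exists_quasiPolynomial {D k : ℕ} {h : ℕ → ℚ} (hD : 0 < D)
    (hh : IsEventuallyQuasiPolynomial D k h) :
    ∃ q : QuasiPolynomial, q.degree < (k : WithBot ℕ) ∧ q.period ∣ D ∧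
      ∀ᶠ n : ℕ in atTop, h n = q.value n := by
  obtain ⟨P, hP, hPh⟩ := hh
  have hper (j : ℕ) : Function.Periodic (fun n : ℤ => (P (n % D).toNat).coeff j) (D : ℤ) :=
    fun n => by simp
  let c (j : ℕ) : periodicFunctions := ⟨fun n : ℤ => (P (n % D).toNat).coeff j, D, hD, hper j⟩
  let q : QuasiPolynomial := ∑ j ∈ Finset.range k, monomial j (c j)
  have hcoeff (j : ℕ) : q.coeff j = if j < k then c j else 0 := by
    simp [q, coeff_monomial]
  refine ⟨q, ?_, ?_, hPh.mono fun n hn => ?_⟩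
  · rw [degree_lt_iff_coeff_zero]
    intro m hm
    rw [hcoeff, if_neg (not_lt.2 hm)]
  · refine Finset.lcm_dvd fun j _ => ?_
    have hDj : Function.Periodic (q.coeff j : ℤ → ℚ) (D : ℤ) := by
      rw [hcoeff]
      split_ifs
      · exact hper j
      · exact fun _ => rfl
    -- The least period divides every period: the remainder would be a smaller one.
    have hmem := Nat.sInf_mem (s := {p : ℕ | 0 < p ∧ Function.Periodic (q.coeff j : ℤ → ℚ) (p : ℤ)})
      ⟨D, hD, hDj⟩
    change 0 < QuasiPolynomial.coeffPeriod _ ∧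
      Function.Periodic _ ((QuasiPolynomial.coeffPeriod _ : ℕ) : ℤ) at hmem
    set p := QuasiPolynomial.coeffPeriod (q.coeff j : ℤ → ℚ) with hp
    refine Nat.dvd_of_mod_eq_zero (Nat.eq_zero_of_not_pos fun hpos => ?_)
    have hmod : Function.Periodic (q.coeff j : ℤ → ℚ) ((D % p : ℕ) : ℤ) := by
      have := hDj.sub_period (hmem.2.int_mul (D / p : ℕ))
      rwa [Int.cast_natCast, show (D : ℤ) - ((D / p : ℕ) : ℤ) * p = ((D % p : ℕ) : ℤ) by
        have := Nat.mod_add_div D p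
        zify at this ⊢
        linarith] at this
    exact absurd (Nat.mod_lt D hmem.1) (not_lt.2 (Nat.sInf_le ⟨hpos, hmod⟩))
  · have hsupp : q.support ⊆ Finset.range k := fun j hj => by
      by_contra hjk
      rw [Finset.mem_range] at hjk
      exact mem_support_iff.1 hj (by rw [hcoeff, if_neg hjk])
    have hsupp' : (P (n % D)).support ⊆ Finset.range k := fun j hj =>
      Finset.mem_range.2 (by_contra fun hjk => mem_support_iff.1 hj
        (coeff_eq_zero_of_degree_lt ((hP _).trans_le (by exact_mod_cast not_lt.1 hjk))))
    rw [hn, QuasiPolynomial.value, eval_eq_sum, sum_def, sum_def, Finset.sum_subset hsupp',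
      Finset.sum_subset hsupp]
    · refine Finset.sum_congr rfl fun j hj => ?_
      rw [hcoeff, if_pos (Finset.mem_range.1 hj)]
      have : ((n : ℤ) % (D : ℤ)).toNat = n % D := by
        rw [← Int.natCast_mod, Int.toNat_natCast]
      change _ = (P ((n : ℤ) % (D : ℤ)).toNat).coeff j * ((n : ℤ) : ℚ) ^ j
      rw [this, Int.cast_natCast]
    · intro j _ hj
      rw [notMem_support_iff.1 hj]
      exact zero_mul _
    · intro j _ hj
      rw [notMem_support_iff.1 hj, zero_mul]

end EventuallyPolynomial

/-! ### Hilbert functions of graded modules -/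

section Hilbert

variable {R M : Type*} [CommRing R] [Algebra ℚ R] [AddCommGroup M] [Module ℚ M] [Module R M]
  [IsScalarTower ℚ R M]

/-- The algebra `R` is generated by elements `x j` of positive weights `d j`, and `T` is a Noetherian
graded `R`-module in nonnegative weights. The grading is given by the projections `p n`, which are
defined on an ambient module `M` of which `T` is a submodule. -/
structure IsPositivelyGraded {q : ℕ} (x : Fin q → R) (d : Fin q → ℕ) (p : ℕ → M →ₗ[ℚ] M)
    (T : Submodule R M) : Prop where
  adjoin_eq_top : Algebra.adjoin ℚ (Set.range x) = ⊤
  pos : ∀ j, 0 < d j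
  proj_proj : ∀ n m a, p n (p m a) = if n = m then p m a else 0
  proj_add_smul : ∀ n j a, p (n + d j) (x j • a) = x j • p n a
  proj_smul_of_lt : ∀ n j, ∀ a ∈ T, n < d j → p n (x j • a) = 0
  proj_mem : ∀ n, ∀ a ∈ T, p n a ∈ T
  exists_sum : ∀ a ∈ T, ∃ N, a = ∑ n ∈ Finset.range N, p n a
  isNoetherian : IsNoetherian R T

/-- The dimension of the piece of weight `n` of a graded submodule. -/
def hilbertFunction (p : ℕ → M →ₗ[ℚ] M) (B : Submodule R M) (n : ℕ) : ℕ :=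
  Module.finrank ℚ ((B.restrictScalars ℚ).map (p n))

theorem Submodule.finrank_map_add_finrank_inf_ker {V W : Type*} [AddCommGroup V] [Module ℚ V]
    [AddCommGroup W] [Module ℚ W] (f : V →ₗ[ℚ] W) (U : Submodule ℚ V) [FiniteDimensional ℚ U] :
    Module.finrank ℚ (U.map f) + Module.finrank ℚ ↥(U ⊓ LinearMap.ker f) = Module.finrank ℚ U := by
  rw [← (f.domRestrict U).finrank_range_add_finrank_ker, LinearMap.range_domRestrict]
  congr 1
  rw [LinearMap.ker_domRestrict, ← Submodule.map_comap_subtype,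
    (Submodule.equivSubtypeMap U _).finrank_eq]

namespace IsPositivelyGraded

variable {q : ℕ} {x : Fin q → R} {d : Fin q → ℕ} {p : ℕ → M →ₗ[ℚ] M} {T : Submodule R M}

theorem mem_map_proj (h : IsPositivelyGraded x d p T) {B : Submodule R M}
    (hB : ∀ n, ∀ b ∈ B, p n b ∈ B) {n : ℕ} {a : M} :
    a ∈ (B.restrictScalars ℚ).map (p n) ↔ a ∈ B ∧ p n a = a := by
  constructor
  · rintro ⟨b, hb, rfl⟩
    exact ⟨hB n b hb, by rw [h.proj_proj, if_pos rfl]⟩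
  · rintro ⟨ha, hpa⟩
    exact ⟨a, ha, hpa⟩

theorem proj_eq_zero (h : IsPositivelyGraded x d p T) {a : M} (ha : a ∈ T) :
    ∃ N, ∀ n, N ≤ n → p n a = 0 := by
  obtain ⟨N, hN⟩ := h.exists_sum a ha
  refine ⟨N, fun n hn => ?_⟩
  rw [hN, map_sum]
  refine Finset.sum_eq_zero fun m hm => ?_
  rw [h.proj_proj, if_neg (by have := Finset.mem_range.1 hm; omega)]

theorem exists_finset (h : IsPositivelyGraded x d p T) {B : Submodule R M} (hBT : B ≤ T) :
    ∃ F : Finset M, Submodule.span R (F : Set M) = B :=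
  haveI := h.isNoetherian
  isNoetherian_submodule.1 h.isNoetherian B hBT

/-- Modulo the image of the generators `x j`, a module is spanned by its generators. -/
theorem le_span_sup (h : IsPositivelyGraded x d p T) {F : Set M} {V : Submodule ℚ M}
    (hV : ∀ j, ∀ b ∈ Submodule.span R F, x j • b ∈ V) :
    (Submodule.span R F).restrictScalars ℚ ≤ Submodule.span ℚ F ⊔ V := by
  have key (r : R) : ∃ c : ℚ, ∀ b ∈ Submodule.span R F, r • b - c • b ∈ V := by
    have hr : r ∈ Algebra.adjoin ℚ (Set.range x) := by rw [h.adjoin_eq_top]; trivial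
    induction hr using Algebra.adjoin_induction with
    | mem r hr =>
      obtain ⟨j, rfl⟩ := hr
      exact ⟨0, fun b hb => by rw [zero_smul, sub_zero]; exact hV j b hb⟩
    | algebraMap c => exact ⟨c, fun b _ => by rw [algebraMap_smul, sub_self]; exact zero_mem _⟩
    | add r s _ _ hr hs =>
      obtain ⟨c, hc⟩ := hr
      obtain ⟨e, he⟩ := hs
      refine ⟨c + e, fun b hb => ?_⟩
      rw [add_smul, add_smul, add_sub_add_comm]
      exact add_mem (hc b hb) (he b hb)
    | mul r s _ _ hr hs =>
      obtain ⟨c, hc⟩ := hr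
      obtain ⟨e, he⟩ := hs
      refine ⟨c * e, fun b hb => ?_⟩
      have h1 := hc (s • b) (Submodule.smul_mem _ s hb)
      have h2 := V.smul_mem c (he b hb)
      rw [mul_smul, mul_smul]
      rw [smul_sub] at h2
      have := add_mem h1 h2
      rwa [sub_add_sub_cancel] at this
  intro b hb
  change b ∈ Submodule.span R F at hb
  induction hb using Submodule.span_induction with
  | mem b hb => exact Submodule.mem_sup_left (Submodule.subset_span hb)
  | zero => exact zero_mem _
  | add a b _ _ ha hb => exact add_mem ha hb
  | smul r b hb hbV =>
    obtain ⟨c, hc⟩ := key r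
    have := add_mem (Submodule.mem_sup_right (hc b hb)) (Submodule.smul_mem _ c hbV)
    rwa [sub_add_cancel] at this

theorem finiteDimensional (h : IsPositivelyGraded x d p T) (n : ℕ) :
    FiniteDimensional ℚ ((T.restrictScalars ℚ).map (p n)) := by
  induction n using Nat.strong_induction_on with
  | _ n ih =>
    obtain ⟨F, rfl⟩ := h.exists_finset le_rfl
    set T := Submodule.span R (F : Set M) with hT
    let xℚ (j : Fin q) : M →ₗ[ℚ] M := (DistribSMul.toLinearMap ℚ M (x j))
    have h1 := Submodule.map_mono (f := p n) (h.le_span_sup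
      (V := ⨆ j, (T.restrictScalars ℚ).map (xℚ j)) fun j b hb =>
        Submodule.mem_iSup_of_mem j ⟨b, hb, rfl⟩)
    rw [Submodule.map_sup, Submodule.map_iSup] at h1
    have h2 (j : Fin q) :
        FiniteDimensional ℚ (((T.restrictScalars ℚ).map (xℚ j)).map (p n)) := by
      by_cases hj : n < d j
      · have : ((T.restrictScalars ℚ).map (xℚ j)).map (p n) = ⊥ := by
          rw [Submodule.eq_bot_iff]
          rintro _ ⟨_, ⟨b, hb, rfl⟩, rfl⟩
          exact h.proj_smul_of_lt n j b hb hj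
        rw [this]; infer_instance
      · have := ih (n - d j) (by have := h.pos j; omega)
        have h3 : ((T.restrictScalars ℚ).map (xℚ j)).map (p n) ≤
            ((T.restrictScalars ℚ).map (p (n - d j))).map (xℚ j) := by
          rintro _ ⟨_, ⟨b, hb, rfl⟩, rfl⟩
          refine ⟨_, ⟨b, hb, rfl⟩, ?_⟩
          have := h.proj_add_smul (n - d j) j b
          rw [Nat.sub_add_cancel (not_lt.1 hj)] at this
          exact this.symm
        exact Submodule.finiteDimensional_of_le h3
    have h4 : FiniteDimensional ℚ ((Submodule.span ℚ (F : Set M)).map (p n)) := by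
      have : FiniteDimensional ℚ (Submodule.span ℚ (F : Set M)) :=
        FiniteDimensional.span_finset ℚ F
      infer_instance
    exact Submodule.finiteDimensional_of_le h1

theorem finiteDimensional_of_le (h : IsPositivelyGraded x d p T) {B : Submodule R M} (hB : B ≤ T)
    (n : ℕ) : FiniteDimensional ℚ ((B.restrictScalars ℚ).map (p n)) :=
  haveI := h.finiteDimensional n
  Submodule.finiteDimensional_of_le (Submodule.map_mono (f := p n)
    (show B.restrictScalars ℚ ≤ T.restrictScalars ℚ from hB))

theorem smul_mem_graded (h : IsPositivelyGraded x d p T) {A : Submodule R M}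
    (hA : ∀ n, ∀ a ∈ A, p n a ∈ A) (j : Fin q) {a : M} (ha : x j • a ∈ A) (n : ℕ) :
    x j • p n a ∈ A := by
  rw [← h.proj_add_smul]
  exact hA _ _ ha

/-- The Hilbert function of a subquotient `B / A` on which only the first `k` generators act
nontrivially. For the induction step, multiplication by the generator `x k` on `B / A` has kernel and
cokernel on which only the first `k - 1` generators act nontrivially. -/
theorem isEventuallyQuasiPolynomial_sub (h : IsPositivelyGraded x d p T) {D : ℕ} (hD : 0 < D)
    (hd : ∀ j, d j ∣ D) {k : ℕ} (hk : k ≤ q) {A B : Submodule R M} (hAB : A ≤ B) (hBT : B ≤ T)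
    (hA : ∀ n, ∀ a ∈ A, p n a ∈ A) (hB : ∀ n, ∀ b ∈ B, p n b ∈ B)
    (hx : ∀ j : Fin q, k ≤ j → ∀ b ∈ B, x j • b ∈ A) :
    IsEventuallyQuasiPolynomial D k
      (fun n => (hilbertFunction p B n : ℚ) - hilbertFunction p A n) := by
  induction k generalizing A B with
  | zero =>
    obtain ⟨F, hF⟩ := h.exists_finset hBT
    have h1 : B.restrictScalars ℚ ≤ Submodule.span ℚ (F : Set M) ⊔ A.restrictScalars ℚ := by
      rw [← hF]
      exact h.le_span_sup fun j b hb => hx j (Nat.zero_le _) b (hF ▸ hb)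
    have h2 : ∀ᶠ n in Filter.atTop, ∀ f ∈ F, p n f = 0 :=
      (Finset.eventually_all F).2 fun f hf => by
        obtain ⟨N, hN⟩ := h.proj_eq_zero (hBT (hF ▸ Submodule.subset_span hf))
        exact Filter.eventually_atTop.2 ⟨N, hN⟩
    refine .of_eventually_eq_zero (h2.mono fun n hn => ?_)
    have h3 : (B.restrictScalars ℚ).map (p n) = (A.restrictScalars ℚ).map (p n) := by
      refine le_antisymm ((Submodule.map_mono h1).trans ?_) (Submodule.map_mono hAB)
      rw [Submodule.map_sup, Submodule.map_span]
      refine sup_le (Submodule.span_le.2 ?_) le_rfl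
      rintro _ ⟨f, hf, rfl⟩
      rw [hn f hf]; exact zero_mem _
    rw [hilbertFunction, hilbertFunction, h3, sub_self]
  | succ k ih =>
    let j₀ : Fin q := ⟨k, hk⟩
    have hcases (j : Fin q) (hj : k ≤ j) : j = j₀ ∨ k + 1 ≤ j := by
      rcases hj.eq_or_lt with hj | hj
      · exact Or.inl (Fin.ext hj.symm)
      · exact Or.inr hj
    let xR : M →ₗ[R] M := LinearMap.lsmul R M (x j₀)
    set K := B ⊓ A.comap xR with hK
    set I := B.map xR ⊔ A with hI
    have hxB {b : M} (hb : b ∈ B) : x j₀ • b ∈ B := B.smul_mem _ hb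
    have hKB : K ≤ B := inf_le_left
    have hAK : A ≤ K := le_inf hAB fun a ha => A.smul_mem _ ha
    have hIB : I ≤ B := sup_le (by rintro _ ⟨b, hb, rfl⟩; exact hxB hb) hAB
    have hKgr : ∀ n, ∀ a ∈ K, p n a ∈ K := fun n a ha =>
      ⟨hB n a ha.1, h.smul_mem_graded hA j₀ ha.2 n⟩
    have hproj (n : ℕ) (b : M) (hb : b ∈ B) : p n (x j₀ • b) ∈ B.map xR := by
      by_cases hn : n < d j₀
      · rw [h.proj_smul_of_lt n j₀ b (hBT hb) hn]; exact zero_mem _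
      · obtain ⟨m, rfl⟩ := Nat.exists_eq_add_of_le' (not_lt.1 hn)
        rw [h.proj_add_smul]
        exact ⟨_, hB m b hb, rfl⟩
    have hIgr : ∀ n, ∀ a ∈ I, p n a ∈ I := by
      intro n a ha
      obtain ⟨_, ⟨b, hb, rfl⟩, a, haA, rfl⟩ := Submodule.mem_sup.1 ha
      rw [map_add]
      exact add_mem (Submodule.mem_sup_left (hproj n b hb)) (Submodule.mem_sup_right (hA n a haA))
    have h1 := ih (Nat.le_of_succ_le hk) hIB hBT hIgr hB fun j hj b hb => by
      rcases hcases j hj with rfl | hj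
      · exact Submodule.mem_sup_left ⟨b, hb, rfl⟩
      · exact Submodule.mem_sup_right (hx j hj b hb)
    have h2 := ih (Nat.le_of_succ_le hk) hAK (hKB.trans hBT) hA hKgr fun j hj b hb => by
      rcases hcases j hj with rfl | hj
      · exact hb.2
      · exact hx j hj b (hKB hb)
    refine .of_difference hD (hd j₀) (((h1.comp_add (d j₀)).sub h2).congr
      (Filter.Eventually.of_forall fun n => ?_))
    -- Multiplication by `x k` from the piece of `B` to the piece of `B / A`.
    have := h.finiteDimensional_of_le hBT n
    have := h.finiteDimensional_of_le (hIB.trans hBT) (n + d j₀)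
    let f : M →ₗ[ℚ] M ⧸ A.restrictScalars ℚ :=
      (A.restrictScalars ℚ).mkQ ∘ₗ DistribSMul.toLinearMap ℚ M (x j₀)
    have e1 := Submodule.finrank_map_add_finrank_inf_ker f ((B.restrictScalars ℚ).map (p n))
    have e2 := Submodule.finrank_map_add_finrank_inf_ker (A.restrictScalars ℚ).mkQ
      ((I.restrictScalars ℚ).map (p (n + d j₀)))
    have e3 : (B.restrictScalars ℚ).map (p n) ⊓ LinearMap.ker f =
        (K.restrictScalars ℚ).map (p n) := by
      ext a
      rw [Submodule.mem_inf, h.mem_map_proj hB, h.mem_map_proj hKgr, LinearMap.mem_ker]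
      have : f a = 0 ↔ x j₀ • a ∈ A := Submodule.Quotient.mk_eq_zero _
      rw [this]
      exact ⟨fun h => ⟨⟨h.1.1, h.2⟩, h.1.2⟩, fun h => ⟨⟨h.1.1, h.2⟩, h.1.2⟩⟩
    have e4 : (I.restrictScalars ℚ).map (p (n + d j₀)) ⊓ LinearMap.ker (A.restrictScalars ℚ).mkQ =
        (A.restrictScalars ℚ).map (p (n + d j₀)) := by
      ext a
      rw [Submodule.ker_mkQ, Submodule.mem_inf, h.mem_map_proj hIgr, h.mem_map_proj hA]
      exact ⟨fun h => ⟨h.2, h.1.2⟩, fun h => ⟨⟨Submodule.mem_sup_right h.1, h.2⟩, h.1⟩⟩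
    have e5 : ((B.restrictScalars ℚ).map (p n)).map f =
        ((I.restrictScalars ℚ).map (p (n + d j₀))).map (A.restrictScalars ℚ).mkQ := by
      apply le_antisymm
      · rintro _ ⟨_, ⟨b, hb, rfl⟩, rfl⟩
        exact ⟨x j₀ • p n b, ⟨x j₀ • b, Submodule.mem_sup_left ⟨b, hb, rfl⟩,
          h.proj_add_smul n j₀ b⟩, rfl⟩
      · rintro _ ⟨_, ⟨c, hc, rfl⟩, rfl⟩
        obtain ⟨_, ⟨b, hb, rfl⟩, a, ha, rfl⟩ := Submodule.mem_sup.1 hc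
        refine ⟨p n b, ⟨b, hb, rfl⟩, (Submodule.Quotient.eq _).2 ?_⟩
        change x j₀ • p n b - p (n + d j₀) (x j₀ • b + a) ∈ A
        rw [map_add, h.proj_add_smul, sub_add_cancel_left]
        exact neg_mem (hA _ a ha)
    rw [e3] at e1
    rw [e4] at e2
    rw [e5] at e1
    simp only [hilbertFunction]
    rw [← e1, ← e2]
    push_cast
    ring

/-- The theorem of Hilbert and Serre: the Hilbert function is eventually quasi-polynomial. -/
theorem isEventuallyQuasiPolynomial (h : IsPositivelyGraded x d p T) {D : ℕ} (hD : 0 < D)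
    (hd : ∀ j, d j ∣ D) :
    IsEventuallyQuasiPolynomial D q (fun n => (hilbertFunction p T n : ℚ)) := by
  refine (h.isEventuallyQuasiPolynomial_sub hD hd le_rfl bot_le le_rfl (fun n a ha => ?_)
    h.proj_mem fun j hj => absurd j.2 (not_lt.2 hj)).congr (Filter.Eventually.of_forall fun n => ?_)
  · rw [(Submodule.mem_bot R).1 ha, map_zero]; exact zero_mem _
  · have : (⊥ : Submodule R M).restrictScalars ℚ = ⊥ := rfl
    rw [hilbertFunction, hilbertFunction, this, Submodule.map_bot, finrank_bot]
    simp

end IsPositivelyGraded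

end Hilbert

/-! ### Homogeneous generators -/

namespace BigradedFamily

variable {V : Type*} [AddCommGroup V] [Module ℚ V] [FiniteDimensional ℚ V]

theorem exists_homogeneous_basis (𝒱 : BigradedFamily V) :
    ∃ (n i : Fin (Module.finrank ℚ 𝒱.total) → ℤ) (x : Fin (Module.finrank ℚ 𝒱.total) → V),
      (∀ j, x j ∈ 𝒱 (n j) (i j) ∧ x j ≠ 0) ∧ Submodule.span ℚ (Set.range x) = 𝒱.total := by
  have hspan : Submodule.span ℚ {v | ∃ n i, v ∈ 𝒱 n i} = 𝒱.total := by
    refine le_antisymm (Submodule.span_le.2 ?_) (iSup_le fun p v hv =>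
      Submodule.subset_span ⟨p.1, p.2, hv⟩)
    rintro v ⟨n, i, hv⟩
    exact Submodule.mem_iSup_of_mem (p := fun p : ℤ × ℤ => 𝒱 p.1 p.2) (n, i) hv
  have key := Submodule.exists_fun_fin_finrank_span_eq ℚ {v : V | ∃ n i, v ∈ 𝒱 n i}
  rw [hspan] at key
  obtain ⟨x, hx, hxs, hli⟩ := key
  choose n i hni using hx
  exact ⟨n, i, x, fun j => ⟨hni j, hli.ne_zero j⟩, hxs⟩

end BigradedFamily

namespace BigradedLieAlgebra

variable {G : Type*} [AddCommGroup G] [Module ℚ G] {𝔤 : BigradedLieAlgebra G}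
  {𝔥 : Submodule ℚ G} {C : ℚ}

theorem mem_extremal {n k : ℤ} {y : G} (hy : y ∈ 𝔤.extremal 𝔥 C n k) (hy0 : y ≠ 0) :
    n ≠ 0 ∧ (k : ℚ) / n = C ∧ y ∈ 𝔤.gr.shift n k := by
  simp only [extremal, BigradedFamily.ofSlope, BigradedFamily.even] at hy
  split_ifs at hy with h1 h2
  · exact ⟨h1.1, h1.2, hy.1⟩
  · exact absurd (by simpa using hy) hy0
  · exact absurd (by simpa using hy) hy0

/-- A basis of `𝔥[1]^0_C` consists of elements on the line through the origin of slope `C`, with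
weights that divide `lcm(𝔥[1]^0_C)`. -/
theorem exists_extremal_basis [FiniteDimensional ℚ G] (hquad : 𝔤.gr.shift.FirstQuadrant)
    (𝔥 : Submodule ℚ G) (C : ℚ) :
    0 < (𝔤.extremal 𝔥 C).weightLcm ∧
    ∃ (u : Fin (Module.finrank ℚ (𝔤.extremal 𝔥 C).total) → ℕ)
      (x : Fin (Module.finrank ℚ (𝔤.extremal 𝔥 C).total) → (𝔤.extremal 𝔥 C).total),
      Submodule.span ℚ (Set.range x) = ⊤ ∧ ∀ j, 0 < u j ∧
        (x j : G) ∈ 𝔤.gr.shift ((C.den : ℤ) * u j) (C.num * u j) ∧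
        C.den * u j ∣ (𝔤.extremal 𝔥 C).weightLcm := by
  obtain ⟨n, k, x, hx, hspan⟩ := (𝔤.extremal 𝔥 C).exists_homogeneous_basis
  have hden : (C.den : ℤ) ≠ 0 := by exact_mod_cast C.den_nz
  have hu (j) : ∃ u : ℕ, 0 < u ∧ n j = C.den * u ∧ k j = C.num * u := by
    obtain ⟨hn, hC, hmem⟩ := mem_extremal (hx j).1 (hx j).2
    have hn0 : 0 < n j := by
      refine lt_of_le_of_ne (not_lt.1 fun hlt => (hx j).2 ?_) hn.symm
      rw [hquad _ _ (Or.inl hlt)] at hmem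
      exact (Submodule.mem_bot ℚ).1 hmem
    have hkn : k j * C.den = C.num * n j := by
      have h1 : (k j : ℚ) = C * n j := by rw [← hC]; field_simp
      have h2 : C * C.den = C.num := Rat.mul_den_eq_num C
      have h3 : ((k j * C.den : ℤ) : ℚ) = ((C.num * n j : ℤ) : ℚ) := by
        push_cast
        rw [h1, ← h2]; ring
      exact_mod_cast h3
    have hdvd : (C.den : ℤ) ∣ n j :=
      (Int.isCoprime_iff_nat_coprime.2 (by simpa using C.reduced.symm)).dvd_of_dvd_mul_left
        ⟨k j, by rw [← hkn]; ring⟩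
    obtain ⟨u, hu⟩ := hdvd
    have hu0 : 0 < u := by
      have : (0 : ℤ) < C.den := by exact_mod_cast C.den_pos
      rw [hu] at hn0
      exact pos_of_mul_pos_right hn0 this.le
    lift u to ℕ using hu0.le
    refine ⟨u, by exact_mod_cast hu0, hu, mul_right_cancel₀ hden ?_⟩
    rw [hkn, hu]; ring
  choose u hu0 hun huk using hu
  have hmemset : (𝔤.extremal 𝔥 C).weightLcm ∈
      {N : ℕ | 0 < N ∧ ∀ n i : ℤ, 𝔤.extremal 𝔥 C n i ≠ ⊥ → n ∣ (N : ℤ)} := by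
    refine Nat.sInf_mem ⟨∏ j, C.den * u j, Finset.prod_pos fun j _ =>
      Nat.mul_pos C.den_pos (hu0 j), fun m i hmi => ?_⟩
    obtain ⟨y, hy, hy0⟩ := (Submodule.ne_bot_iff _).1 hmi
    -- Some basis element has the weight of `y`, since the projection of `y` to its own piece
    -- would be zero otherwise.
    obtain ⟨j, hj⟩ : ∃ j, n j = m := by
      by_contra! hne
      have h1 : y ∈ Submodule.span ℚ (Set.range x) := by
        rw [hspan]
        exact Submodule.mem_iSup_of_mem (p := fun p : ℤ × ℤ => 𝔤.extremal 𝔥 C p.1 p.2) (m, i) hy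
      have h2 : Submodule.span ℚ (Set.range x) ≤
          LinearMap.ker (𝔤.toBigrading.proj m (i - 1)) := by
        refine Submodule.span_le.2 ?_
        rintro _ ⟨j, rfl⟩
        exact 𝔤.toBigrading.proj_of_mem_ne (mem_extremal (hx j).1 (hx j).2).2.2
          fun h => hne j h.1
      have h3 := LinearMap.mem_ker.1 (h2 h1)
      rw [𝔤.toBigrading.proj_of_mem (mem_extremal hy hy0).2.2] at h3
      exact hy0 h3
    rw [← hj, hun]
    exact_mod_cast Finset.dvd_prod_of_mem (fun j => C.den * u j) (Finset.mem_univ j)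
  have hxt (j) : x j ∈ (𝔤.extremal 𝔥 C).total := by
    rw [← hspan]; exact Submodule.subset_span ⟨j, rfl⟩
  refine ⟨hmemset.1, u, fun j => ⟨x j, hxt j⟩, ?_, fun j => ⟨hu0 j, ?_, ?_⟩⟩
  · refine Submodule.map_injective_of_injective (Submodule.injective_subtype _) ?_
    rw [Submodule.map_span, Submodule.map_subtype_top, ← Set.range_comp]
    exact hspan
  · rw [← hun, ← huk]
    exact (mem_extremal (hx j).1 (hx j).2).2.2
  · have := hmemset.2 (n j) (k j) ((Submodule.ne_bot_iff _).2 ⟨x j, (hx j).1, (hx j).2⟩)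
    rw [hun] at this
    exact_mod_cast this

/-- The slope conditions, in terms of a linear functional `ℓ` that vanishes on the line through the
origin of slope `C`. -/
theorem exists_functional (hquad : 𝔤.gr.shift.FirstQuadrant)
    (hslope :
      ((𝔤.gr.restrict 𝔥).shift.even.SlopesSatisfy (fun m => m ≤ C) ∧
        (𝔤.gr.quotient 𝔥).shift.even.SlopesSatisfy (fun m => m < C)) ∨
      ((𝔤.gr.restrict 𝔥).shift.even.SlopesSatisfy (fun m => C ≤ m) ∧
        (𝔤.gr.quotient 𝔥).shift.even.SlopesSatisfy (fun m => C < m))) :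
    ∃ ℓ : ℤ × ℤ →+ ℚ, (∀ u : ℤ, ℓ (C.den * u, C.num * u) = 0) ∧
      ∀ n k y, y ∈ 𝔤.gr.shift n k → y ≠ 0 →
        Odd k ∨ ℓ (n, k) < 0 ∨ ℓ (n, k) = 0 ∧ y ∈ 𝔤.extremal 𝔥 C n k := by
  let ℓ₀ : ℤ × ℤ →+ ℚ :=
    (Int.castAddHom ℚ).comp (AddMonoidHom.snd ℤ ℤ) -
      (AddMonoidHom.mulLeft C).comp ((Int.castAddHom ℚ).comp (AddMonoidHom.fst ℤ ℤ))
  have hℓ₀ (n k : ℤ) : ℓ₀ (n, k) = k - C * n := rfl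
  have hline (u : ℤ) : ℓ₀ (C.den * u, C.num * u) = 0 := by
    rw [hℓ₀]
    push_cast
    rw [← mul_assoc, Rat.mul_den_eq_num, sub_self]
  -- The slope of an element of positive weight determines the sign of `ℓ₀`.
  have hres {n k : ℤ} {y : G} (hy : y ∈ 𝔤.gr.shift n k) (hy0 : y ≠ 0) (hk : Even k) :
      0 ≤ n ∧ (y ∈ 𝔥 → (𝔤.gr.restrict 𝔥).shift.even n k ≠ ⊥) ∧
        (y ∉ 𝔥 → (𝔤.gr.quotient 𝔥).shift.even n k ≠ ⊥) := by
    refine ⟨not_lt.1 fun hlt => hy0 ?_, fun hyh => ?_, fun hyh => ?_⟩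
    · rw [hquad _ _ (Or.inl hlt)] at hy
      exact (Submodule.mem_bot ℚ).1 hy
    · rw [BigradedFamily.even, if_pos hk]
      exact (Submodule.ne_bot_iff _).2 ⟨y, ⟨hy, hyh⟩, hy0⟩
    · rw [BigradedFamily.even, if_pos hk]
      exact (Submodule.ne_bot_iff _).2 ⟨𝔥.mkQ y, ⟨y, hy, rfl⟩,
        fun h => hyh ((Submodule.Quotient.mk_eq_zero _).1 h)⟩
  have hext {n k : ℤ} {y : G} (hy : y ∈ 𝔤.gr.shift n k) (hyh : y ∈ 𝔥) (hk : Even k) (hn : n ≠ 0)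
      (hC : (k : ℚ) / n = C) : y ∈ 𝔤.extremal 𝔥 C n k := by
    rw [extremal, BigradedFamily.ofSlope, if_pos ⟨hn, hC⟩, BigradedFamily.even, if_pos hk]
    exact ⟨hy, hyh⟩
  rcases hslope with ⟨h1, h2⟩ | ⟨h1, h2⟩
  · refine ⟨ℓ₀, hline, fun n k y hy hy0 => ?_⟩
    rcases Int.even_or_odd k with hk | hk
    · obtain ⟨hn0, hin, hout⟩ := hres hy hy0 hk
      right
      by_cases hyh : y ∈ 𝔥
      · obtain ⟨hn, hle⟩ := h1 n k (hin hyh)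
        have hn' : (0 : ℚ) < n := by exact_mod_cast lt_of_le_of_ne hn0 hn.symm
        rcases hle.lt_or_eq with hlt | heq
        · left
          rw [div_lt_iff₀ hn'] at hlt
          rw [hℓ₀]; linarith
        · refine Or.inr ⟨?_, hext hy hyh hk hn heq⟩
          rw [div_eq_iff hn'.ne'] at heq
          rw [hℓ₀]; linarith
      · obtain ⟨hn, hlt⟩ := h2 n k (hout hyh)
        have hn' : (0 : ℚ) < n := by exact_mod_cast lt_of_le_of_ne hn0 hn.symm
        left
        rw [div_lt_iff₀ hn'] at hlt
        rw [hℓ₀]; linarith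
    · exact Or.inl hk
  · refine ⟨-ℓ₀, fun u => by rw [AddMonoidHom.neg_apply, hline, neg_zero], fun n k y hy hy0 => ?_⟩
    rw [AddMonoidHom.neg_apply]
    rcases Int.even_or_odd k with hk | hk
    · obtain ⟨hn0, hin, hout⟩ := hres hy hy0 hk
      right
      by_cases hyh : y ∈ 𝔥
      · obtain ⟨hn, hle⟩ := h1 n k (hin hyh)
        have hn' : (0 : ℚ) < n := by exact_mod_cast lt_of_le_of_ne hn0 hn.symm
        rcases hle.lt_or_eq with hlt | heq
        · left
          rw [lt_div_iff₀ hn'] at hlt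
          rw [hℓ₀]; linarith
        · refine Or.inr ⟨?_, hext hy hyh hk hn heq.symm⟩
          rw [eq_div_iff hn'.ne'] at heq
          rw [hℓ₀]; linarith
      · obtain ⟨hn, hlt⟩ := h2 n k (hout hyh)
        have hn' : (0 : ℚ) < n := by exact_mod_cast lt_of_le_of_ne hn0 hn.symm
        left
        rw [lt_div_iff₀ hn'] at hlt
        rw [hℓ₀]; linarith
    · exact Or.inl hk

end BigradedLieAlgebra

theorem SymmetricAlgebra.adjoin_eq_top {K V ι : Type*} [CommRing K] [AddCommGroup V] [Module K V]
    {x : ι → V} (hx : Submodule.span K (Set.range x) = ⊤) :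
    Algebra.adjoin K (Set.range fun j => SymmetricAlgebra.ι K V (x j)) = ⊤ := by
  rw [eq_top_iff]
  rintro r -
  induction r using SymmetricAlgebra.induction with
  | algebraMap r => exact Subalgebra.algebraMap_mem _ r
  | mul a b ha hb => exact mul_mem ha hb
  | add a b ha hb => exact add_mem ha hb
  | ι v =>
    have hv : v ∈ Submodule.span K (Set.range x) := by rw [hx]; trivial
    induction hv using Submodule.span_induction with
    | zero => rw [map_zero]; exact zero_mem _
    | add a b _ _ ha hb => rw [map_add]; exact add_mem ha hb
    | smul c a _ ha => rw [map_smul]; exact Subalgebra.smul_mem _ ha c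
    | mem v hv =>
      obtain ⟨j, rfl⟩ := hv
      exact Algebra.subset_adjoin ⟨j, rfl⟩

/-! ### The bigrading of homology -/

namespace BigradedLieAlgebra

variable {E : Type*} [AddCommGroup E] [Module ℚ E] {𝔢 : BigradedLieAlgebra E}

variable (𝔢) in
/-- The class of a cycle. -/
abbrev homologyMk : LinearMap.ker 𝔢.ceD →ₗ[ℚ] 𝔢.Homology :=
  ((LinearMap.range 𝔢.ceD).submoduleOf (LinearMap.ker 𝔢.ceD)).mkQ

theorem homologyMk_surjective : Function.Surjective 𝔢.homologyMk := Submodule.mkQ_surjective _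

theorem mem_homologyGr {n i : ℤ} {a : 𝔢.Homology} :
    a ∈ 𝔢.homologyGr n i ↔
      ∃ z : LinearMap.ker 𝔢.ceD, (z : 𝔢.CE) ∈ 𝔢.ceBigrading.gr n i ∧ 𝔢.homologyMk z = a := Iff.rfl

theorem homologyMk_eq {z w : LinearMap.ker 𝔢.ceD} {b : 𝔢.CE} (h : (z : 𝔢.CE) = w + 𝔢.ceD b) :
    𝔢.homologyMk z = 𝔢.homologyMk w :=
  (Submodule.Quotient.eq _).2 ⟨b, by simp [h]⟩

theorem proj_mem_ker (n i : ℤ) {z : 𝔢.CE} (hz : z ∈ LinearMap.ker 𝔢.ceD) :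
    𝔢.ceBigrading.proj n i z ∈ LinearMap.ker 𝔢.ceD := by
  have := 𝔢.proj_ceD n (i - 1) z
  rw [LinearMap.mem_ker.1 hz, map_zero, sub_add_cancel] at this
  exact this.symm

variable (𝔢) in
/-- The projection of homology onto the piece of bidegree `(n,i)`. -/
def homologyProj (n i : ℤ) : 𝔢.Homology →ₗ[ℚ] 𝔢.Homology :=
  Submodule.mapQ _ _
    ((𝔢.ceBigrading.proj n i).restrict (p := LinearMap.ker 𝔢.ceD) (q := LinearMap.ker 𝔢.ceD)
      fun _ hz => proj_mem_ker n i hz)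
    (by
      rintro ⟨_, hz⟩ ⟨b, rfl⟩
      exact ⟨𝔢.ceBigrading.proj n (i + 1) b, (proj_ceD n i b).symm⟩)

theorem homologyProj_mk (n i : ℤ) (z : LinearMap.ker 𝔢.ceD) :
    𝔢.homologyProj n i (𝔢.homologyMk z) = 𝔢.homologyMk ⟨_, proj_mem_ker n i z.2⟩ := rfl

theorem homologyProj_mem (n i : ℤ) (a : 𝔢.Homology) : 𝔢.homologyProj n i a ∈ 𝔢.homologyGr n i := by
  obtain ⟨z, rfl⟩ := homologyMk_surjective a
  exact mem_homologyGr.2 ⟨_, 𝔢.ceBigrading.proj_mem n i z, rfl⟩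

theorem homologyProj_of_mem {n i : ℤ} {a : 𝔢.Homology} (ha : a ∈ 𝔢.homologyGr n i) :
    𝔢.homologyProj n i a = a := by
  obtain ⟨z, hz, rfl⟩ := mem_homologyGr.1 ha
  rw [homologyProj_mk]
  exact congrArg _ (Subtype.ext (Bigrading.proj_of_mem _ hz))

theorem homologyProj_of_mem_ne {n i m j : ℤ} {a : 𝔢.Homology} (ha : a ∈ 𝔢.homologyGr m j)
    (h : ¬ (m = n ∧ j = i)) : 𝔢.homologyProj n i a = 0 := by
  obtain ⟨z, hz, rfl⟩ := mem_homologyGr.1 ha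
  rw [homologyProj_mk, ← map_zero 𝔢.homologyMk]
  exact congrArg _ (Subtype.ext (Bigrading.proj_of_mem_ne _ hz h))

theorem homologyProj_act {m j : ℤ} {x : E} (hx : x ∈ 𝔢.gr.shift m j) (hx' : 𝔢.IsOddCentral x)
    (n i : ℤ) (a : 𝔢.Homology) : 𝔢.homologyProj n i (hx'.act a) =
      hx'.act (𝔢.homologyProj (n - m) (i - j) a) := by
  obtain ⟨z, rfl⟩ := homologyMk_surjective a
  exact congrArg 𝔢.homologyMk (Subtype.ext (proj_ceι_mul hx n i z))

/-! ### Finite generation -/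

section FiniteGeneration

variable {R : Type*} [CommRing R] [Module R 𝔢.CE] [Module R 𝔢.Homology]

/-- If a Noetherian ring acts on the chains and on homology, then the classes of the cycles in a
finitely generated module are contained in a finitely generated module. -/
theorem exists_fg_homologyMk_mem [IsNoetherianRing R]
    (hD : ∀ (r : R) (z : 𝔢.CE), 𝔢.ceD (r • z) = r • 𝔢.ceD z)
    (hmk : ∀ (r : R) (z w : LinearMap.ker 𝔢.ceD), (w : 𝔢.CE) = r • (z : 𝔢.CE) →
      r • 𝔢.homologyMk z = 𝔢.homologyMk w)
    {T : Submodule R 𝔢.CE} (hT : T.FG) :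
    ∃ W : Submodule R 𝔢.Homology, W.FG ∧
      ∀ z : LinearMap.ker 𝔢.ceD, (z : 𝔢.CE) ∈ T → 𝔢.homologyMk z ∈ W := by
  let Z : Submodule R 𝔢.CE :=
    { carrier := {z | z ∈ T ∧ 𝔢.ceD z = 0}
      add_mem' := fun ha hb => ⟨add_mem ha.1 hb.1, by rw [map_add, ha.2, hb.2, add_zero]⟩
      zero_mem' := ⟨zero_mem _, map_zero _⟩
      smul_mem' := fun r a ha => ⟨T.smul_mem r ha.1, by rw [hD, ha.2, smul_zero]⟩ }
  let φ : Z →ₗ[R] 𝔢.Homology :=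
    { toFun := fun z => 𝔢.homologyMk ⟨z, z.2.2⟩
      map_add' := fun _ _ => rfl
      map_smul' := fun r z => (hmk r ⟨z, z.2.2⟩ ⟨_, (r • z).2.2⟩ rfl).symm }
  have hZ : Z.FG := by
    have := isNoetherian_of_fg_of_noetherian T hT
    exact isNoetherian_submodule.1 this Z fun z hz => hz.1
  refine ⟨LinearMap.range φ, ?_, fun z hz => ⟨⟨z, hz, z.2⟩, rfl⟩⟩
  have : Module.Finite R Z := Module.Finite.iff_fg.2 hZ
  exact Module.Finite.iff_fg.1 (Module.Finite.range φ)

end FiniteGeneration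

end BigradedLieAlgebra

/-! ### Rays in homology -/

namespace BigradedLieAlgebra

variable {E : Type*} [AddCommGroup E] [Module ℚ E] {𝔢 : BigradedLieAlgebra E} {C : ℚ} {i₀ : ℤ}

open Classical in
variable (𝔢 C i₀) in
/-- The projection of homology onto the piece of weight `n` of a ray. -/
def rayProj (n : ℕ) : 𝔢.Homology →ₗ[ℚ] 𝔢.Homology :=
  if C.den ∣ n then 𝔢.homologyProj n (C.num * ((n / C.den : ℕ) : ℤ) + i₀) else 0

theorem rayProj_mul (u : ℕ) :
    𝔢.rayProj C i₀ (C.den * u) = 𝔢.homologyProj ((C.den : ℤ) * u) (C.num * u + i₀) := by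
  rw [rayProj, if_pos (dvd_mul_right _ _), Nat.mul_div_cancel_left _ C.den_pos, Nat.cast_mul]

theorem rayProj_of_not_dvd {n : ℕ} (h : ¬ C.den ∣ n) : 𝔢.rayProj C i₀ n = 0 := if_neg h

theorem homologyGr_le_ray (u : ℕ) :
    𝔢.homologyGr ((C.den : ℤ) * u) (C.num * u + i₀) ≤ 𝔢.homologyGr.ray C i₀ :=
  le_iSup (fun u : ℕ => 𝔢.homologyGr ((C.den : ℤ) * u) (C.num * u + i₀)) u

theorem rayProj_mem (n : ℕ) (a : 𝔢.Homology) : 𝔢.rayProj C i₀ n a ∈ 𝔢.homologyGr.ray C i₀ := by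
  by_cases h : C.den ∣ n
  · obtain ⟨u, rfl⟩ := h
    rw [rayProj_mul]
    exact homologyGr_le_ray u (homologyProj_mem _ _ a)
  · rw [rayProj_of_not_dvd h]; exact zero_mem _

theorem rayProj_of_mem {u : ℕ} {a : 𝔢.Homology}
    (ha : a ∈ 𝔢.homologyGr ((C.den : ℤ) * u) (C.num * u + i₀)) (n : ℕ) :
    𝔢.rayProj C i₀ n a = if n = C.den * u then a else 0 := by
  split_ifs with h
  · rw [h, rayProj_mul, homologyProj_of_mem ha]
  · by_cases hn : C.den ∣ n
    · obtain ⟨v, rfl⟩ := hn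
      rw [rayProj_mul, homologyProj_of_mem_ne ha]
      rintro ⟨h1, -⟩
      exact h (by exact_mod_cast h1.symm)
    · rw [rayProj_of_not_dvd hn, LinearMap.zero_apply]

theorem rayProj_rayProj (n m : ℕ) (a : 𝔢.Homology) :
    𝔢.rayProj C i₀ n (𝔢.rayProj C i₀ m a) = if n = m then 𝔢.rayProj C i₀ m a else 0 := by
  by_cases hm : C.den ∣ m
  · obtain ⟨u, rfl⟩ := hm
    rw [rayProj_mul, rayProj_of_mem (homologyProj_mem _ _ a)]
  · rw [rayProj_of_not_dvd hm]; simp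

theorem map_rayProj (n : ℕ) : (𝔢.homologyGr.ray C i₀).map (𝔢.rayProj C i₀ n) =
    if C.den ∣ n then 𝔢.homologyGr n (C.num * ((n / C.den : ℕ) : ℤ) + i₀) else ⊥ := by
  split_ifs with h
  · obtain ⟨u, rfl⟩ := h
    rw [rayProj_mul, Nat.mul_div_cancel_left _ C.den_pos, Nat.cast_mul]
    apply le_antisymm
    · rintro _ ⟨a, -, rfl⟩
      exact homologyProj_mem _ _ a
    · exact fun a ha => ⟨a, homologyGr_le_ray u ha, homologyProj_of_mem ha⟩
  · rw [rayProj_of_not_dvd h, Submodule.map_zero]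

theorem eq_sum_rayProj {a : 𝔢.Homology} (ha : a ∈ 𝔢.homologyGr.ray C i₀) :
    ∃ N, ∀ N', N ≤ N' → a = ∑ n ∈ Finset.range N', 𝔢.rayProj C i₀ n a := by
  induction ha using Submodule.iSup_induction' with
  | zero => exact ⟨0, fun _ _ => by simp⟩
  | add a b _ _ ha hb =>
    obtain ⟨N, hN⟩ := ha
    obtain ⟨M, hM⟩ := hb
    refine ⟨max N M, fun N' h => ?_⟩
    simp only [map_add, Finset.sum_add_distrib]
    rw [← hN N' (le_of_max_le_left h), ← hM N' (le_of_max_le_right h)]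
  | mem u a ha =>
    refine ⟨C.den * u + 1, fun N' h => ?_⟩
    simp only [rayProj_of_mem ha]
    rw [Finset.sum_ite_eq', if_pos (Finset.mem_range.2 h)]

theorem act_mem_homologyGr {m j : ℤ} {x : E} (hx : x ∈ 𝔢.gr.shift m j) (hx' : 𝔢.IsOddCentral x)
    {n i : ℤ} {a : 𝔢.Homology} (ha : a ∈ 𝔢.homologyGr n i) :
    hx'.act a ∈ 𝔢.homologyGr (m + n) (j + i) := by
  have := 𝔢.homologyProj_act hx hx' (m + n) (j + i) a
  rw [add_sub_cancel_left, add_sub_cancel_left, homologyProj_of_mem ha] at this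
  rw [← this]
  exact homologyProj_mem _ _ _

theorem act_mem_ray {x : E} {u : ℕ} (hx : x ∈ 𝔢.gr.shift ((C.den : ℤ) * u) (C.num * u))
    (hx' : 𝔢.IsOddCentral x) {a : 𝔢.Homology} (ha : a ∈ 𝔢.homologyGr.ray C i₀) :
    hx'.act a ∈ 𝔢.homologyGr.ray C i₀ := by
  induction ha using Submodule.iSup_induction' with
  | zero => simp
  | add a b _ _ ha hb => rw [map_add]; exact add_mem ha hb
  | mem v a ha =>
    have := act_mem_homologyGr hx hx' ha
    rw [← mul_add, ← add_assoc, ← mul_add, ← Nat.cast_add] at this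
    exact homologyGr_le_ray _ this

theorem rayProj_add_act {x : E} {u : ℕ} (hx : x ∈ 𝔢.gr.shift ((C.den : ℤ) * u) (C.num * u))
    (hx' : 𝔢.IsOddCentral x) (n : ℕ) (a : 𝔢.Homology) :
    𝔢.rayProj C i₀ (n + C.den * u) (hx'.act a) = hx'.act (𝔢.rayProj C i₀ n a) := by
  by_cases h : C.den ∣ n
  · obtain ⟨v, rfl⟩ := h
    rw [← mul_add, rayProj_mul, rayProj_mul, homologyProj_act hx]
    push_cast
    congr 2
    congr 1 <;> ring
  · rw [rayProj_of_not_dvd h, rayProj_of_not_dvd fun h' => h ((Nat.dvd_add_left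
      (dvd_mul_right _ _)).1 h')]
    simp

theorem rayProj_act_of_lt {x : E} {u : ℕ} (hx : x ∈ 𝔢.gr.shift ((C.den : ℤ) * u) (C.num * u))
    (hx' : 𝔢.IsOddCentral x) {a : 𝔢.Homology} (ha : a ∈ 𝔢.homologyGr.ray C i₀) {n : ℕ}
    (hn : n < C.den * u) : 𝔢.rayProj C i₀ n (hx'.act a) = 0 := by
  induction ha using Submodule.iSup_induction' with
  | zero => simp
  | add a b _ _ ha hb => rw [map_add, map_add, ha, hb, add_zero]
  | mem v a ha =>
    have := act_mem_homologyGr hx hx' ha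
    rw [← mul_add, ← add_assoc, ← mul_add, ← Nat.cast_add] at this
    rw [rayProj_of_mem this, if_neg]
    rw [mul_add]
    omega

/-- A ray in homology as a graded module over an algebra that is generated by central elements on the
line through the origin. -/
theorem isPositivelyGraded_ray {R : Type*} [CommRing R] [Algebra ℚ R] [Module R 𝔢.Homology]
    [IsScalarTower ℚ R 𝔢.Homology] {q : ℕ} {r : Fin q → R}
    (hr : Algebra.adjoin ℚ (Set.range r) = ⊤) {x : Fin q → E} (hx' : ∀ j, 𝔢.IsOddCentral (x j))
    {u : Fin q → ℕ} (hu : ∀ j, 0 < u j)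
    (hx : ∀ j, x j ∈ 𝔢.gr.shift ((C.den : ℤ) * u j) (C.num * u j))
    (hact : ∀ j (a : 𝔢.Homology), r j • a = (hx' j).act a) {T : Submodule R 𝔢.Homology}
    (hT : T.restrictScalars ℚ = 𝔢.homologyGr.ray C i₀) (hnoeth : IsNoetherian R T) :
    IsPositivelyGraded r (fun j => C.den * u j) (𝔢.rayProj C i₀) T where
  adjoin_eq_top := hr
  pos j := Nat.mul_pos C.den_pos (hu j)
  proj_proj := rayProj_rayProj
  proj_add_smul n j a := by rw [hact, hact, rayProj_add_act (hx j)]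
  proj_smul_of_lt n j a ha hn := by
    rw [hact]
    exact rayProj_act_of_lt (hx j) (hx' j) (hT ▸ ha) hn
  proj_mem n a _ := by
    have := 𝔢.rayProj_mem (C := C) (i₀ := i₀) n a
    rwa [← hT] at this
  exists_sum a ha := by
    obtain ⟨N, hN⟩ := eq_sum_rayProj (C := C) (i₀ := i₀) (a := a) (hT ▸ ha)
    exact ⟨N, hN N le_rfl⟩
  isNoetherian := hnoeth

/-- A ray is a submodule for an algebra that is generated by central elements on the line through
the origin. -/
theorem exists_restrictScalars_eq_ray {R : Type*} [CommRing R] [Algebra ℚ R]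
    [Module R 𝔢.Homology] [IsScalarTower ℚ R 𝔢.Homology] {q : ℕ} {r : Fin q → R}
    (hr : Algebra.adjoin ℚ (Set.range r) = ⊤) {x : Fin q → E} (hx' : ∀ j, 𝔢.IsOddCentral (x j))
    {u : Fin q → ℕ} (hx : ∀ j, x j ∈ 𝔢.gr.shift ((C.den : ℤ) * u j) (C.num * u j))
    (hact : ∀ j (a : 𝔢.Homology), r j • a = (hx' j).act a) (i₀ : ℤ) :
    ∃ T : Submodule R 𝔢.Homology, T.restrictScalars ℚ = 𝔢.homologyGr.ray C i₀ := by
  refine ⟨{ 𝔢.homologyGr.ray C i₀ with smul_mem' := fun s a ha => ?_ }, rfl⟩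
  have hs : s ∈ Algebra.adjoin ℚ (Set.range r) := by rw [hr]; trivial
  change a ∈ 𝔢.homologyGr.ray C i₀ at ha
  change s • a ∈ 𝔢.homologyGr.ray C i₀
  induction hs using Algebra.adjoin_induction generalizing a with
  | mem s hs =>
    obtain ⟨j, rfl⟩ := hs
    rw [hact]
    exact act_mem_ray (hx j) (hx' j) ha
  | algebraMap c => rw [algebraMap_smul]; exact Submodule.smul_mem _ c ha
  | add s t _ _ hs ht => rw [add_smul]; exact add_mem (hs a ha) (ht a ha)
  | mul s t _ _ hs ht => rw [mul_smul]; exact hs _ (ht a ha)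

end BigradedLieAlgebra

/-! ### Rays in the homology of a semidirect product -/

theorem corollary4p4 {G L E : Type*} [AddCommGroup G] [Module ℚ G] [AddCommGroup L] [Module ℚ L]
    [AddCommGroup E] [Module ℚ E]
    (𝔤 : BigradedLieAlgebra G) (𝔩 : BigradedLieAlgebra L) (𝔢 : BigradedLieAlgebra E)
    (hfin : FiniteDimensional ℚ G) (hquad : 𝔤.gr.shift.FirstQuadrant)
    (hconn : 𝔤.gr.shift.Connected)
    (𝔥 : Submodule ℚ G) (h𝔥 : 𝔤.IsCentralSubalgebra 𝔥) (C : ℚ)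
    (hslope :
      ((𝔤.gr.restrict 𝔥).shift.even.SlopesSatisfy (fun m => m ≤ C) ∧
        (𝔤.gr.quotient 𝔥).shift.even.SlopesSatisfy (fun m => m < C)) ∨
      ((𝔤.gr.restrict 𝔥).shift.even.SlopesSatisfy (fun m => C ≤ m) ∧
        (𝔤.gr.quotient 𝔥).shift.even.SlopesSatisfy (fun m => C < m)))
    (hfree : 𝔩.IsFreeOfFiniteRank)
    (i : G →ₗ[ℚ] E) (s : L →ₗ[ℚ] E)
    (hsemi : BigradedLieAlgebra.IsSemidirectProduct 𝔤 𝔩 𝔢 i s)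
    (hcent : ∀ x ∈ (𝔤.extremal 𝔥 C).total, ∀ y : L, 𝔢.bracket (s y) (i x) = 0) :
    ∀ i₀ : ℤ,
      IsFinitelyGeneratedOver
        (BigradedLieAlgebra.centralAction (i ∘ₗ (𝔤.extremal 𝔥 C).total.subtype)
          (hsemi.isOddCentral h𝔥 hcent))
        (𝔢.homologyGr.ray C i₀) ∧
      (∀ u : ℕ, FiniteDimensional ℚ
        (𝔢.homologyGr ((C.den : ℤ) * u) (C.num * u + i₀))) ∧
      ∃ q : QuasiPolynomial,
        q.degree < (Module.finrank ℚ (𝔤.extremal 𝔥 C).total : WithBot ℕ) ∧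
        q.period ∣ (𝔤.extremal 𝔥 C).weightLcm ∧
        ∀ᶠ n : ℕ in Filter.atTop, (𝔢.homologyGr.rayDim C i₀ n : ℚ) = q.value n := by
  intro i₀
  set S := (𝔤.extremal 𝔥 C).total
  set f : S →ₗ[ℚ] E := i ∘ₗ S.subtype
  have hf : ∀ x, 𝔢.IsOddCentral (f x) := hsemi.isOddCentral h𝔥 hcent
  obtain ⟨hpos, u, s', hs', hu⟩ := BigradedLieAlgebra.exists_extremal_basis hquad 𝔥 C
  obtain ⟨ℓ, hℓ, hclass⟩ := BigradedLieAlgebra.exists_functional hquad hslope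
  obtain ⟨κ, _, m, d, g, ρ, hext⟩ := hsemi.exists_isFreeExtension hfree
  let instC : Module (SymmetricAlgebra ℚ S) 𝔢.CE :=
    Module.compHom _ (BigradedLieAlgebra.centralChainAction f hf).toRingHom
  let instH : Module (SymmetricAlgebra ℚ S) 𝔢.Homology :=
    Module.compHom _ (BigradedLieAlgebra.centralAction f hf).toRingHom
  have towerC : IsScalarTower ℚ (SymmetricAlgebra ℚ S) 𝔢.CE :=
    ⟨fun c r z => congrArg (fun φ : Module.End ℚ 𝔢.CE => φ z)
      (map_smul (BigradedLieAlgebra.centralChainAction f hf) c r)⟩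
  have towerH : IsScalarTower ℚ (SymmetricAlgebra ℚ S) 𝔢.Homology :=
    ⟨fun c r z => congrArg (fun φ : Module.End ℚ 𝔢.Homology => φ z)
      (map_smul (BigradedLieAlgebra.centralAction f hf) c r)⟩
  have hadj := SymmetricAlgebra.adjoin_eq_top hs'
  have hxs (j) : f (s' j) ∈ 𝔢.gr.shift ((C.den : ℤ) * u j) (C.num * u j) :=
    hsemi.isHom_left.1 _ _ _ (hu j).2.1
  have hact (j) (a : 𝔢.Homology) : SymmetricAlgebra.ι ℚ S (s' j) • a = (hf (s' j)).act a :=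
    congrArg (fun φ : Module.End ℚ 𝔢.Homology => φ a)
      (BigradedLieAlgebra.centralAction_ι f hf (s' j))
  obtain ⟨T, hT⟩ :=
    BigradedLieAlgebra.exists_restrictScalars_eq_ray hadj (fun j => hf (s' j)) hxs hact i₀
  -- The products of a homogeneous basis `y` of `𝔤` span `Sym(𝔤[1])`.
  obtain ⟨n', k', y, hy, hyspan⟩ := 𝔤.gr.exists_homogeneous_basis
  replace hyspan := hyspan.trans 𝔤.isInternal.submodule_iSup_eq_top
  have hy' (j) : y j ∈ 𝔤.gr.shift (n' j) (k' j + 1) := by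
    simpa [BigradedFamily.shift] using (hy j).1
  obtain ⟨F, hF, hFmem⟩ := BigradedLieAlgebra.exists_fg_genComplex (R := SymmetricAlgebra ℚ S) ℓ
    (fun r x p => BigradedLieAlgebra.ceι_mul_centralChainAction (hf := hf) r x p)
    (List.ofFn fun j => (n' j, k' j + 1, i (y j))) (by
      intro t ht
      obtain ⟨j, rfl⟩ := List.mem_ofFn.1 ht
      refine ⟨hsemi.isHom_left.1 _ _ _ (hy' j), ?_⟩
      rcases hclass _ _ _ (hy' j) (hy j).2 with h | h | ⟨h, hj⟩
      · exact Or.inl h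
      · exact Or.inr (Or.inl h)
      · have hyS : y j ∈ S := Submodule.mem_iSup_of_mem
          (p := fun p : ℤ × ℤ => 𝔤.extremal 𝔥 C p.1 p.2) (n' j, k' j + 1) hj
        exact Or.inr (Or.inr ⟨h, SymmetricAlgebra.ι ℚ S ⟨y j, hyS⟩, fun p =>
          (BigradedLieAlgebra.centralChainAction_ι (hf := hf) ⟨y j, hyS⟩ p).symm⟩))
    (I := LinearMap.range i) (by
      rintro _ ⟨a, rfl⟩
      have ha : a ∈ Submodule.span ℚ (Set.range y) := by rw [hyspan]; trivial
      have h1 := Submodule.mem_map_of_mem (f := i) ha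
      rw [Submodule.map_span] at h1
      refine Submodule.span_mono ?_ h1
      rintro _ ⟨_, ⟨j, rfl⟩, rfl⟩
      exact ⟨_, List.mem_ofFn.2 ⟨j, rfl⟩, rfl⟩) hext.mem (ℓ (0, i₀))
  obtain ⟨W, hW, hWmem⟩ := BigradedLieAlgebra.exists_fg_homologyMk_mem (R := SymmetricAlgebra ℚ S)
    (fun r z => BigradedLieAlgebra.ceD_centralChainAction (hf := hf) r z)
    (fun r z w h => BigradedLieAlgebra.centralAction_mk (hf := hf) r z w h) hF
  have hTW : T ≤ W := by
    have hle : 𝔢.homologyGr.ray C i₀ ≤ W.restrictScalars ℚ := by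
      refine iSup_le fun v a ha => ?_
      obtain ⟨z, hz, rfl⟩ := BigradedLieAlgebra.mem_homologyGr.1 ha
      obtain ⟨w, hw, hwgr, b, hb⟩ := hext.exists_homogeneous hz z.2
      have hwD : w ∈ LinearMap.ker 𝔢.ceD := by
        have := congrArg 𝔢.ceD hb
        rw [LinearMap.mem_ker.1 z.2, map_add, BigradedLieAlgebra.ceD_ceD, add_zero] at this
        exact this.symm
      rw [BigradedLieAlgebra.homologyMk_eq (w := ⟨w, hwD⟩) hb]
      refine hWmem _ (hFmem _ _ ?_ w hw hwgr)
      have := hℓ v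
      rw [show (((C.den : ℤ) * v, C.num * v + i₀) : ℤ × ℤ) = ((C.den : ℤ) * v, C.num * v) + (0, i₀) by simp,
        map_add, this, zero_add]
    rw [← hT] at hle
    exact hle
  have hnoeth : IsNoetherian (SymmetricAlgebra ℚ S) W := isNoetherian_of_fg_of_noetherian W hW
  have hnoethT : IsNoetherian (SymmetricAlgebra ℚ S) T := isNoetherian_of_le hTW
  have hgr := BigradedLieAlgebra.isPositivelyGraded_ray hadj (fun j => hf (s' j)) (fun j => (hu j).1) hxs hact hT
    hnoethT
  refine ⟨⟨T, ?_, isNoetherian_submodule.1 hnoeth T hTW⟩, fun v => ?_, ?_⟩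
  · exact congrArg (fun U : Submodule ℚ 𝔢.Homology => (U : Set 𝔢.Homology)) hT
  · have := hgr.finiteDimensional (C.den * v)
    rwa [hT, BigradedLieAlgebra.map_rayProj, if_pos (dvd_mul_right _ _), Nat.mul_div_cancel_left _ C.den_pos,
      Nat.cast_mul] at this
  · obtain ⟨q, hq, hqper, hqval⟩ :=
      (hgr.isEventuallyQuasiPolynomial hpos fun j => (hu j).2.2).exists_quasiPolynomial hpos
    refine ⟨q, hq, hqper, hqval.mono fun n hn => ?_⟩
    rw [← hn, hilbertFunction, hT, BigradedLieAlgebra.map_rayProj, BigradedFamily.rayDim]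
    by_cases h : C.den ∣ n
    · rw [if_pos h, if_pos h]
    · rw [if_neg h, if_neg h, finrank_bot]

end
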